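/- Let $N\ge 2$ be an integer, $a<b$ real numbers and $x\in(a,b)$. Let $p(t;x)=\frac1{2\pi}\int_{\mathbb R}e^{-iux}e^{-tu^{2N}}\,du$ ($t>0$) be the elementary solution of $\partial_t=(-1)^{N-1}\partial_x^{2N}$, with Fourier transform $\int_{\mathbb R}e^{iux}p(t;x)\,dx=e^{-tu^{2N}}$, and let $(X_t)_{t\ge0}$ be the pseudo-Brownian motion it drives: under the signed laws $\mathbb P_x$, $X_0=x$ and, for $0=t_0<t_1<\dots<t_k$ and $x_0=x$, $$\mathbb P_x\{X_{t_1}\in dx_1,\dots,X_{t_k}\in dx_k\}=\prod_{j=1}^k p(t_j-t_{j-1};x_{j-1}-x_j)\,dx_1\cdots dx_k .$$ For $n\in\mathbb N$ let $X_{n,s}=X_{\lfloor 2^n s\rfloor/2^n}$ be the dyadic step process, $m_{n,t}=\min_{0\le s\le t}X_{n,s}$, $M_{n,t}=\max_{0\le s\le t}X_{n,s}$. For the running minimum $m_t=\min_{0\le s\le t}X_s$ and maximum $M_t=\max_{0\le s\le t}X_s$ one defines $$\mathbb P_x\{a<m_t\le M_t<b\}:=\lim_{n\to\infty}\mathbb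 P_x\{a<m_{n,t}\le M_{n,t}<b\}.$$ For $\lambda>0$ put $\theta_\ell=e^{i\frac{2\ell+N-1}{2N}\pi}$ ($1\le\ell\le 2N$) and $e_\lambda^z=\exp(\lambda^{1/(2N)}z)$. Let $\Delta(\lambda)$ be the determinant of the $2N\times2N$ matrix whose first $N$ rows are $(\theta_\ell^{k}e_\lambda^{\theta_\ell a})_{1\le\ell\le2N}$, $k=0,\dots,N-1$, and whose last $N$ rows are $(\theta_\ell^{k}e_\lambda^{\theta_\ell b})_{1\le\ell\le2N}$, $k=0,\dots,N-1$. Let $\Delta_0^-(\lambda;x)$ (resp. $\Delta_0^+(\lambda;x)$) be the determinant obtained from it by replacing the row $(e_\lambda^{\theta_\ell a})_\ell$ (resp. $(e_\lambda^{\theta_\ell b})_\ell$) by $(e_\lambda^{\theta_\ell x})_\ell$. Then the limit defining $\mathbb P_x\{a<m_t\le M_t<b\}$ exists for every $t\ge0$, $\Delta(\lambda)\ne0$ for every $\lambda>0$, and there is a unique continuous function $J(\cdot\,;x)$ on $[0,\infty)$ whose Laplace transform converges absolutely for every $\lambda>0$ and satisfies $$\int_0^\infty J(t;x)\,e^{-\lambda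 t}\,dt=\frac1\lambda\,\frac{\Delta_0^+(\lambda;x)+\Delta_0^-(\lambda;x)}{\Delta(\lambda)}\qquad(\lambda>0).$$ The joint pseudo-distribution of $(m_t,M_t)$ is given by $$\mathbb P_x\{a<m_t\le M_t<b\}=1-J(t;x)\qquad(t\ge0),$$ and for every $\lambda>0$ its Laplace transform in $t$ converges absolutely and equals $$\int_0^\infty\mathbb P_x\{a<m_t\le M_t<b\}\,e^{-\lambda t}\,dt=\frac1\lambda\,\frac{\Delta(\lambda)-\Delta_0^+(\lambda;x)-\Delta_0^-(\lambda;x)}{\Delta(\lambda)} .$$ -/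

import Mathlib

open Filter MeasureTheory Set
open scoped Topology

noncomputable section

namespace PseudoBM

/-- The heat-type kernel `p(t; x)` of order `2N`, i.e. the function with Fourier transform
`∫ e^{iux} p(t; x) dx = e^{-t u^{2N}}`, given by Fourier inversion
`p(t; x) = (1 / 2π) ∫ e^{-iux} e^{-t u^{2N}} du` (the imaginary part vanishes by parity). -/
def kernel (N : ℕ) (t x : ℝ) : ℝ :=
  (2 * Real.pi)⁻¹ * ∫ u : ℝ, Real.cos (u * x) * Real.exp (-t * u ^ (2 * N))

/-- The transition kernel `p(t; x, y) = p(t; x - y)`. -/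
def transition (N : ℕ) (t x y : ℝ) : ℝ := kernel N t (x - y)

/-- The sequence of positions `x, y₁, …, y_k` (with irrelevant values after index `k`). -/
def positions (x : ℝ) {k : ℕ} (y : Fin k → ℝ) : ℕ → ℝ
  | 0 => x
  | j + 1 => if h : j < k then y ⟨j, h⟩ else 0

/-- The finite-dimensional signed law of the pseudo-process started at `x`: the pseudo-probability
`P_x{(X_{τ 1}, …, X_{τ k}) ∈ B}` for times `0 = τ 0 < τ 1 < … < τ k`, that is, the integral over
`B` of the density `∏_{j=1}^{k} p(τ j - τ (j-1); x_{j-1}, x_j)`, where `x_0 = x`. -/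
def pseudoProb (N : ℕ) (x : ℝ) (τ : ℕ → ℝ) (k : ℕ) (B : Set (Fin k → ℝ)) : ℝ :=
  ∫ y in B, ∏ j ∈ Finset.range k,
    transition N (τ (j + 1) - τ j) (positions x y j) (positions x y (j + 1))

/-- The step process `X_{n,s} = ∑_k 1_{[k/2^n, (k+1)/2^n)}(s) X_{k/2^n}`, for `s ≥ 0`, built from
the sequence `ω k = X_{k/2^n}`. -/
def stepPath (n : ℕ) (ω : ℕ → ℝ) (s : ℝ) : ℝ := ω ⌊(2 : ℝ) ^ n * s⌋₊

/-- `min_{s ∈ [0,t]} X_{n,s}` (finitely many values, so the infimum is a minimum). -/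
def runMin (n : ℕ) (ω : ℕ → ℝ) (t : ℝ) : ℝ := sInf (stepPath n ω '' Icc 0 t)

/-- `max_{s ∈ [0,t]} X_{n,s}` (finitely many values, so the supremum is a maximum). -/
def runMax (n : ℕ) (ω : ℕ → ℝ) (t : ℝ) : ℝ := sSup (stepPath n ω '' Icc 0 t)

/-- The pseudo-probability `P_x{a < m_{n,t} ≤ M_{n,t} < b}` for the running minimum and maximum of
the step process with mesh `2^{-n}`; the event depends only on `X_{j/2^n}`, `j ≤ ⌊2^n t⌋`. -/
def stepProb (N : ℕ) (a b x : ℝ) (n : ℕ) (t : ℝ) : ℝ :=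
  pseudoProb N x (fun j => (j : ℝ) / 2 ^ n) ⌊(2 : ℝ) ^ n * t⌋₊
    {y | a < runMin n (positions x y) t ∧
      runMin n (positions x y) t ≤ runMax n (positions x y) t ∧
      runMax n (positions x y) t < b}

/-- The pseudo-probability `P_x{a < m_t ≤ M_t < b}`, defined as the limit of the
pseudo-probabilities of the corresponding events for the dyadic step processes. -/
def minMaxProb (N : ℕ) (a b x t : ℝ) : ℝ :=
  limUnder atTop (fun n : ℕ => stepProb N a b x n t)

/-- The `2N`-th roots of `(-1)^(N-1)`: `θ_ℓ = exp(i (2ℓ + N - 1) π / (2N))`; the index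
`j = 0, …, 2N - 1` stands for `ℓ = j + 1`. -/
def theta (N : ℕ) (j : Fin (2 * N)) : ℂ :=
  Complex.exp (Complex.I * (((2 * ((j : ℕ) + 1) + N - 1 : ℝ) / (2 * N) * Real.pi : ℝ) : ℂ))

/-- `e_λ^{z} = exp(λ^{1/(2N)} z)`. -/
def eLam (N : ℕ) (lam : ℝ) (z : ℂ) : ℂ :=
  Complex.exp (((lam ^ (1 / (2 * N : ℝ)) : ℝ) : ℂ) * z)

/-- The `2N × 2N` matrix whose row `i < N` is `(θ_ℓ^i e_λ^{θ_ℓ a})_ℓ` and whose row `N + i`,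
`i < N`, is `(θ_ℓ^i e_λ^{θ_ℓ b})_ℓ`. -/
def bvMatrix (N : ℕ) (a b lam : ℝ) : Matrix (Fin (2 * N)) (Fin (2 * N)) ℂ :=
  Matrix.of fun i j =>
    if (i : ℕ) < N then theta N j ^ (i : ℕ) * eLam N lam (theta N j * a)
    else theta N j ^ ((i : ℕ) - N) * eLam N lam (theta N j * b)

/-- The determinant `Δ(λ)`. -/
def Delta (N : ℕ) (a b lam : ℝ) : ℂ := (bvMatrix N a b lam).det

/-- The determinant obtained from `Δ(λ)` on replacing row `r` by `(e_λ^{θ_ℓ x})_ℓ`. -/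
def DeltaRow (N : ℕ) (a b lam x : ℝ) (r : ℕ) : ℂ :=
  (Matrix.of fun i j : Fin (2 * N) =>
    if (i : ℕ) = r then eLam N lam (theta N j * x) else bvMatrix N a b lam i j).det

/-- The determinant `Δ_k^-(λ; x)`, `0 ≤ k ≤ N - 1`. -/
def DeltaMinus (N : ℕ) (a b lam x : ℝ) (k : ℕ) : ℂ := DeltaRow N a b lam x k

/-- The determinant `Δ_k^+(λ; x)`, `0 ≤ k ≤ N - 1`. -/
def DeltaPlus (N : ℕ) (a b lam x : ℝ) (k : ℕ) : ℂ := DeltaRow N a b lam x (N + k)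

/-- `J = J(·; x)` is the continuous function on `[0, ∞)` characterized by its Laplace transform
`∫_0^∞ J(t; x) e^{-λt} dt = (1/λ) (Δ_0^+(λ; x) + Δ_0^-(λ; x)) / Δ(λ)` for all `λ > 0`. -/
structure IsExitFunction (N : ℕ) (a b x : ℝ) (J : ℝ → ℝ) : Prop where
  continuousOn : ContinuousOn J (Ici 0)
  integrable : ∀ lam : ℝ, 0 < lam → IntegrableOn (fun t => J t * Real.exp (-lam * t)) (Ioi 0)
  laplace : ∀ lam : ℝ, 0 < lam →
    ((∫ t in Ioi (0 : ℝ), J t * Real.exp (-lam * t) : ℝ) : ℂ) =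
      1 / (lam : ℂ) *
        ((DeltaPlus N a b lam x 0 + DeltaMinus N a b lam x 0) / Delta N a b lam)

end PseudoBM

end

open scoped FourierTransform ComplexConjugate InnerProductSpace SchwartzMap ContDiff

noncomputable section

namespace PseudoBM

/-! Let A = (-1)^N D^{2N}, with symbol s(ξ) = (2πξ)^{2N}, and let T_h be the compression of e^{-hA}
to L²(a, b). Integrating the path density one step at a time shows that the pseudo-probability with
mesh h = 2^{-n} is the value at x of T_h^k 1, k = ⌊2^n t⌋ (`stepProb_eq_stepVal`). The theorem is
thus a product formula: T_h^k 1 converges to the semigroup of A with Dirichlet conditions of order N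
at a and b. The kernel is signed, so no maximum principle is available; what survives is 0 ≤ T_h ≤ 1
on L², because the multiplier e^{-hs} lies in [0, 1].

Resolvents. The Laplace transform of the discrete flow solves a discrete resolvent equation.
Extended by zero, the solution v of λv + Av = 1 with Dirichlet conditions satisfies the equation up
to derivatives of order < N of point masses at a and b. The operator (1 - T_h)/h sees these masses
smeared over the width δ = h^{1/(2N)}, and a smeared mass may be traded for a bump just outside (a,
b), invisible to functions on (a, b), at a cost O(√δ) in the energy norm (`exists_boundary_bound`).
Coercivity then gives `tendsto_stepResolvent`. The same convergence with zero datum gives uniqueness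
for the Dirichlet problem, hence Δ(λ) ≠ 0 (`Delta_ne_zero`), and Cramer's rule expresses v by
determinants.

Fixed times. Positivity gives ‖T^k f - T^{k+1} f‖ ≤ ‖f‖/(k+1), so the flows are equicontinuous away
from t = 0 up to the time step, and Weierstrass approximation in the variable e^{-t} upgrades
convergence of Laplace transforms to convergence in L² for each t > 0 (`exists_tendsto_stepFlow`).

Fixed points. The last kernel step smooths: an energy of order 1/t yields pointwise bounds and a
modulus of continuity uniform in n, with a weight of order t^{-1/2} near 0, which is integrable.
Hence the values at x converge (`tendsto_limVal`) and their Laplace transform is v(x)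
(`integral_exp_mul_limVal`). Continuity at t = 0 needs a separate argument, which transports a
cut-off heat kernel through the powers of T_h (`exists_norm_sg_pow_sub_le`). The function J is one
minus the limit, unique because the Laplace transform is injective. -/

variable {a b : ℝ}

/-! ### Fourier transform on the line: duality and Plancherel. -/

theorem continuous_fourier {f : ℝ → ℂ} (hf : Integrable f) : Continuous (𝓕 f) :=
  VectorFourier.fourierIntegral_continuous Real.continuous_fourierChar
    (innerSL ℝ).continuous₂ hf

theorem norm_fourier_le (f : ℝ → ℂ) (ξ : ℝ) : ‖𝓕 f ξ‖ ≤ ∫ y, ‖f y‖ :=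
  VectorFourier.norm_fourierIntegral_le_integral_norm _ _ _ _ _

theorem integral_fourier_mul {f g : ℝ → ℂ} (hf : Integrable f) (hg : Integrable g) :
    ∫ ξ, 𝓕 f ξ * g ξ = ∫ x, f x * 𝓕 g x := by
  have := VectorFourier.integral_fourierIntegral_smul_eq_flip (μ := volume) (ν := volume)
    (L := (innerₗ ℝ : ℝ →ₗ[ℝ] ℝ →ₗ[ℝ] ℝ)) (f := f) (g := g) Real.continuous_fourierChar
    (innerSL ℝ).continuous₂ hf hg
  rw [flip_innerₗ] at this
  exact this

/-- The L² transform and the integral transform define the same distribution: against a test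
function, both move the transform onto the test function. This makes Plancherel usable for the
concrete integrals below. -/
theorem fourier_toLp_ae_eq {f : ℝ → ℂ} (hf : Integrable f) (hf2 : MemLp f 2) :
    (𝓕 (hf2.toLp f) : Lp ℂ 2 (volume : Measure ℝ)) =ᵐ[volume] 𝓕 f := by
  apply ae_eq_of_integral_contDiff_smul_eq
  · exact (Lp.memLp _).locallyIntegrable (by norm_num)
  · exact (continuous_fourier hf).locallyIntegrable
  intro g hg hgc
  have hg' : ContDiff ℝ ∞ (fun x => (g x : ℂ)) := Complex.ofRealCLM.contDiff.comp hg
  have hgc' : HasCompactSupport (fun x => (g x : ℂ)) := hgc.comp_left (g := ((↑) : ℝ → ℂ)) rfl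
  set φ : 𝓢(ℝ, ℂ) := hgc'.toSchwartzMap hg' with hφ
  have e1 := congrArg (fun T => T φ) (Lp.fourier_toTemperedDistribution_eq (hf2.toLp f))
  simp only [TemperedDistribution.fourier_apply, Lp.toTemperedDistribution_apply] at e1
  have h1 : ∫ x, g x • (𝓕 (hf2.toLp f) : Lp ℂ 2 (volume : Measure ℝ)) x =
      ∫ x, φ x • (𝓕 (hf2.toLp f) : Lp ℂ 2 (volume : Measure ℝ)) x := by
    congr 1
  rw [h1, ← e1]
  have h2 : ∫ x, g x • 𝓕 f x = ∫ x, 𝓕 f x * φ x := by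
    congr 1; ext x; rw [mul_comm]; rfl
  rw [h2, integral_fourier_mul hf φ.integrable]
  apply integral_congr_ae
  filter_upwards [hf2.coeFn_toLp] with x hx
  rw [hx, smul_eq_mul, mul_comm, SchwartzMap.fourier_coe]

theorem memLp_fourier {f : ℝ → ℂ} (hf : Integrable f) (hf2 : MemLp f 2) : MemLp (𝓕 f) 2 :=
  (memLp_congr_ae (fourier_toLp_ae_eq hf hf2)).1 (Lp.memLp _)

theorem integral_conj_fourier_mul {f g : ℝ → ℂ} (hf : Integrable f) (hf2 : MemLp f 2)
    (hg : Integrable g) (hg2 : MemLp g 2) :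
    ∫ ξ, conj (𝓕 f ξ) * 𝓕 g ξ = ∫ x, conj (f x) * g x := by
  have h := Lp.inner_fourier_eq (hf2.toLp f) (hg2.toLp g)
  rw [L2.inner_def, L2.inner_def] at h
  calc _ = _ := ?_
    _ = _ := h
    _ = _ := ?_
  · apply integral_congr_ae
    filter_upwards [fourier_toLp_ae_eq hf hf2, fourier_toLp_ae_eq hg hg2] with x h1 h2
    simp [h1, h2, mul_comm]
  · apply integral_congr_ae
    filter_upwards [hf2.coeFn_toLp, hg2.coeFn_toLp] with x h1 h2
    simp [h1, h2, mul_comm]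

/-! ### L²(a, b), extended by zero, on the Fourier side. -/

/-- Lebesgue measure on `(a, b)`. -/
abbrev ivl (a b : ℝ) : Measure ℝ := volume.restrict (Ioo a b)

/-- The complex Hilbert space `L²(a, b)`. -/
abbrev L2i (a b : ℝ) := Lp ℂ 2 (ivl a b)

/-- Extension by zero of a function on `(a, b)`. -/
def ext0 (a b : ℝ) (f : ℝ → ℂ) : ℝ → ℂ := (Ioo a b).indicator f

/-- The Fourier transform of a function on `(a, b)`, extended by zero. -/
def hat (a b : ℝ) (f : ℝ → ℂ) : ℝ → ℂ := 𝓕 (ext0 a b f)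

theorem integrable_of_memLp_ivl {f : ℝ → ℂ} (hf : MemLp f 2 (ivl a b)) : Integrable f (ivl a b) :=
  hf.integrable (by norm_num)

theorem integrable_ext0 {f : ℝ → ℂ} (hf : MemLp f 2 (ivl a b)) : Integrable (ext0 a b f) :=
  (integrable_indicator_iff measurableSet_Ioo).2 (integrable_of_memLp_ivl hf)

theorem memLp_ext0 {f : ℝ → ℂ} (hf : MemLp f 2 (ivl a b)) : MemLp (ext0 a b f) 2 :=
  (memLp_indicator_iff_restrict measurableSet_Ioo).2 hf

theorem ext0_congr {f g : ℝ → ℂ} (h : f =ᵐ[ivl a b] g) : ext0 a b f =ᵐ[volume] ext0 a b g := by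
  have := (ae_restrict_iff' measurableSet_Ioo).1 h
  filter_upwards [this] with x hx
  by_cases hx' : x ∈ Ioo a b
  · simp [ext0, hx', hx hx']
  · simp [ext0, hx']

theorem hat_congr {f g : ℝ → ℂ} (h : f =ᵐ[ivl a b] g) : hat a b f = hat a b g := by
  ext ξ; exact Real.fourier_congr_ae (ext0_congr h) ξ

theorem continuous_hat {f : ℝ → ℂ} (hf : MemLp f 2 (ivl a b)) : Continuous (hat a b f) :=
  continuous_fourier (integrable_ext0 hf)

theorem memLp_hat {f : ℝ → ℂ} (hf : MemLp f 2 (ivl a b)) : MemLp (hat a b f) 2 :=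
  memLp_fourier (integrable_ext0 hf) (memLp_ext0 hf)

theorem norm_hat_le (f : ℝ → ℂ) (ξ : ℝ) : ‖hat a b f ξ‖ ≤ ∫ y, ‖f y‖ ∂(ivl a b) := by
  refine (norm_fourier_le _ ξ).trans (le_of_eq ?_)
  rw [← integral_indicator measurableSet_Ioo]
  congr 1; ext y
  by_cases hy : y ∈ Ioo a b <;> simp [ext0, hy]

theorem hat_eq_integral (f : ℝ → ℂ) (ξ : ℝ) :
    hat a b f ξ = ∫ y, Complex.exp ((-2 * Real.pi * y * ξ : ℝ) * Complex.I) * f y ∂(ivl a b) := by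
  rw [hat, Real.fourier_real_eq_integral_exp_smul, ← integral_indicator measurableSet_Ioo]
  congr 1; ext y
  by_cases hy : y ∈ Ioo a b <;> simp [ext0, hy]

theorem hat_smul (c : ℂ) (f : ℝ → ℂ) (ξ : ℝ) :
    hat a b (c • f) ξ = c * hat a b f ξ := by
  rw [hat_eq_integral, hat_eq_integral, ← integral_const_mul]
  congr 1; ext y; simp; ring

theorem integral_conj_hat_mul {f g : ℝ → ℂ} (hf : MemLp f 2 (ivl a b))
    (hg : MemLp g 2 (ivl a b)) :
    ∫ ξ, conj (hat a b f ξ) * hat a b g ξ = ∫ x, conj (f x) * g x ∂(ivl a b) := by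
  rw [hat, hat, integral_conj_fourier_mul (integrable_ext0 hf) (memLp_ext0 hf)
    (integrable_ext0 hg) (memLp_ext0 hg), ← integral_indicator measurableSet_Ioo]
  congr 1; ext y
  by_cases hy : y ∈ Ioo a b <;> simp [ext0, hy]

theorem inner_eq_integral_hat (f g : L2i a b) :
    ⟪f, g⟫_ℂ = ∫ ξ, conj (hat a b f ξ) * hat a b g ξ := by
  rw [integral_conj_hat_mul (Lp.memLp f) (Lp.memLp g), L2.inner_def]
  congr 1; ext y; simp [mul_comm]

theorem norm_sq_eq_integral_hat (f : L2i a b) : ‖f‖ ^ 2 = ∫ ξ, ‖hat a b f ξ‖ ^ 2 := by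
  have h := inner_eq_integral_hat f f
  rw [inner_self_eq_norm_sq_to_K] at h
  have h2 : ∫ ξ, conj (hat a b f ξ) * hat a b f ξ = ((∫ ξ, ‖hat a b f ξ‖ ^ 2 : ℝ) : ℂ) := by
    rw [← integral_complex_ofReal]
    congr 1; ext y
    rw [Complex.conj_mul']; push_cast; rfl
  rw [h2] at h
  exact Complex.ofReal_injective (by push_cast at h ⊢; exact h)

theorem integrable_norm_sq_hat {f : ℝ → ℂ} (hf : MemLp f 2 (ivl a b)) :
    Integrable (fun ξ => ‖hat a b f ξ‖ ^ 2) :=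
  (memLp_two_iff_integrable_sq_norm (continuous_hat hf).aestronglyMeasurable).1 (memLp_hat hf)

/-! ### The symbol, its multiplier and the heat-type kernel. -/

/-- The symbol `(2πξ)^{2N}` of the operator `(-1)^N D^{2N}` in the frequency variable `ξ`. -/
def sym (N : ℕ) (ξ : ℝ) : ℝ := (2 * Real.pi * ξ) ^ (2 * N)

theorem sym_nonneg (N : ℕ) (ξ : ℝ) : 0 ≤ sym N ξ := by
  unfold sym; rw [pow_mul]; positivity

theorem sym_neg (N : ℕ) (ξ : ℝ) : sym N (-ξ) = sym N ξ := by
  unfold sym; rw [pow_mul, pow_mul]; congr 1; ring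

theorem continuous_sym (N : ℕ) : Continuous (sym N) := by
  unfold sym; fun_prop

/-- Quadratic growth suffices for the integrability claims: it dominates e^{-hs} by a Gaussian and
1/(1 + s) by a Cauchy density. -/
theorem sq_le_sym_add_one {N : ℕ} (hN : 0 < N) (ξ : ℝ) : ξ ^ 2 ≤ sym N ξ + 1 := by
  have hpi := Real.pi_gt_three
  by_cases h : 1 ≤ (2 * Real.pi * ξ) ^ 2
  · have h1 : (2 * Real.pi * ξ) ^ 2 ≤ sym N ξ := by
      unfold sym; rw [pow_mul]; exact le_self_pow₀ h hN.ne'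
    have h2 : ξ ^ 2 ≤ (2 * Real.pi * ξ) ^ 2 := by
      rw [mul_pow]; exact le_mul_of_one_le_left (sq_nonneg ξ) (by nlinarith)
    linarith
  · push Not at h
    have h2 : ξ ^ 2 ≤ (2 * Real.pi * ξ) ^ 2 := by
      rw [mul_pow]; exact le_mul_of_one_le_left (sq_nonneg ξ) (by nlinarith)
    linarith [sym_nonneg N ξ]

theorem integrable_one_add_abs_pow_mul_exp_sq (m : ℕ) {h : ℝ} (hh : 0 < h) :
    Integrable (fun ξ : ℝ => (1 + |ξ|) ^ m * Real.exp (-h * ξ ^ 2)) := by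
  have h0 : ∀ k : ℕ, Integrable (fun ξ : ℝ => |ξ| ^ k * Real.exp (-h * ξ ^ 2)) := fun k => by
    have := (integrable_rpow_mul_exp_neg_mul_sq hh (s := k) (by
      have : (0 : ℝ) ≤ k := k.cast_nonneg
      linarith)).norm
    refine this.congr (Eventually.of_forall fun ξ => ?_)
    simp
  have h1 := ((h0 0).add (h0 m)).const_mul (2 ^ (m - 1))
  refine h1.mono' (by fun_prop) (Eventually.of_forall fun ξ => ?_)
  have h2 := add_pow_le (zero_le_one (α := ℝ)) (abs_nonneg ξ) m
  have h3 := Real.exp_nonneg (-h * ξ ^ 2)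
  rw [Real.norm_of_nonneg (by positivity)]
  simp only [Pi.add_apply, one_pow, pow_zero] at *
  nlinarith

theorem integrable_one_add_abs_pow_mul_exp_sym {N : ℕ} (hN : 0 < N) (m : ℕ) {h : ℝ} (hh : 0 < h) :
    Integrable (fun ξ : ℝ => (1 + |ξ|) ^ m * Real.exp (-h * sym N ξ)) := by
  refine ((integrable_one_add_abs_pow_mul_exp_sq m hh).const_mul (Real.exp h)).mono'
    ((by fun_prop : Continuous fun ξ : ℝ => (1 + |ξ|) ^ m).mul
      (Real.continuous_exp.comp (continuous_const.mul (continuous_sym N)))).aestronglyMeasurable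
      (Eventually.of_forall fun ξ => ?_)
  rw [Real.norm_of_nonneg (by positivity)]
  have : Real.exp (-h * sym N ξ) ≤ Real.exp h * Real.exp (-h * ξ ^ 2) := by
    rw [← Real.exp_add]
    apply Real.exp_le_exp.2
    nlinarith [sq_le_sym_add_one hN ξ]
  calc _ ≤ (1 + |ξ|) ^ m * (Real.exp h * Real.exp (-h * ξ ^ 2)) := by gcongr
    _ = _ := by ring

/-- The Fourier multiplier `e^{-h (2πξ)^{2N}}` of the heat-type semigroup. -/
def mult (N : ℕ) (h ξ : ℝ) : ℂ := (Real.exp (-h * sym N ξ) : ℝ)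

theorem continuous_mult (N : ℕ) (h : ℝ) : Continuous (mult N h) :=
  Complex.continuous_ofReal.comp
    (Real.continuous_exp.comp (continuous_const.mul (continuous_sym N)))

theorem norm_mult (N : ℕ) (h ξ : ℝ) : ‖mult N h ξ‖ = Real.exp (-h * sym N ξ) := by
  rw [mult, Complex.norm_real, Real.norm_of_nonneg (Real.exp_nonneg _)]

theorem norm_mult_le_one (N : ℕ) {h : ℝ} (hh : 0 ≤ h) (ξ : ℝ) : ‖mult N h ξ‖ ≤ 1 := by
  rw [norm_mult, Real.exp_le_one_iff]
  nlinarith [sym_nonneg N ξ, mul_nonneg hh (sym_nonneg N ξ)]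

theorem integrable_mult {N : ℕ} (hN : 0 < N) {h : ℝ} (hh : 0 < h) : Integrable (mult N h) := by
  have := integrable_one_add_abs_pow_mul_exp_sym hN 0 hh
  simp only [pow_zero, one_mul] at this
  exact this.ofReal

theorem kernel_eq_integral {N : ℕ} (hN : 0 < N) {h : ℝ} (hh : 0 < h) (x : ℝ) :
    (kernel N h x : ℂ) = 𝓕⁻ (mult N h) x := by
  have e0 : kernel N h x = ∫ ξ : ℝ, Real.cos (2 * Real.pi * ξ * x) * Real.exp (-h * sym N ξ) := by
    have := Measure.integral_comp_mul_left
      (fun u => Real.cos (u * x) * Real.exp (-h * u ^ (2 * N))) (2 * Real.pi)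
    unfold kernel sym
    rw [this, smul_eq_mul, abs_of_pos (by positivity)]
  have hint : Integrable (fun v : ℝ =>
      Complex.exp (↑(2 * Real.pi * inner ℝ v x) * Complex.I) * mult N h v) := by
    refine (integrable_mult hN hh).bdd_mul (c := 1) ?_ ?_
    · exact (by simp only [RCLike.inner_apply, conj_trivial]; fun_prop : Continuous fun v : ℝ =>
        Complex.exp (↑(2 * Real.pi * inner ℝ v x) * Complex.I)).aestronglyMeasurable
    · exact Eventually.of_forall fun y => (Complex.norm_exp_ofReal_mul_I _).le
  rw [e0, Real.fourierInv_eq']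
  simp only [smul_eq_mul]
  -- The multiplier is even, so the integral equals its average with its reflection, in which the
  -- exponential becomes a cosine.
  have e1 := integral_neg_eq_self (fun v : ℝ =>
      Complex.exp (↑(2 * Real.pi * inner ℝ v x) * Complex.I) * mult N h v) volume
  have e2 : ∀ z w : ℂ, w = z → z = (1 / 2) * (z + w) := by intro z w h; rw [h]; ring
  rw [e2 _ _ e1, ← integral_add hint hint.comp_neg, ← integral_const_mul, ← integral_complex_ofReal]
  congr 1; ext v
  have : mult N h (-v) = mult N h v := by simp [mult, sym_neg]
  rw [this, mult]
  simp only [RCLike.inner_apply, conj_trivial]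
  push_cast
  rw [Complex.cos]
  have e3 : (2 * (Real.pi : ℂ) * (x * -v) * Complex.I) = -(2 * (Real.pi:ℂ) * v * x) * Complex.I := by
    ring
  have e4 : (2 * (Real.pi : ℂ) * (x * v) * Complex.I) = (2 * (Real.pi:ℂ) * v * x) * Complex.I := by
    ring
  rw [e3, e4]; ring

theorem continuous_fourierInv {f : ℝ → ℂ} (hf : Integrable f) : Continuous (𝓕⁻ f) := by
  rw [Real.fourierInv_eq_fourier_comp_neg]
  exact continuous_fourier hf.comp_neg

theorem norm_fourierInv_le (f : ℝ → ℂ) (x : ℝ) : ‖𝓕⁻ f x‖ ≤ ∫ y, ‖f y‖ := by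
  rw [Real.fourierInv_eq_fourier_neg]
  exact norm_fourier_le _ _

theorem continuous_kernel {N : ℕ} (hN : 0 < N) {h : ℝ} (hh : 0 < h) :
    Continuous (kernel N h) := by
  have : kernel N h = fun x => (𝓕⁻ (mult N h) x).re := by
    ext x; rw [← kernel_eq_integral hN hh]; simp
  rw [this]
  exact Complex.continuous_re.comp (continuous_fourierInv (integrable_mult hN hh))

theorem abs_kernel_le {N : ℕ} (hN : 0 < N) {h : ℝ} (hh : 0 < h) (x : ℝ) :
    |kernel N h x| ≤ ∫ y, ‖mult N h y‖ := by
  have := norm_fourierInv_le (mult N h) x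
  rwa [← kernel_eq_integral hN hh, Complex.norm_real] at this

theorem integral_conj_fourier_mul_eq {f g : ℝ → ℂ} (hf : Integrable f) (hg : Integrable g) :
    ∫ ξ, conj (𝓕 f ξ) * g ξ = ∫ x, conj (f x) * 𝓕⁻ g x := by
  have := VectorFourier.integral_sesq_fourierIntegral_eq_neg_flip (μ := volume) (ν := volume)
    (L := (innerₗ ℝ : ℝ →ₗ[ℝ] ℝ →ₗ[ℝ] ℝ)) (f := f) (g := g) (innerSL ℂ)
    Real.continuous_fourierChar (innerSL ℝ).continuous₂ hf hg
  rw [flip_innerₗ] at this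
  simp only [innerSL_apply_apply, RCLike.inner_apply] at this
  simp only [mul_comm (conj _)]
  exact this

/-! ### The compressed semigroup on L²(a, b) and its energy form. -/

/-- `e^{-hA} f`, evaluated on the whole line, for `f` on `(a, b)` extended by zero. -/
def sg (a b : ℝ) (N : ℕ) (h : ℝ) (f : ℝ → ℂ) : ℝ → ℂ := 𝓕⁻ (fun ξ => mult N h ξ * hat a b f ξ)

theorem integrable_mult_mul_hat {N : ℕ} (hN : 0 < N) {h : ℝ} (hh : 0 < h) {f : ℝ → ℂ}
    (hf : MemLp f 2 (ivl a b)) : Integrable (fun ξ => mult N h ξ * hat a b f ξ) :=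
  (integrable_mult hN hh).mul_bdd (continuous_hat hf).aestronglyMeasurable
    (Eventually.of_forall (norm_hat_le f))

theorem continuous_sg {N : ℕ} (hN : 0 < N) {h : ℝ} (hh : 0 < h) {f : ℝ → ℂ}
    (hf : MemLp f 2 (ivl a b)) : Continuous (sg a b N h f) :=
  continuous_fourierInv (integrable_mult_mul_hat hN hh hf)

theorem memLp_sg {N : ℕ} (hN : 0 < N) {h : ℝ} (hh : 0 < h) {f : ℝ → ℂ}
    (hf : MemLp f 2 (ivl a b)) : MemLp (sg a b N h f) 2 (ivl a b) :=
  MemLp.of_bound (continuous_sg hN hh hf).aestronglyMeasurable _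
    (Eventually.of_forall (norm_fourierInv_le _))

theorem sg_congr {N : ℕ} {h : ℝ} {f g : ℝ → ℂ} (hfg : f =ᵐ[ivl a b] g) :
    sg a b N h f = sg a b N h g := by
  rw [sg, sg, hat_congr hfg]

theorem sg_eq_integral_kernel {N : ℕ} (hN : 0 < N) {h : ℝ} (hh : 0 < h) {f : ℝ → ℂ}
    (hf : MemLp f 2 (ivl a b)) (x : ℝ) :
    sg a b N h f x = ∫ y, (kernel N h (x - y) : ℂ) * f y ∂(ivl a b) := by
  have hg : Integrable (fun ξ : ℝ => Complex.exp (↑(2 * Real.pi * inner ℝ ξ x) * Complex.I) *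
      mult N h ξ) := by
    refine (integrable_mult hN hh).bdd_mul (c := 1) ?_ ?_
    · exact (by simp only [RCLike.inner_apply, conj_trivial]; fun_prop : Continuous fun v : ℝ =>
        Complex.exp (↑(2 * Real.pi * inner ℝ v x) * Complex.I)).aestronglyMeasurable
    · exact Eventually.of_forall fun y => (Complex.norm_exp_ofReal_mul_I _).le
  have h1 := integral_fourier_mul (integrable_ext0 hf) hg
  rw [sg, Real.fourierInv_eq', ← integral_indicator measurableSet_Ioo]
  calc _ = _ := ?_
    _ = _ := h1
    _ = _ := ?_
  · congr 1; ext ξ; rw [hat, smul_eq_mul]; ring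
  · congr 1; ext y
    have : 𝓕 (fun ξ : ℝ => Complex.exp (↑(2 * Real.pi * inner ℝ ξ x) * Complex.I) * mult N h ξ) y
        = (kernel N h (x - y) : ℂ) := by
      rw [kernel_eq_integral hN hh, Real.fourierInv_eq', Real.fourier_real_eq_integral_exp_smul]
      congr 1; ext v
      simp only [smul_eq_mul, RCLike.inner_apply, conj_trivial]
      rw [← mul_assoc, ← Complex.exp_add]
      congr 2; push_cast; ring
    rw [this]
    by_cases hy : y ∈ Ioo a b <;> simp [ext0, hy, mul_comm]

theorem sg_add {N : ℕ} (hN : 0 < N) {h : ℝ} (hh : 0 < h) {f g : ℝ → ℂ}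
    (hf : MemLp f 2 (ivl a b)) (hg : MemLp g 2 (ivl a b)) (x : ℝ) :
    sg a b N h (f + g) x = sg a b N h f x + sg a b N h g x := by
  have hK : ∀ f : ℝ → ℂ, MemLp f 2 (ivl a b) →
      Integrable (fun y => (kernel N h (x - y) : ℂ) * f y) (ivl a b) := fun f hf => by
    refine (integrable_of_memLp_ivl hf).bdd_mul (c := ∫ y, ‖mult N h y‖) ?_ ?_
    · exact (Complex.continuous_ofReal.comp ((continuous_kernel hN hh).comp
        (continuous_const.sub continuous_id))).aestronglyMeasurable
    · exact Eventually.of_forall fun y => by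
        rw [Complex.norm_real]; exact abs_kernel_le hN hh _
  rw [sg_eq_integral_kernel hN hh hf, sg_eq_integral_kernel hN hh hg,
    sg_eq_integral_kernel hN hh (hf.add hg), ← integral_add (hK f hf) (hK g hg)]
  congr 1; ext y; simp; ring

theorem sg_smul {N : ℕ} (hN : 0 < N) {h : ℝ} (hh : 0 < h) (c : ℂ) {f : ℝ → ℂ}
    (hf : MemLp f 2 (ivl a b)) (x : ℝ) :
    sg a b N h (c • f) x = c * sg a b N h f x := by
  rw [sg_eq_integral_kernel hN hh hf, sg_eq_integral_kernel hN hh (hf.const_smul c),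
    ← integral_const_mul]
  congr 1; ext y; simp; ring

/-- Since g vanishes outside (a, b), the compression is invisible to the pairing, which becomes
plain multiplication by e^{-hs}. Symmetry, positivity and contractivity of the compression are all
read off from this. -/
theorem integral_conj_mul_sg {N : ℕ} (hN : 0 < N) {h : ℝ} (hh : 0 < h) {f g : ℝ → ℂ}
    (hf : MemLp f 2 (ivl a b)) (hg : MemLp g 2 (ivl a b)) :
    ∫ x, conj (g x) * sg a b N h f x ∂(ivl a b) =
      ∫ ξ, mult N h ξ * (conj (hat a b g ξ) * hat a b f ξ) := by
  have h1 := integral_conj_fourier_mul_eq (integrable_ext0 hg)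
    (integrable_mult_mul_hat hN hh hf)
  rw [← integral_indicator measurableSet_Ioo]
  calc _ = _ := ?_
    _ = _ := h1.symm
    _ = _ := ?_
  · congr 1; ext y
    by_cases hy : y ∈ Ioo a b <;> simp [ext0, hy, sg]
  · congr 1; ext ξ; rw [hat, hat]; ring

theorem integrable_conj_hat_mul {f g : ℝ → ℂ}
    (hf : MemLp f 2 (ivl a b)) (hg : MemLp g 2 (ivl a b)) :
    Integrable (fun ξ => conj (hat a b g ξ) * hat a b f ξ) := by
  have h1 := memLp_hat hf
  have h2 := (memLp_hat hg).star
  exact h2.integrable_mul h1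

/-- The compression `χ e^{-hA} χ` of the heat-type semigroup to `L²(a, b)`, as a linear map. -/
def compLin (a b : ℝ) (N : ℕ) (hN : 0 < N) (h : ℝ) (hh : 0 < h) : L2i a b →ₗ[ℂ] L2i a b where
  toFun f := (memLp_sg hN hh (Lp.memLp f)).toLp _
  map_add' f g := by
    rw [← MemLp.toLp_add]
    refine MemLp.toLp_congr _ _ (Eventually.of_forall fun x => ?_)
    rw [sg_congr (Lp.coeFn_add f g), sg_add hN hh (Lp.memLp f) (Lp.memLp g)]; rfl
  map_smul' c f := by
    rw [RingHom.id_apply, ← MemLp.toLp_const_smul]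
    refine MemLp.toLp_congr _ _ (Eventually.of_forall fun x => ?_)
    rw [sg_congr (Lp.coeFn_smul c f), sg_smul hN hh c (Lp.memLp f)]; rfl

theorem coeFn_compLin {N : ℕ} (hN : 0 < N) {h : ℝ} (hh : 0 < h) (f : L2i a b) :
    compLin a b N hN h hh f =ᵐ[ivl a b] sg a b N h f :=
  (memLp_sg hN hh (Lp.memLp f)).coeFn_toLp

theorem inner_compLin {N : ℕ} (hN : 0 < N) {h : ℝ} (hh : 0 < h) (f g : L2i a b) :
    ⟪g, compLin a b N hN h hh f⟫_ℂ = ∫ ξ, mult N h ξ * (conj (hat a b g ξ) * hat a b f ξ) := by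
  rw [← integral_conj_mul_sg hN hh (Lp.memLp f) (Lp.memLp g), L2.inner_def]
  apply integral_congr_ae
  filter_upwards [coeFn_compLin hN hh f] with x hx
  rw [hx]; simp [mul_comm]

/-- For g = T f, the pairing of g with T f on the Fourier side and Cauchy–Schwarz give ‖g‖² ≤ ‖g‖
‖f‖. -/
theorem norm_compLin_le {N : ℕ} (hN : 0 < N) {h : ℝ} (hh : 0 < h) (f : L2i a b) :
    ‖compLin a b N hN h hh f‖ ≤ 1 * ‖f‖ := by
  set g := compLin a b N hN h hh f with hg
  have h1 : ‖g‖ * ‖g‖ = ‖⟪g, g⟫_ℂ‖ := by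
    rw [inner_self_eq_norm_sq_to_K]; simp [sq]
  have h2 : ‖⟪g, g⟫_ℂ‖ ≤ ∫ ξ, ‖hat a b g ξ‖ * ‖hat a b f ξ‖ := by
    conv_lhs => rw [hg, ← hg, inner_compLin hN hh]
    refine norm_integral_le_of_norm_le ?_ (Eventually.of_forall fun ξ => ?_)
    · have := (integrable_conj_hat_mul (Lp.memLp f) (Lp.memLp g)).norm
      simpa using this
    · rw [norm_mul, norm_mul, RCLike.norm_conj]
      exact mul_le_of_le_one_left (by positivity) (norm_mult_le_one N hh.le ξ)
  have h3 : ∫ ξ, ‖hat a b g ξ‖ * ‖hat a b f ξ‖ ≤ ‖g‖ * ‖f‖ := by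
    have := integral_mul_norm_le_Lp_mul_Lq (μ := volume) (f := hat a b g) (g := hat a b f)
      Real.HolderConjugate.two_two (by simpa using memLp_hat (Lp.memLp g))
      (by simpa using memLp_hat (Lp.memLp f))
    refine this.trans (le_of_eq ?_)
    simp only [Real.rpow_two]
    rw [← norm_sq_eq_integral_hat, ← norm_sq_eq_integral_hat, ← Real.sqrt_eq_rpow,
      ← Real.sqrt_eq_rpow, Real.sqrt_sq (norm_nonneg _), Real.sqrt_sq (norm_nonneg _)]
  rw [one_mul]
  have h4 : ‖g‖ * ‖g‖ ≤ ‖g‖ * ‖f‖ := by linarith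
  by_cases hg0 : ‖g‖ = 0
  · rw [hg0]; positivity
  · exact le_of_mul_le_mul_left h4 (lt_of_le_of_ne (norm_nonneg _) (Ne.symm hg0))

/-- The compression `χ e^{-hA} χ` of the heat-type semigroup to `L²(a, b)`. -/
def comp (a b : ℝ) (N : ℕ) (hN : 0 < N) (h : ℝ) (hh : 0 < h) : L2i a b →L[ℂ] L2i a b :=
  (compLin a b N hN h hh).mkContinuous 1 (norm_compLin_le hN hh)

theorem coeFn_comp {N : ℕ} (hN : 0 < N) {h : ℝ} (hh : 0 < h) (f : L2i a b) :
    comp a b N hN h hh f =ᵐ[ivl a b] sg a b N h f := coeFn_compLin hN hh f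

theorem inner_comp {N : ℕ} (hN : 0 < N) {h : ℝ} (hh : 0 < h) (f g : L2i a b) :
    ⟪g, comp a b N hN h hh f⟫_ℂ = ∫ ξ, mult N h ξ * (conj (hat a b g ξ) * hat a b f ξ) :=
  inner_compLin hN hh f g

theorem norm_comp_le {N : ℕ} (hN : 0 < N) {h : ℝ} (hh : 0 < h) (f : L2i a b) :
    ‖comp a b N hN h hh f‖ ≤ ‖f‖ :=
  (norm_compLin_le hN hh f).trans_eq (one_mul _)

theorem comp_symm {N : ℕ} (hN : 0 < N) {h : ℝ} (hh : 0 < h) (f g : L2i a b) :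
    ⟪comp a b N hN h hh f, g⟫_ℂ = ⟪f, comp a b N hN h hh g⟫_ℂ := by
  rw [← inner_conj_symm, inner_comp hN hh, inner_comp hN hh, ← integral_conj]
  congr 1; ext ξ
  simp only [map_mul, Complex.conj_conj, mult, Complex.conj_ofReal]; ring

theorem inner_comp_self {N : ℕ} (hN : 0 < N) {h : ℝ} (hh : 0 < h) (f : L2i a b) :
    ⟪f, comp a b N hN h hh f⟫_ℂ =
      ((∫ ξ, Real.exp (-h * sym N ξ) * ‖hat a b f ξ‖ ^ 2 : ℝ) : ℂ) := by
  rw [inner_comp hN hh, ← integral_complex_ofReal]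
  congr 1; ext ξ
  rw [Complex.conj_mul', mult]; push_cast; rfl

theorem re_inner_comp_nonneg {N : ℕ} (hN : 0 < N) {h : ℝ} (hh : 0 < h) (f : L2i a b) :
    0 ≤ (⟪f, comp a b N hN h hh f⟫_ℂ).re := by
  rw [inner_comp_self hN hh, Complex.ofReal_re]
  exact integral_nonneg fun ξ => by positivity

/-- The form `⟨(1 - χ e^{-hA} χ) f, f⟩ / h`, which increases to `⟨A f, f⟩` as `h ↓ 0`. -/
def energy (a b : ℝ) (N : ℕ) (h : ℝ) (f : ℝ → ℂ) : ℝ :=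
  ∫ ξ, (1 - Real.exp (-h * sym N ξ)) / h * ‖hat a b f ξ‖ ^ 2

theorem integrable_energy {N : ℕ} {h : ℝ} (hh : 0 < h) {f : ℝ → ℂ} (hf : MemLp f 2 (ivl a b)) :
    Integrable (fun ξ => (1 - Real.exp (-h * sym N ξ)) / h * ‖hat a b f ξ‖ ^ 2) := by
  refine (integrable_norm_sq_hat hf).bdd_mul (c := 1 / h) ?_ (Eventually.of_forall fun ξ => ?_)
  · exact ((continuous_const.sub (Real.continuous_exp.comp
      (continuous_const.mul (continuous_sym N)))).div_const h).aestronglyMeasurable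
  · have h1 : Real.exp (-h * sym N ξ) ≤ 1 := by
      rw [Real.exp_le_one_iff]; nlinarith [mul_nonneg hh.le (sym_nonneg N ξ)]
    have h2 := Real.exp_nonneg (-h * sym N ξ)
    rw [Real.norm_of_nonneg (div_nonneg (by linarith) hh.le)]
    gcongr; linarith

theorem one_sub_exp_nonneg {N : ℕ} {h : ℝ} (hh : 0 < h) (ξ : ℝ) :
    0 ≤ 1 - Real.exp (-h * sym N ξ) := by
  have h1 : Real.exp (-h * sym N ξ) ≤ 1 := by
    rw [Real.exp_le_one_iff]; nlinarith [mul_nonneg hh.le (sym_nonneg N ξ)]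
  linarith

theorem energy_nonneg {N : ℕ} {h : ℝ} (hh : 0 < h) (f : ℝ → ℂ) : 0 ≤ energy a b N h f :=
  integral_nonneg fun ξ => mul_nonneg (div_nonneg (one_sub_exp_nonneg hh ξ) hh.le) (by positivity)

theorem inner_sub_comp_self {N : ℕ} (hN : 0 < N) {h : ℝ} (hh : 0 < h) (f : L2i a b) :
    ⟪f, f - comp a b N hN h hh f⟫_ℂ = ((h * energy a b N h f : ℝ) : ℂ) := by
  have hb : Integrable (fun ξ => Real.exp (-h * sym N ξ) * ‖hat a b f ξ‖ ^ 2) := by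
    refine (integrable_norm_sq_hat (Lp.memLp f)).bdd_mul (c := 1) ?_ (Eventually.of_forall fun ξ => ?_)
    · exact (Real.continuous_exp.comp
        (continuous_const.mul (continuous_sym N))).aestronglyMeasurable
    · have := one_sub_exp_nonneg (N := N) hh ξ
      rw [Real.norm_of_nonneg (Real.exp_nonneg _)]; linarith
  rw [inner_sub_right, inner_comp_self hN hh, inner_self_eq_norm_sq_to_K, energy,
    ← integral_const_mul]
  have : ((‖f‖ : ℂ)) ^ 2 = ((∫ ξ, ‖hat a b f ξ‖ ^ 2 : ℝ) : ℂ) := by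
    rw [← norm_sq_eq_integral_hat]; push_cast; rfl
  change (‖f‖ : ℂ) ^ 2 - _ = _
  rw [this, ← Complex.ofReal_sub,
    ← integral_sub (integrable_norm_sq_hat (Lp.memLp f)) hb]
  congr 2; ext ξ; field_simp

/-! ### Powers of a positive contraction. -/

/-- A nonnegative symmetric contraction of a complex Hilbert space, `0 ≤ T ≤ 1`. -/
structure IsPosContraction {H : Type*} [NormedAddCommGroup H] [InnerProductSpace ℂ H]
    (T : H →L[ℂ] H) : Prop where
  symm : ∀ f g, ⟪T f, g⟫_ℂ = ⟪f, T g⟫_ℂ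
  nonneg : ∀ f, 0 ≤ (⟪f, T f⟫_ℂ).re
  le_one : ∀ f, 0 ≤ (⟪f, f - T f⟫_ℂ).re
  norm_le : ∀ f, ‖T f‖ ≤ ‖f‖

section Hilbert

variable {H : Type*} [NormedAddCommGroup H] [InnerProductSpace ℂ H] {T : H →L[ℂ] H}

/-- The moments `⟨T^j f, f⟩` of the spectral measure of `f`. -/
def moment (T : H →L[ℂ] H) (f : H) (j : ℕ) : ℝ := (⟪f, (T ^ j) f⟫_ℂ).re

theorem moment_zero (f : H) : moment T f 0 = ‖f‖ ^ 2 := by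
  simp only [moment, pow_zero, one_apply_eq_self]
  exact inner_self_eq_norm_sq (𝕜 := ℂ) f

theorem IsPosContraction.symm_pow (hT : IsPosContraction T) (j : ℕ) (f g : H) :
    ⟪(T ^ j) f, g⟫_ℂ = ⟪f, (T ^ j) g⟫_ℂ := by
  induction j generalizing f g with
  | zero => simp
  | succ j ih => rw [pow_succ', mul_apply_eq_comp, hT.symm, ih, ← mul_apply_eq_comp,
      ← pow_succ, pow_succ']

theorem pow_apply_apply (T : H →L[ℂ] H) (i j : ℕ) (f : H) : (T ^ i) ((T ^ j) f) = (T ^ (i + j)) f := by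
  rw [pow_add, mul_apply_eq_comp]

theorem IsPosContraction.moment_add (hT : IsPosContraction T) (f : H) (i j : ℕ) :
    moment T f (i + j) = (⟪(T ^ i) f, (T ^ j) f⟫_ℂ).re := by
  rw [hT.symm_pow, pow_apply_apply, moment]

theorem IsPosContraction.moment_nonneg (hT : IsPosContraction T) (f : H) (j : ℕ) :
    0 ≤ moment T f j := by
  rcases Nat.even_or_odd' j with ⟨i, rfl | rfl⟩
  · rw [two_mul, hT.moment_add]
    exact inner_self_nonneg (𝕜 := ℂ)
  · rw [two_mul, add_assoc, hT.moment_add, add_comm i 1, ← pow_apply_apply, pow_one]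
    exact hT.nonneg _

theorem IsPosContraction.moment_sub (hT : IsPosContraction T) (f : H) (j : ℕ) :
    moment T (f - T f) j = moment T f j - 2 * moment T f (j + 1) + moment T f (j + 2) := by
  have h1 : (T ^ j) (T f) = (T ^ (j + 1)) f := by rw [pow_succ, mul_apply_eq_comp]
  have h2 : T ((T ^ j) f) = (T ^ (j + 1)) f := by rw [pow_succ', mul_apply_eq_comp]
  have h3 : T ((T ^ (j + 1)) f) = (T ^ (j + 2)) f := by
    rw [pow_succ' T (j + 1), mul_apply_eq_comp]
  simp only [moment, map_sub, inner_sub_left, inner_sub_right, h1, hT.symm, h2, h3, Complex.sub_re]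
  ring

/-- An even index reduces to 1 - T ≥ 0 at T^i f. An odd one needs T - T² ≥ 0, obtained without
spectral calculus: with m_j the moments of g, T(1 - T)² ≥ 0 says m₁ - 2m₂ + m₃ ≥ 0, and m₃ ≤ m₂ by
the even case at T g, so m₂ ≤ m₁. -/
theorem IsPosContraction.moment_succ_le (hT : IsPosContraction T) (f : H) (j : ℕ) :
    moment T f (j + 1) ≤ moment T f j := by
  have key : ∀ g : H, moment T g 1 ≤ moment T g 0 := fun g => by
    have := hT.le_one g
    simp only [moment, pow_zero, pow_one, one_apply_eq_self]
    rw [inner_sub_right, Complex.sub_re] at this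
    linarith
  have key2 : ∀ g : H, moment T g 2 ≤ moment T g 1 := fun g => by
    have h1 := hT.moment_nonneg (g - T g) 1
    have h2 := key (T g)
    rw [hT.moment_sub] at h1
    have h3 : moment T (T g) 1 = moment T g 3 := by
      have := hT.moment_add g 1 2
      rw [show 3 = 1 + 2 from rfl, this, moment, pow_one, pow_two, mul_apply_eq_comp]
    have h4 : moment T (T g) 0 = moment T g 2 := by
      have := hT.moment_add g 1 1
      rw [show 2 = 1 + 1 from rfl, this, moment, pow_zero, pow_one, one_apply_eq_self]
    norm_num at h1
    linarith
  have shift : ∀ i k : ℕ, moment T ((T ^ i) f) k = moment T f (i + (i + k)) := fun i k => by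
    rw [hT.moment_add, moment, pow_apply_apply, add_comm k i]
  rcases Nat.even_or_odd' j with ⟨i, rfl | rfl⟩
  · have := key ((T ^ i) f)
    rw [shift, shift] at this
    convert this using 2 <;> ring
  · have := key2 ((T ^ i) f)
    rw [shift, shift] at this
    convert this using 2 <;> ring

theorem IsPosContraction.moment_antitone (hT : IsPosContraction T) (f : H) :
    Antitone (moment T f) := antitone_nat_of_succ_le (hT.moment_succ_le f)

/-- The moments form a convex sequence: their second differences are the moments of f - T f. -/
theorem IsPosContraction.moment_diff_antitone (hT : IsPosContraction T) (f : H) :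
    Antitone (fun j => moment T f j - moment T f (j + 1)) :=
  antitone_nat_of_succ_le fun j => by
    have := hT.moment_nonneg (f - T f) j
    rw [hT.moment_sub] at this
    change moment T f (j + 1) - moment T f (j + 2) ≤ _
    linarith

/-- The last of k + 1 decreasing increments is at most their average, and the increments telescope.
-/
theorem antitone_mul_le_sub {u : ℕ → ℝ} (hu : Antitone (fun j => u j - u (j + 1))) (i k : ℕ) :
    (k + 1) * (u (i + k) - u (i + k + 1)) ≤ u i - u (i + k + 1) := by
  induction k with
  | zero => simp
  | succ k ih =>
    have h1 := hu (show i + k ≤ i + k + 1 by lia)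
    simp only at h1
    push_cast
    rw [show i + (k + 1) = i + k + 1 from rfl]
    have : (0 : ℝ) ≤ k := k.cast_nonneg
    nlinarith

theorem IsPosContraction.mul_moment_diff_le (hT : IsPosContraction T) (f : H) (j : ℕ) :
    (j + 1) * (moment T f j - moment T f (j + 1)) ≤ ‖f‖ ^ 2 := by
  have h1 := antitone_mul_le_sub (hT.moment_diff_antitone f) 0 j
  have h2 := hT.moment_nonneg f (j + 1)
  rw [zero_add, moment_zero] at h1
  linarith

/-- The discrete counterpart of ‖tA e^{-tA}‖ ≤ 1. The averaging bound is used twice: on the moments,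
giving (k + 1) u_k ≤ ‖f‖² for the increments u, and on the increments themselves, giving (k + 1)‖T^k
f - T^{k+1} f‖² ≤ u_k. -/
theorem IsPosContraction.norm_pow_sub_succ_le (hT : IsPosContraction T) (f : H) (k : ℕ) :
    ‖(T ^ k) f - (T ^ (k + 1)) f‖ ≤ ‖f‖ / (k + 1) := by
  set u := fun j => moment T f j - moment T f (j + 1) with hu
  have hc : ∀ j, u j - u (j + 1) = moment T (f - T f) j := fun j => by
    rw [hT.moment_sub]; simp only [hu]; ring
  have h1 := antitone_mul_le_sub (u := u) (by
    simp only [hc]; exact hT.moment_antitone _) k k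
  rw [hc] at h1
  have h2 := hT.mul_moment_diff_le f k
  have h3 : 0 ≤ u (k + k + 1) := by have := hT.moment_succ_le f (k + k + 1); simp only [hu]; linarith
  have h4 : moment T (f - T f) (k + k) = ‖(T ^ k) f - (T ^ (k + 1)) f‖ ^ 2 := by
    rw [hT.moment_add, map_sub, ← mul_apply_eq_comp, ← pow_succ]
    exact inner_self_eq_norm_sq (𝕜 := ℂ) _
  rw [h4] at h1
  have hk : (0 : ℝ) < (k : ℝ) + 1 := by positivity
  rw [le_div_iff₀ hk]
  apply le_of_sq_le_sq ?_ (norm_nonneg _)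
  change (k + 1) * u k ≤ _ at h2
  calc _ = (k + 1) * ((k + 1) * ‖(T ^ k) f - (T ^ (k + 1)) f‖ ^ 2) := by ring
    _ ≤ (k + 1) * u k := by gcongr; linarith
    _ ≤ _ := h2

theorem IsPosContraction.norm_pow_le (hT : IsPosContraction T) (f : H) (k : ℕ) :
    ‖(T ^ k) f‖ ≤ ‖f‖ := by
  induction k with
  | zero => simp
  | succ k ih => rw [pow_succ', mul_apply_eq_comp]; exact (hT.norm_le _).trans ih

theorem IsPosContraction.norm_pow_sub_le (hT : IsPosContraction T) (f : H) {k l : ℕ} (hkl : k ≤ l) :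
    ‖(T ^ k) f - (T ^ l) f‖ ≤ ‖f‖ * ((l - k : ℝ) / (k + 1)) := by
  induction l, hkl using Nat.le_induction with
  | base => simp
  | succ l hl ih =>
    have h1 := hT.norm_pow_sub_succ_le f l
    have h2 : ‖f‖ / ((l : ℝ) + 1) ≤ ‖f‖ / (k + 1) := by
      have : (k : ℝ) ≤ l := by exact_mod_cast hl
      gcongr
    calc _ ≤ ‖(T ^ k) f - (T ^ l) f‖ + ‖(T ^ l) f - (T ^ (l + 1)) f‖ := norm_sub_le_norm_sub_add_norm_sub _ _ _
      _ ≤ ‖f‖ * ((l - k : ℝ) / (k + 1)) + ‖f‖ / (k + 1) := by linarith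
      _ = _ := by push_cast; ring

end Hilbert

theorem isPosContraction_comp {a b : ℝ} {N : ℕ} (hN : 0 < N) {h : ℝ} (hh : 0 < h) :
    IsPosContraction (comp a b N hN h hh) where
  symm := comp_symm hN hh
  nonneg := re_inner_comp_nonneg hN hh
  le_one f := by
    rw [inner_sub_comp_self hN hh, Complex.ofReal_re]
    exact mul_nonneg hh.le (energy_nonneg hh _)
  norm_le := norm_comp_le hN hh

/-! ### From Laplace transforms of discrete flows to the flows themselves. -/

section Hilbert

variable {H : Type*} [NormedAddCommGroup H] [InnerProductSpace ℂ H]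

/-- The path `t ↦ T^{⌊rt⌋} e` of the discrete semigroup with time step `1/r`. -/
def stepFlow (T : H →L[ℂ] H) (r : ℝ) (e : H) (t : ℝ) : H := (T ^ ⌊r * t⌋₊) e

/-- The Laplace transform of `stepFlow`. -/
def stepResolvent (T : H →L[ℂ] H) (r : ℝ) (e : H) (lam : ℝ) : H :=
  ∫ t in Ioi (0 : ℝ), Real.exp (-lam * t) • stepFlow T r e t

variable {T : H →L[ℂ] H}

theorem stronglyMeasurable_stepFlow (T : H →L[ℂ] H) (r : ℝ) (e : H) :
    StronglyMeasurable (stepFlow T r e) :=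
  (StronglyMeasurable.of_discrete (f := fun k : ℕ => (T ^ k) e)).comp_measurable
    (Nat.measurable_floor.comp (measurable_const.mul measurable_id))

theorem IsPosContraction.norm_stepFlow_le (hT : IsPosContraction T) (r : ℝ) (e : H) (t : ℝ) :
    ‖stepFlow T r e t‖ ≤ ‖e‖ := hT.norm_pow_le _ _

theorem IsPosContraction.norm_stepFlow_sub_le_of_le (hT : IsPosContraction T) {r : ℝ} (hr : 0 < r)
    (e : H) {τ s t : ℝ} (hτ : 0 < τ) (hs : τ ≤ s) (hst : s ≤ t) :
    ‖stepFlow T r e s - stepFlow T r e t‖ ≤ ‖e‖ * ((t - s + 1 / r) / τ) := by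
  have h1 : ⌊r * s⌋₊ ≤ ⌊r * t⌋₊ := Nat.floor_le_floor (by gcongr)
  refine (hT.norm_pow_sub_le e h1).trans ?_
  have h2 : r * τ ≤ (⌊r * s⌋₊ : ℝ) + 1 :=
    (mul_le_mul_of_nonneg_left hs hr.le).trans (Nat.lt_floor_add_one _).le
  have h3 : (⌊r * t⌋₊ : ℝ) ≤ r * t := Nat.floor_le (by nlinarith)
  have h4 := Nat.lt_floor_add_one (r * s)
  have hrτ : 0 < r * τ := by positivity
  refine mul_le_mul_of_nonneg_left ?_ (norm_nonneg e)
  have h5 : ((⌊r * t⌋₊ : ℝ) - ⌊r * s⌋₊) ≤ r * (t - s + 1 / r) := by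
    rw [mul_add, mul_one_div_cancel hr.ne']; linarith
  have h6 : 0 ≤ r * (t - s + 1 / r) := by
    have : 0 ≤ t - s := by linarith
    positivity
  calc _ ≤ r * (t - s + 1 / r) / ((⌊r * s⌋₊ : ℝ) + 1) := by gcongr
    _ ≤ r * (t - s + 1 / r) / (r * τ) := by gcongr
    _ = _ := mul_div_mul_left _ _ hr.ne'

/-- Equicontinuity on [τ, ∞), uniform over all positive contractions; the extra 1/r pays for
rounding down to the time grid. -/
theorem IsPosContraction.norm_stepFlow_sub_le (hT : IsPosContraction T) {r : ℝ} (hr : 0 < r)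
    (e : H) {τ s t : ℝ} (hτ : 0 < τ) (hs : τ ≤ s) (ht : τ ≤ t) :
    ‖stepFlow T r e s - stepFlow T r e t‖ ≤ ‖e‖ * ((|s - t| + 1 / r) / τ) := by
  rcases le_total s t with h | h
  · rw [abs_sub_comm, abs_of_nonneg (sub_nonneg.2 h)]
    exact hT.norm_stepFlow_sub_le_of_le hr e hτ hs h
  · rw [norm_sub_rev, abs_of_nonneg (sub_nonneg.2 h)]
    exact hT.norm_stepFlow_sub_le_of_le hr e hτ ht h

theorem IsPosContraction.integrableOn_smul_stepFlow (hT : IsPosContraction T) (r : ℝ) (e : H)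
    {g : ℝ → ℝ} (hg : IntegrableOn g (Ioi 0)) :
    IntegrableOn (fun t => g t • stepFlow T r e t) (Ioi 0) :=
  (hg.norm.mul_const ‖e‖).mono'
    (hg.aestronglyMeasurable.smul (stronglyMeasurable_stepFlow T r e).aestronglyMeasurable)
    (Eventually.of_forall fun t => by
      rw [norm_smul]
      exact mul_le_mul_of_nonneg_left (hT.norm_stepFlow_le r e t) (norm_nonneg _))

theorem stepFlow_add_inv (T : H →L[ℂ] H) {r : ℝ} (hr : 0 < r) (e : H) {t : ℝ} (ht : 0 ≤ t) :
    stepFlow T r e (t + 1 / r) = T (stepFlow T r e t) := by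
  rw [stepFlow, mul_add, mul_one_div_cancel hr.ne', Nat.floor_add_one (by positivity), pow_succ',
    mul_apply_eq_comp, stepFlow]

/-- The equation satisfied by the Laplace transform of the discrete semigroup. -/
theorem IsPosContraction.apply_stepResolvent [CompleteSpace H] (hT : IsPosContraction T) {r : ℝ}
    (hr : 0 < r) (e : H) {lam : ℝ} (hlam : 0 < lam) :
    ((Real.exp (-lam / r) : ℝ) : ℂ) • T (stepResolvent T r e lam) =
      stepResolvent T r e lam - (((1 - Real.exp (-lam / r)) / lam : ℝ) : ℂ) • e := by
  have hexp : IntegrableOn (fun t => Real.exp (-lam * t)) (Ioi 0) :=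
    exp_neg_integrableOn_Ioi 0 hlam
  have hint := hT.integrableOn_smul_stepFlow r e hexp
  set F := fun t => Real.exp (-lam * t) • stepFlow T r e t with hF
  have h1r : 0 < 1 / r := by positivity
  -- One application of T shifts the flow by a time step, so T acts on the Laplace integral as a
  -- translation. The translation loses only the first step, on which the flow equals e.
  have h1 : ((Real.exp (-lam / r) : ℝ) : ℂ) • T (stepResolvent T r e lam) =
      ∫ t in Ioi (0 : ℝ), F (t + 1 / r) := by
    rw [stepResolvent, ← ContinuousLinearMap.integral_comp_comm T hint, Complex.coe_smul,
      ← integral_smul]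
    refine setIntegral_congr_fun measurableSet_Ioi fun t ht => ?_
    simp only [hF]
    rw [stepFlow_add_inv T hr e (le_of_lt ht), T.map_smul_of_tower, smul_smul, ← Real.exp_add]
    congr 2; ring
  have h2 : ∫ t in Ioi (0 : ℝ), F (t + 1 / r) = ∫ t in Ioi (1 / r), F t := by
    have := (measurePreserving_add_right (volume : Measure ℝ) (1 / r)).setIntegral_preimage_emb
      (measurableEmbedding_addRight _) F (Ioi (1 / r))
    rw [← this]
    congr 2; ext t; simp
  have h3 : ∫ t in Ioi (0 : ℝ), F t = (∫ t in Ioc 0 (1 / r), F t) + ∫ t in Ioi (1 / r), F t := by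
    rw [← setIntegral_union Ioc_disjoint_Ioi_same measurableSet_Ioi
      (hint.mono_set Ioc_subset_Ioi_self) (hint.mono_set (Ioi_subset_Ioi h1r.le)),
      Ioc_union_Ioi_eq_Ioi h1r.le]
  have h4 : ∫ t in Ioc 0 (1 / r), F t = ((1 - Real.exp (-lam / r)) / lam) • e := by
    have e1 : ∫ t in Ioc 0 (1 / r), F t = ∫ t in Ioc 0 (1 / r), Real.exp (-lam * t) • e := by
      rw [integral_Ioc_eq_integral_Ioo, integral_Ioc_eq_integral_Ioo]
      refine setIntegral_congr_fun measurableSet_Ioo fun t ht => ?_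
      have : ⌊r * t⌋₊ = 0 := by
        rw [Nat.floor_eq_zero]
        have := mul_lt_mul_of_pos_left ht.2 hr
        rwa [mul_one_div_cancel hr.ne'] at this
      simp [hF, stepFlow, this]
    rw [e1, integral_smul_const]
    congr 1
    have e2 : ∫ t in Ioi (0 : ℝ), Real.exp (-lam * t) =
        (∫ t in Ioc 0 (1 / r), Real.exp (-lam * t)) + ∫ t in Ioi (1 / r), Real.exp (-lam * t) := by
      rw [← setIntegral_union Ioc_disjoint_Ioi_same measurableSet_Ioi
        (hexp.mono_set Ioc_subset_Ioi_self) (hexp.mono_set (Ioi_subset_Ioi h1r.le)),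
        Ioc_union_Ioi_eq_Ioi h1r.le]
    rw [integral_exp_mul_Ioi (by linarith), integral_exp_mul_Ioi (by linarith)] at e2
    have e3 : -lam * (1 / r) = -lam / r := by ring
    rw [e3, mul_zero, Real.exp_zero] at e2
    have : ∫ t in Ioc 0 (1 / r), Real.exp (-lam * t) = -1 / -lam - -Real.exp (-lam / r) / -lam := by
      linarith
    rw [this]; field_simp
  rw [h1, h2, Complex.coe_smul, ← h4, stepResolvent, h3]
  abel

theorem cauchySeq_of_forall_approx {X : Type*} [PseudoMetricSpace X] {w : ℕ → X}
    (hw : ∀ ε > 0, ∃ z : ℕ → X, CauchySeq z ∧ ∀ᶠ n in atTop, dist (w n) (z n) ≤ ε) :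
    CauchySeq w := by
  rw [Metric.cauchySeq_iff]
  intro ε hε
  obtain ⟨z, hz, hwz⟩ := hw (ε / 4) (by positivity)
  obtain ⟨n₁, h₁⟩ := Metric.cauchySeq_iff.1 hz (ε / 4) (by positivity)
  obtain ⟨n₂, h₂⟩ := eventually_atTop.1 hwz
  refine ⟨max n₁ n₂, fun m hm n hn => ?_⟩
  have a1 := h₁ m (le_trans (le_max_left _ _) hm) n (le_trans (le_max_left _ _) hn)
  have a2 := h₂ m (le_trans (le_max_right _ _) hm)
  have a3 := h₂ n (le_trans (le_max_right _ _) hn)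
  rw [dist_comm] at a3
  have := dist_triangle4 (w m) (z m) (z n) (w n)
  linarith

/-- The monomial e^{-jt} under the weight e^{-t} samples the Laplace transform at λ = j + 1. -/
theorem tendsto_integral_polynomial_smul_stepFlow {T : ℕ → H →L[ℂ] H}
    (hT : ∀ n, IsPosContraction (T n)) {r : ℕ → ℝ} {e : H}
    (hv : ∀ lam : ℝ, 0 < lam → ∃ v, Tendsto (fun n => stepResolvent (T n) (r n) e lam) atTop (𝓝 v))
    (p : Polynomial ℝ) :
    ∃ v, Tendsto (fun n => ∫ t in Ioi (0 : ℝ), (Real.exp (-t) * p.eval (Real.exp (-t))) •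
      stepFlow (T n) (r n) e t) atTop (𝓝 v) := by
  choose! v hv using hv
  refine ⟨∑ j ∈ Finset.range (p.natDegree + 1), p.coeff j • v ((j : ℝ) + 1), ?_⟩
  have hj : ∀ (n j : ℕ), IntegrableOn (fun t : ℝ => Real.exp (-((j : ℝ) + 1) * t) •
      stepFlow (T n) (r n) e t) (Ioi 0) := fun n j =>
    (hT n).integrableOn_smul_stepFlow _ _ (exp_neg_integrableOn_Ioi 0 (by positivity))
  have : ∀ n, ∫ t in Ioi (0 : ℝ), (Real.exp (-t) * p.eval (Real.exp (-t))) •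
      stepFlow (T n) (r n) e t =
      ∑ j ∈ Finset.range (p.natDegree + 1), p.coeff j • stepResolvent (T n) (r n) e ((j : ℝ) + 1) := by
    intro n
    simp only [stepResolvent, ← integral_smul]
    refine Eq.trans ?_ (integral_finsetSum _ fun j _ => (hj n j).smul (p.coeff j))
    congr 1; ext t
    rw [Polynomial.eval_eq_sum_range, Finset.mul_sum, Finset.sum_smul]
    refine Finset.sum_congr rfl fun j _ => ?_
    rw [smul_smul]
    congr 1
    rw [← Real.exp_nat_mul, mul_left_comm, ← Real.exp_add]
    congr 2; ring
  simp only [this]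
  exact tendsto_finsetSum _ fun j _ => (hv ((j : ℝ) + 1) (by positivity)).const_smul _

/-- Convergence of the Laplace transforms of discrete semigroups of nonnegative contractions implies
convergence of the semigroups. -/
theorem exists_tendsto_stepFlow [CompleteSpace H] {T : ℕ → H →L[ℂ] H}
    (hT : ∀ n, IsPosContraction (T n)) {r : ℕ → ℝ} (hr : ∀ n, 0 < r n) (hr' : Tendsto r atTop atTop)
    {e : H}
    (hv : ∀ lam : ℝ, 0 < lam → ∃ v, Tendsto (fun n => stepResolvent (T n) (r n) e lam) atTop (𝓝 v))
    {t₀ : ℝ} (ht₀ : 0 < t₀) :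
    ∃ u, Tendsto (fun n => stepFlow (T n) (r n) e t₀) atTop (𝓝 u) := by
  apply cauchySeq_tendsto_of_complete
  apply cauchySeq_of_forall_approx
  intro ε hε
  set C := ‖e‖ + 1 with hC
  have hC0 : 0 < C := by positivity
  -- the time scale on which the flows oscillate by at most `ε / 2`
  set η := min (t₀ / 2) (ε / 2 / C * (t₀ / 4)) with hη
  have hη0 : 0 < η := by positivity
  obtain ⟨κ, hκ0, hκ⟩ : ∃ κ > 0, ∀ z, |z - Real.exp (-t₀)| < κ → |Real.log z + t₀| < η := by
    have := Metric.continuousAt_iff.1 (Real.continuousAt_log (Real.exp_pos (-t₀)).ne') η hη0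
    obtain ⟨κ, h1, h2⟩ := this
    refine ⟨κ, h1, fun z hz => ?_⟩
    have := h2 (by rwa [Real.dist_eq])
    rwa [Real.dist_eq, Real.log_exp, sub_neg_eq_add] at this
  -- A tent in the variable z = e^{-t}, vanishing unless |t - t₀| < η. By equicontinuity the average
  -- of the flow against it is close to the flow at t₀.
  set g : ℝ → ℝ := fun z => max 0 (κ - |z - Real.exp (-t₀)|) with hg
  have hgc : Continuous g := by fun_prop
  have hg0 : ∀ z, 0 ≤ g z := fun z => le_max_left _ _
  have hexp : IntegrableOn (fun t : ℝ => Real.exp (-t)) (Ioi 0) := integrableOn_exp_neg_Ioi 0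
  have hgb : ∀ z, |g z| ≤ κ := fun z => by
    rw [abs_of_nonneg (hg0 z)]; exact max_le hκ0.le (by linarith [abs_nonneg (z - Real.exp (-t₀))])
  have hgint : IntegrableOn (fun t : ℝ => Real.exp (-t) * g (Real.exp (-t))) (Ioi 0) :=
    Integrable.mul_bdd (c := κ) hexp (by fun_prop) (Eventually.of_forall fun t => hgb _)
  set m := ∫ t in Ioi (0 : ℝ), Real.exp (-t) * g (Real.exp (-t)) with hm
  have hm0 : 0 < m := by
    rw [hm, setIntegral_pos_iff_support_of_nonneg_ae
      (Eventually.of_forall fun t => mul_nonneg (Real.exp_nonneg _) (hg0 _)) hgint]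
    have hopen : IsOpen ((fun t : ℝ => Real.exp (-t)) ⁻¹' (Metric.ball (Real.exp (-t₀)) κ) ∩ Ioi 0) :=
      (Metric.isOpen_ball.preimage (by fun_prop)).inter isOpen_Ioi
    refine (hopen.measure_pos volume ⟨t₀, by simpa using hκ0, ht₀⟩).trans_le (measure_mono ?_)
    rintro t ⟨h1, h2⟩
    refine ⟨?_, h2⟩
    have h3 : |Real.exp (-t) - Real.exp (-t₀)| < κ := by simpa [Real.dist_eq] using h1
    have h4 : 0 < g (Real.exp (-t)) := lt_max_of_lt_right (by linarith)
    exact (mul_pos (Real.exp_pos _) h4).ne'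
  -- The flow is bounded by C and the average is divided by the mass m, so this accuracy costs ε/2;
  -- the tent costs the other half.
  obtain ⟨p, hp⟩ := exists_polynomial_near_of_continuousOn 0 1 g hgc.continuousOn
    (m * (ε / 2) / C) (by positivity)
  obtain ⟨v, hv⟩ := tendsto_integral_polynomial_smul_stepFlow hT hv p
  refine ⟨_, (hv.const_smul m⁻¹).cauchySeq, ?_⟩
  have hr1 : ∀ᶠ n in atTop, 1 / r n < η := by
    have : Tendsto (fun n => 1 / r n) atTop (𝓝 0) := by
      simpa using! hr'.inv_tendsto_atTop
    exact this.eventually_lt_const hη0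
  filter_upwards [hr1] with n hn
  set w := stepFlow (T n) (r n) e with hw
  have hpc : Continuous fun z => p.eval z := p.continuous
  have hpg : ∀ t ∈ Ioi (0 : ℝ), |p.eval (Real.exp (-t)) - g (Real.exp (-t))| < m * (ε / 2) / C :=
    fun t ht => hp _ ⟨Real.exp_nonneg _, Real.exp_le_one_iff.2 (neg_nonpos.2 (le_of_lt ht))⟩
  have hpint : IntegrableOn (fun t : ℝ => Real.exp (-t) * p.eval (Real.exp (-t))) (Ioi 0) := by
    have : IntegrableOn (fun t : ℝ => Real.exp (-t) *
        (p.eval (Real.exp (-t)) - g (Real.exp (-t)))) (Ioi 0) := by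
      refine Integrable.mul_bdd (c := m * (ε / 2) / C) hexp ?_ ?_
      · exact (by fun_prop : Continuous fun t : ℝ =>
          p.eval (Real.exp (-t)) - g (Real.exp (-t))).aestronglyMeasurable
      · exact (ae_restrict_iff' measurableSet_Ioi).2 (Eventually.of_forall fun t ht => (hpg t ht).le)
    refine (this.add hgint).congr (Eventually.of_forall fun t => ?_)
    simp only [Pi.add_apply]; ring
  have hmw : w t₀ = m⁻¹ • ∫ t in Ioi (0 : ℝ), (Real.exp (-t) * g (Real.exp (-t))) • w t₀ := by
    rw [integral_smul_const, smul_smul, inv_mul_cancel₀ hm0.ne', one_smul]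
  have key : ‖(∫ t in Ioi (0 : ℝ), (Real.exp (-t) * g (Real.exp (-t))) • w t₀) -
      ∫ t in Ioi (0 : ℝ), (Real.exp (-t) * p.eval (Real.exp (-t))) • w t‖ ≤ m * ε := by
    rw [← integral_sub (hgint.smul_const _) ((hT n).integrableOn_smul_stepFlow _ _ hpint)]
    have hb : IntegrableOn (fun t : ℝ => Real.exp (-t) * g (Real.exp (-t)) * (ε / 2) +
        Real.exp (-t) * (m * (ε / 2))) (Ioi 0) := (hgint.mul_const _).add (hexp.mul_const _)
    refine (norm_integral_le_of_norm_le hb ((ae_restrict_iff' measurableSet_Ioi).2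
      (Eventually.of_forall fun t ht => ?_))).trans (le_of_eq ?_)
    · have e1 : (Real.exp (-t) * g (Real.exp (-t))) • w t₀ -
          (Real.exp (-t) * p.eval (Real.exp (-t))) • w t =
          (Real.exp (-t) * g (Real.exp (-t))) • (w t₀ - w t) -
          (Real.exp (-t) * (p.eval (Real.exp (-t)) - g (Real.exp (-t)))) • w t := by
        rw [smul_sub, mul_sub, sub_smul]; abel
      rw [e1]
      refine (norm_sub_le _ _).trans (add_le_add ?_ ?_)
      · rw [norm_smul, Real.norm_of_nonneg (mul_nonneg (Real.exp_nonneg _) (hg0 _))]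
        by_cases hz : |Real.exp (-t) - Real.exp (-t₀)| < κ
        · have h1 := hκ _ hz
          rw [Real.log_exp, show -t + t₀ = t₀ - t by ring] at h1
          have h2 : t₀ / 2 ≤ t := by
            have := min_le_left (t₀ / 2) (ε / 2 / C * (t₀ / 4))
            have := (abs_lt.1 h1).2
            linarith
          have h3 := (hT n).norm_stepFlow_sub_le (hr n) e (τ := t₀ / 2) (s := t₀) (t := t)
            (by positivity) (by linarith) h2
          have h4 := min_le_right (t₀ / 2) (ε / 2 / C * (t₀ / 4))
          have h5 : ‖w t₀ - w t‖ ≤ ε / 2 := by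
            refine h3.trans ?_
            calc _ ≤ C * ((ε / 2 / C * (t₀ / 4) + ε / 2 / C * (t₀ / 4)) / (t₀ / 2)) := by
                  refine mul_le_mul (by linarith) ?_ ?_ hC0.le
                  · gcongr <;> linarith
                  · have := hr n
                    positivity
              _ = ε / 2 := by field_simp; ring
          exact mul_le_mul_of_nonneg_left h5 (mul_nonneg (Real.exp_nonneg _) (hg0 _))
        · have : g (Real.exp (-t)) = 0 := max_eq_left (by linarith)
          rw [this]; simp
      · rw [norm_smul, norm_mul, Real.norm_of_nonneg (Real.exp_nonneg _), mul_assoc]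
        refine mul_le_mul_of_nonneg_left ?_ (Real.exp_nonneg _)
        calc _ ≤ m * (ε / 2) / C * C := by
              refine mul_le_mul (hpg t ht).le ?_ (norm_nonneg _) (by positivity)
              exact ((hT n).norm_stepFlow_le _ _ _).trans (by linarith)
          _ = _ := by field_simp
    · rw [integral_add (hgint.mul_const _) (hexp.mul_const _), integral_mul_const,
        integral_mul_const, ← hm, integral_exp_neg_Ioi_zero]
      ring
  rw [dist_eq_norm]
  conv_lhs => rw [hmw]
  rw [← smul_sub, norm_smul, Real.norm_of_nonneg (by positivity)]
  calc _ ≤ m⁻¹ * (m * ε) := by gcongr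
    _ = ε := by field_simp

/-- The Laplace transform of a limit of discrete semigroups. -/
theorem integral_exp_mul_apply_lim [CompleteSpace H] {T : ℕ → H →L[ℂ] H}
    (hT : ∀ n, IsPosContraction (T n)) {r : ℕ → ℝ} {e v : H} {lam : ℝ} (hlam : 0 < lam)
    (hv : Tendsto (fun n => stepResolvent (T n) (r n) e lam) atTop (𝓝 v)) {u : ℝ → H}
    (hu : ∀ t, 0 < t → Tendsto (fun n => stepFlow (T n) (r n) e t) atTop (𝓝 (u t)))
    (l : H →L[ℂ] ℂ) :
    ∫ t in Ioi (0 : ℝ), (Real.exp (-lam * t) : ℂ) * l (u t) = l v := by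
  have hexp : IntegrableOn (fun t => Real.exp (-lam * t)) (Ioi 0) :=
    exp_neg_integrableOn_Ioi 0 hlam
  have h1 : ∀ n, l (stepResolvent (T n) (r n) e lam) =
      ∫ t in Ioi (0 : ℝ), (Real.exp (-lam * t) : ℂ) * l (stepFlow (T n) (r n) e t) := fun n => by
    rw [stepResolvent, ← ContinuousLinearMap.integral_comp_comm l
      ((hT n).integrableOn_smul_stepFlow _ _ hexp)]
    congr 1; ext t
    rw [l.map_smul_of_tower, Complex.real_smul]
  refine tendsto_nhds_unique ?_ ((l.continuous.tendsto v).comp hv)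
  simp only [Function.comp_def, h1]
  refine tendsto_integral_of_dominated_convergence
    (fun t => Real.exp (-lam * t) * (‖l‖ * ‖e‖)) (fun n => ?_) (hexp.mul_const _)
    (fun n => Eventually.of_forall fun t => ?_) ?_
  · exact ((by fun_prop : Continuous fun t : ℝ =>
      Complex.exp (-lam * t)).aestronglyMeasurable.congr
      (Eventually.of_forall fun t => by push_cast; rfl)).mul
      (l.continuous.comp_stronglyMeasurable (stronglyMeasurable_stepFlow _ _ _)).aestronglyMeasurable
  · rw [norm_mul]
    have : ‖(Real.exp (-lam * t) : ℂ)‖ = Real.exp (-lam * t) := by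
      rw [Complex.norm_real, Real.norm_of_nonneg (Real.exp_nonneg _)]
    rw [this]
    gcongr
    exact (l.le_opNorm _).trans (by gcongr; exact (hT n).norm_stepFlow_le _ _ _)
  · refine (ae_restrict_iff' measurableSet_Ioi).2 (Eventually.of_forall fun t ht => ?_)
    exact ((l.continuous.tendsto _).comp (hu t ht)).const_mul _

end Hilbert

/-! ### Smallness of boundary terms: (1 - e^{-hs})/h = s φ(hs) with φ = `avgExp`. -/

/-- The function `(1 - e^{-x}) / x`, with value `1` at `0`. -/
def avgExp (x : ℝ) : ℝ := if x = 0 then 1 else (1 - Real.exp (-x)) / x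

theorem measurable_avgExp : Measurable avgExp :=
  Measurable.ite (measurableSet_singleton 0) measurable_const (by fun_prop)

theorem mul_avgExp (x : ℝ) : x * avgExp x = 1 - Real.exp (-x) := by
  unfold avgExp
  split_ifs with h
  · simp [h]
  · field_simp

theorem div_one_add_le_one_sub_exp {x : ℝ} (hx : 0 ≤ x) : x / (1 + x) ≤ 1 - Real.exp (-x) := by
  have h1 : Real.exp (-x) ≤ 1 / (1 + x) := by
    rw [Real.exp_neg, ← one_div]
    exact one_div_le_one_div_of_le (by linarith) (by linarith [Real.add_one_le_exp x])
  have h2 : x / (1 + x) = 1 - 1 / (1 + x) := by field_simp; ring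
  linarith

theorem avgExp_le_one {x : ℝ} (hx : 0 ≤ x) : avgExp x ≤ 1 := by
  unfold avgExp
  split_ifs with h
  · exact le_rfl
  · rw [div_le_one (lt_of_le_of_ne hx (Ne.symm h))]
    linarith [Real.add_one_le_exp (-x)]

theorem one_div_le_avgExp {x : ℝ} (hx : 0 ≤ x) : 1 / (1 + x) ≤ avgExp x := by
  unfold avgExp
  split_ifs with h
  · simp [h]
  · rw [le_div_iff₀ (lt_of_le_of_ne hx (Ne.symm h))]
    have := div_one_add_le_one_sub_exp hx
    rwa [one_div_mul_eq_div]

theorem avgExp_nonneg {x : ℝ} (hx : 0 ≤ x) : 0 ≤ avgExp x :=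
  le_trans (by positivity) (one_div_le_avgExp hx)

theorem one_sub_avgExp_le {x : ℝ} (hx : 0 ≤ x) : 1 - avgExp x ≤ 1 - Real.exp (-x) := by
  have h1 := one_div_le_avgExp hx
  have h2 := div_one_add_le_one_sub_exp hx
  have h3 : x / (1 + x) = 1 - 1 / (1 + x) := by field_simp; ring
  linarith

theorem one_sub_avgExp_le_self {x : ℝ} (hx : 0 ≤ x) : 1 - avgExp x ≤ x := by
  linarith [one_sub_avgExp_le hx, Real.add_one_le_exp (-x)]

/-- A bump of mass one near c. Rescaled by δ and recentred at an endpoint of (a, b), it imitates the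
smeared point mass while its support avoids the interval. -/
theorem exists_schwartz_bump (c : ℝ) :
    ∃ ψ : 𝓢(ℝ, ℂ), 𝓕 ψ 0 = 1 ∧ ∀ z, 1 / 2 ≤ |z - c| → ψ z = 0 := by
  let f : ContDiffBump c := ⟨1 / 4, 1 / 2, by norm_num, by norm_num⟩
  have hg : ContDiff ℝ ∞ (fun x => (f.normed volume x : ℂ)) :=
    Complex.ofRealCLM.contDiff.comp f.contDiff_normed
  have hgc : HasCompactSupport (fun x => (f.normed volume x : ℂ)) :=
    f.hasCompactSupport_normed.comp_left (g := ((↑) : ℝ → ℂ)) rfl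
  refine ⟨hgc.toSchwartzMap hg, ?_, fun z hz => ?_⟩
  · rw [SchwartzMap.fourier_coe, Real.fourier_eq']
    simp only [inner_zero_right, mul_zero, Complex.ofReal_zero, zero_mul, Complex.exp_zero, one_smul]
    change ∫ v, (f.normed volume v : ℂ) = 1
    rw [integral_complex_ofReal, f.integral_normed]; simp
  · change (f.normed volume z : ℂ) = 0
    have : z ∉ Function.support (f.normed volume) := by
      rw [f.support_normed_eq, Metric.mem_ball, not_lt, Real.dist_eq]; exact hz
    rw [Function.notMem_support.1 this]; simp

/-- Here ψ plays the role of the transform of the bump. Both functions equal 1 at frequency 0, hence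
differ linearly there, and both decay at infinity at least like the power -N. -/
theorem exists_bound_avgExp_sub (N : ℕ) (hN : 0 < N) (ψ : 𝓢(ℝ, ℂ)) (hψ : ψ 0 = 1) :
    ∃ C : ℝ, 0 < C ∧ ∀ z : ℝ,
      (|2 * Real.pi * z| ≤ 1 → ‖(avgExp (sym N z) : ℂ) - ψ z‖ ≤ C * |2 * Real.pi * z|) ∧
      (1 ≤ |2 * Real.pi * z| → ‖(avgExp (sym N z) : ℂ) - ψ z‖ * |2 * Real.pi * z| ^ N ≤ C) := by
  obtain ⟨C₁, hC₁, h₁⟩ := ψ.decay 0 1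
  obtain ⟨C₂, hC₂, h₂⟩ := ψ.decay N 0
  have hpi := Real.pi_gt_three
  refine ⟨1 + C₁ + C₂ * (2 * Real.pi) ^ N, by positivity, fun z => ⟨fun hz => ?_, fun hz => ?_⟩⟩
  · have e1 : ‖(avgExp (sym N z) : ℂ) - 1‖ ≤ |2 * Real.pi * z| := by
      rw [← Complex.ofReal_one, ← Complex.ofReal_sub, Complex.norm_real, Real.norm_eq_abs,
        abs_sub_comm, abs_of_nonneg (sub_nonneg.2 (avgExp_le_one (sym_nonneg N z)))]
      refine (one_sub_avgExp_le_self (sym_nonneg N z)).trans ?_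
      have : sym N z = |2 * Real.pi * z| ^ (2 * N) := by
        rw [sym, pow_mul, pow_mul, sq_abs]
      rw [this]
      exact pow_le_of_le_one (abs_nonneg _) hz (by lia)
    have e2 : ‖ψ 0 - ψ z‖ ≤ C₁ * |z| := by
      have := Convex.norm_image_sub_le_of_norm_deriv_le (f := ψ) (s := univ) (x := z) (y := 0)
        (C := C₁) (fun x _ => ψ.differentiableAt) (fun x _ => by
          have := h₁ x
          rwa [pow_zero, one_mul, norm_iteratedFDeriv_eq_norm_iteratedDeriv, iteratedDeriv_one]
            at this) convex_univ (mem_univ _) (mem_univ _)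
      simpa using this
    have e3 : |z| ≤ |2 * Real.pi * z| := by
      rw [abs_mul]
      exact le_mul_of_one_le_left (abs_nonneg z) (by rw [abs_of_pos (by positivity)]; linarith)
    calc _ = ‖((avgExp (sym N z) : ℂ) - 1) + (ψ 0 - ψ z)‖ := by rw [hψ]; congr 1; ring
      _ ≤ |2 * Real.pi * z| + C₁ * |2 * Real.pi * z| :=
        (norm_add_le _ _).trans (add_le_add e1 (e2.trans (by gcongr)))
      _ ≤ _ := by
        have : 0 ≤ C₂ * (2 * Real.pi) ^ N * |2 * Real.pi * z| := by positivity
        linarith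
  · have hs : 1 ≤ sym N z := by
      have : sym N z = |2 * Real.pi * z| ^ (2 * N) := by
        rw [sym, pow_mul, pow_mul, sq_abs]
      rw [this]; exact one_le_pow₀ hz
    have e1 : avgExp (sym N z) * |2 * Real.pi * z| ^ N ≤ 1 := by
      have h3 := mul_avgExp (sym N z)
      have h4 : |2 * Real.pi * z| ^ N ≤ sym N z := by
        have : sym N z = |2 * Real.pi * z| ^ (2 * N) := by
          rw [sym, pow_mul, pow_mul, sq_abs]
        rw [this]; exact pow_le_pow_right₀ hz (by lia)
      have h5 := avgExp_nonneg (sym_nonneg N z)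
      have h6 := Real.exp_nonneg (-sym N z)
      nlinarith
    have e2 : ‖ψ z‖ * |2 * Real.pi * z| ^ N ≤ C₂ * (2 * Real.pi) ^ N := by
      have := h₂ z
      rw [norm_iteratedFDeriv_zero, Real.norm_eq_abs] at this
      rw [abs_mul, abs_of_pos (by positivity : 0 < 2 * Real.pi), mul_pow]
      have h7 : 0 < (2 * Real.pi) ^ N := by positivity
      nlinarith
    calc _ ≤ (avgExp (sym N z) + ‖ψ z‖) * |2 * Real.pi * z| ^ N := by
          gcongr
          refine (norm_sub_le _ _).trans_eq ?_
          rw [Complex.norm_real, Real.norm_of_nonneg (avgExp_nonneg (sym_nonneg N z))]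
      _ ≤ _ := by rw [add_mul]; linarith

/-- The Fourier weight of the norm `‖f‖² + energy f`. -/
def wt (N : ℕ) (h ξ : ℝ) : ℝ := 1 + (1 - Real.exp (-h * sym N ξ)) / h

theorem one_le_wt (N : ℕ) {h : ℝ} (hh : 0 < h) (ξ : ℝ) : 1 ≤ wt N h ξ := by
  have := div_nonneg (one_sub_exp_nonneg (N := N) hh ξ) hh.le
  unfold wt; linarith

/-- The square norm `‖f‖² + energy f` on the Fourier side. -/
def wnorm (a b : ℝ) (N : ℕ) (h : ℝ) (f : ℝ → ℂ) : ℝ := ∫ ξ, wt N h ξ * ‖hat a b f ξ‖ ^ 2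

theorem integrable_wnorm {N : ℕ} {h : ℝ} (hh : 0 < h) {f : ℝ → ℂ} (hf : MemLp f 2 (ivl a b)) :
    Integrable (fun ξ => wt N h ξ * ‖hat a b f ξ‖ ^ 2) := by
  refine ((integrable_norm_sq_hat hf).add (integrable_energy (N := N) hh hf)).congr
    (Eventually.of_forall fun ξ => ?_)
  simp only [Pi.add_apply, wt]; ring

theorem wnorm_eq {N : ℕ} {h : ℝ} (hh : 0 < h) (f : L2i a b) :
    wnorm a b N h f = ‖f‖ ^ 2 + energy a b N h f := by
  rw [norm_sq_eq_integral_hat, energy, wnorm, ← integral_add (integrable_norm_sq_hat (Lp.memLp f))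
    (integrable_energy hh (Lp.memLp f))]
  congr 1; ext ξ; simp only [wt]; ring

theorem sq_norm_le_wnorm {N : ℕ} {h : ℝ} (hh : 0 < h) (f : L2i a b) :
    ‖f‖ ^ 2 ≤ wnorm a b N h f := by
  rw [wnorm_eq hh]; linarith [energy_nonneg (a := a) (b := b) (N := N) hh f]

theorem wnorm_nonneg {N : ℕ} {h : ℝ} (hh : 0 < h) (f : L2i a b) : 0 ≤ wnorm a b N h f :=
  (sq_nonneg _).trans (sq_norm_le_wnorm hh f)

/-- The weighted pointwise bound behind the decay of boundary terms; here `X = 2πξ`. -/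
theorem boundary_pointwise {N k : ℕ} (hk : k < N) {δ X K C : ℝ} (hδ : 0 < δ) (hδ1 : δ ≤ 1)
    (hC : 0 < C) (hX : 0 ≤ X) (hK : 0 ≤ K) (h1 : δ * X ≤ 1 → K ≤ C * (δ * X))
    (h2 : 1 ≤ δ * X → K * (δ * X) ^ N ≤ C) :
    (K * X ^ k) ^ 2 ≤
      4 * C ^ 2 * δ ^ 2 * (1 + (δ * X) ^ 2)⁻¹ *
        (1 + (1 - Real.exp (-δ ^ (2 * N) * X ^ (2 * N))) / δ ^ (2 * N)) := by
  have hexp := div_one_add_le_one_sub_exp (x := (δ * X) ^ (2 * N)) (by positivity)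
  rw [show -(δ * X) ^ (2 * N) = -δ ^ (2 * N) * X ^ (2 * N) by rw [mul_pow]; ring] at hexp
  set E := 1 - Real.exp (-δ ^ (2 * N) * X ^ (2 * N)) with hE
  have hδN : 0 < δ ^ (2 * N) := by positivity
  -- At low frequency K ≤ CδX, and X^{2k+2} ≤ 1 + X^{2N} is controlled by the weight because k < N.
  -- At high frequency the weight is at least 1/(2δ^{2N}), the decay of K supplies (δX)^{-N}, and k
  -- < N enters again through δ^{2N} ≤ δ^{2k+2}. The factor (1 + (δX)²)^{-1} is kept for
  -- integrability in X.
  rcases le_total (δ * X) 1 with h | h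
  · have h3 : X ^ (2 * N) / 2 ≤ E / δ ^ (2 * N) := by
      rw [le_div_iff₀ hδN]
      refine le_trans ?_ hexp
      rw [div_mul_eq_mul_div, mul_comm (X ^ _), ← mul_pow]
      have : (δ * X) ^ (2 * N) ≤ 1 := pow_le_one₀ (by positivity) h
      gcongr; linarith
    have h4 : X ^ (2 * k + 2) ≤ 1 + X ^ (2 * N) := by
      rcases le_total X 1 with hx | hx
      · have := pow_le_one₀ (n := 2 * k + 2) hX hx
        have : 0 ≤ X ^ (2 * N) := by positivity
        linarith
      · have := pow_le_pow_right₀ hx (show 2 * k + 2 ≤ 2 * N by lia)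
        linarith
    have h5 : 1 / 2 ≤ (1 + (δ * X) ^ 2)⁻¹ := by
      rw [← one_div]
      apply one_div_le_one_div_of_le (by positivity)
      have : (δ * X) ^ 2 ≤ 1 := pow_le_one₀ (by positivity) h
      linarith
    calc (K * X ^ k) ^ 2 ≤ (C * (δ * X) * X ^ k) ^ 2 := by gcongr; exact h1 h
      _ = C ^ 2 * δ ^ 2 * X ^ (2 * k + 2) := by ring
      _ ≤ C ^ 2 * δ ^ 2 * (2 * (1 + E / δ ^ (2 * N))) := by gcongr; linarith
      _ = 4 * C ^ 2 * δ ^ 2 * (1 / 2) * (1 + E / δ ^ (2 * N)) := by ring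
      _ ≤ _ := by
        have : 0 ≤ X ^ (2 * N) / 2 := by positivity
        have : 0 ≤ 1 + E / δ ^ (2 * N) := by linarith
        gcongr
  · have h3 : 1 / 2 ≤ E := by
      refine le_trans ?_ hexp
      have : 1 ≤ (δ * X) ^ (2 * N) := one_le_pow₀ h
      rw [div_le_div_iff₀ (by norm_num) (by positivity)]; linarith
    have h4 : (1 / 2) / δ ^ (2 * N) ≤ 1 + E / δ ^ (2 * N) := by
      have : (1 / 2) / δ ^ (2 * N) ≤ E / δ ^ (2 * N) := by gcongr
      linarith
    have hX0 : 0 < X := by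
      rcases hX.eq_or_lt with h0 | h0
      · rw [← h0] at h; norm_num at h
      · exact h0
    have hZ : 0 < δ * X := by positivity
    have h5 : (δ * X) ^ (2 * k) * (1 + (δ * X) ^ 2) ≤ 2 * (δ * X) ^ (2 * N) := by
      have e1 : (1 + (δ * X) ^ 2) ≤ 2 * (δ * X) ^ 2 := by nlinarith
      calc _ ≤ (δ * X) ^ (2 * k) * (2 * (δ * X) ^ 2) := by gcongr
        _ = 2 * (δ * X) ^ (2 * k + 2) := by ring
        _ ≤ _ := by exact mul_le_mul_of_nonneg_left (pow_le_pow_right₀ h (by lia)) (by norm_num)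
    have h6 : δ ^ (2 * N) ≤ δ ^ (2 * k) * δ ^ 2 := by
      rw [← pow_add]; exact pow_le_pow_of_le_one hδ.le hδ1 (by lia)
    have h7 : (K * X ^ k) ^ 2 ≤ 4 * C ^ 2 * δ ^ 2 * (1 + (δ * X) ^ 2)⁻¹ * ((1 / 2) / δ ^ (2 * N)) := by
      have e1 : 4 * C ^ 2 * δ ^ 2 * (1 + (δ * X) ^ 2)⁻¹ * ((1 / 2) / δ ^ (2 * N)) =
          (2 * C ^ 2 * δ ^ 2) / ((1 + (δ * X) ^ 2) * δ ^ (2 * N)) := by field_simp; ring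
      rw [e1, le_div_iff₀ (by positivity)]
      have e2 : (K * (δ * X) ^ N) ^ 2 ≤ C ^ 2 := by gcongr; exact h2 h
      calc (K * X ^ k) ^ 2 * ((1 + (δ * X) ^ 2) * δ ^ (2 * N))
          ≤ (K * X ^ k) ^ 2 * ((1 + (δ * X) ^ 2) * (δ ^ (2 * k) * δ ^ 2)) := by gcongr
        _ = K ^ 2 * δ ^ 2 * ((δ * X) ^ (2 * k) * (1 + (δ * X) ^ 2)) := by
          rw [mul_pow, mul_pow δ X (2 * k), ← pow_mul, mul_comm k 2]; ring
        _ ≤ K ^ 2 * δ ^ 2 * (2 * (δ * X) ^ (2 * N)) := by gcongr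
        _ = 2 * δ ^ 2 * (K * (δ * X) ^ N) ^ 2 := by rw [mul_pow K, ← pow_mul, mul_comm N 2]; ring
        _ ≤ 2 * δ ^ 2 * C ^ 2 := by gcongr
        _ = _ := by ring
    refine h7.trans ?_
    gcongr

/-- By Parseval the integral pairs w with a multiple of ψ^{(k)}((y - c)/δ), which vanishes on (a,
b). -/
theorem integral_conj_hat_mul_eq_zero {ψ : 𝓢(ℝ, ℂ)} {c c₀ δ : ℝ} (hδ : 0 < δ)
    (hψ : ∀ z, 1 / 2 ≤ |z - c₀| → ψ z = 0)
    (hc : ∀ y ∈ Ioo a b, 1 / 2 < |(y - c) / δ - c₀|) (k : ℕ) {w : ℝ → ℂ}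
    (hw : MemLp w 2 (ivl a b)) :
    Integrable (fun ξ : ℝ => conj (hat a b w ξ) * ((2 * Real.pi * Complex.I * ξ) ^ k *
      Complex.exp ((-2 * Real.pi * c * ξ : ℝ) * Complex.I) * 𝓕 ψ (δ * ξ))) ∧
    ∫ ξ : ℝ, conj (hat a b w ξ) * ((2 * Real.pi * Complex.I * ξ) ^ k *
      Complex.exp ((-2 * Real.pi * c * ξ : ℝ) * Complex.I) * 𝓕 ψ (δ * ξ)) = 0 := by
  set B : ℝ → ℂ := fun ξ => (2 * Real.pi * Complex.I * ξ) ^ k *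
      Complex.exp ((-2 * Real.pi * c * ξ : ℝ) * Complex.I) * 𝓕 ψ (δ * ξ) with hB
  have hΨc : Continuous (𝓕 ψ : 𝓢(ℝ, ℂ)) := (𝓕 ψ : 𝓢(ℝ, ℂ)).continuous
  have hp : Integrable (fun η : ℝ => (2 * Real.pi * Complex.I * η) ^ k * 𝓕 ψ η) := by
    refine (((𝓕 ψ : 𝓢(ℝ, ℂ)).integrable_pow_mul volume k).const_mul ((2 * Real.pi) ^ k)).mono'
      (by fun_prop) (Eventually.of_forall fun η => ?_)
    rw [norm_mul, norm_pow]
    simp only [norm_mul, Complex.norm_I, Complex.norm_real, Complex.norm_ofNat]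
    rw [Real.norm_of_nonneg Real.pi_pos.le, mul_one, mul_pow, mul_assoc]
  have hBint : Integrable B := by
    have h1 : Integrable (fun ξ : ℝ => (2 * Real.pi * Complex.I * (δ * ξ : ℝ)) ^ k * 𝓕 ψ (δ * ξ)) :=
      hp.comp_mul_left' hδ.ne'
    have h2 := (h1.const_mul ((δ : ℂ) ^ k)⁻¹).bdd_mul (c := 1)
      (f := fun ξ : ℝ => Complex.exp ((-2 * Real.pi * c * ξ : ℝ) * Complex.I))
      (by fun_prop) (Eventually.of_forall fun ξ => (Complex.norm_exp_ofReal_mul_I _).le)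
    refine h2.congr (Eventually.of_forall fun ξ => ?_)
    simp only [hB]
    have : (δ : ℂ) ^ k ≠ 0 := pow_ne_zero _ (by exact_mod_cast hδ.ne')
    field_simp
    push_cast; ring
  refine ⟨?_, ?_⟩
  · refine hBint.bdd_mul (c := ∫ y, ‖w y‖ ∂(ivl a b)) ?_ (Eventually.of_forall fun ξ => ?_)
    · exact (Complex.continuous_conj.comp (continuous_hat hw)).aestronglyMeasurable
    · rw [RCLike.norm_conj]; exact norm_hat_le w ξ
  rw [hat, integral_conj_fourier_mul_eq (integrable_ext0 hw) hBint]
  -- the `k`-th derivative of `ψ` and its Fourier transform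
  have hψd : ContDiff ℝ ∞ ψ := ψ.smooth'
  have hψs : HasCompactSupport ψ := by
    refine HasCompactSupport.intro (K := Metric.closedBall c₀ (1 / 2)) (isCompact_closedBall _ _)
      fun z hz => hψ z ?_
    rw [Metric.mem_closedBall, not_le, Real.dist_eq] at hz; exact hz.le
  have hcont : ∀ j : ℕ, Continuous (iteratedDeriv j ψ) := fun j =>
    hψd.continuous_iteratedDeriv j (by exact_mod_cast le_top)
  have hcomp : ∀ j : ℕ, HasCompactSupport (iteratedDeriv j ψ) := fun j => by
    refine HasCompactSupport.intro (K := Metric.closedBall c₀ (1 / 2)) (isCompact_closedBall _ _)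
      fun z hz => ?_
    have : (ψ : ℝ → ℂ) =ᶠ[𝓝 z] fun _ => 0 := by
      filter_upwards [Metric.isClosed_closedBall.isOpen_compl.mem_nhds hz] with y hy
      rw [mem_compl_iff, Metric.mem_closedBall, not_le, Real.dist_eq] at hy
      exact hψ y hy.le
    rw [this.iteratedDeriv_eq j]; simp
  have hint : ∀ j : ℕ, Integrable (iteratedDeriv j ψ) := fun j =>
    (hcont j).integrable_of_hasCompactSupport (hcomp j)
  have hF : 𝓕 (iteratedDeriv k ψ) = fun η : ℝ => (2 * Real.pi * Complex.I * η) ^ k * 𝓕 ψ η := by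
    rw [Real.fourier_iteratedDeriv (N := ⊤) hψd (fun n _ => hint n) le_top]
    ext η; rw [smul_eq_mul, SchwartzMap.fourier_coe]
  have hinv : 𝓕⁻ (fun η : ℝ => (2 * Real.pi * Complex.I * η) ^ k * 𝓕 ψ η) = iteratedDeriv k ψ := by
    rw [← hF]
    exact (hcont k).fourierInv_fourier_eq (hint k) (by rw [hF]; exact hp)
  have hzero : ∀ y ∈ Ioo a b, 𝓕⁻ B y = 0 := by
    intro y hy
    set z := (y - c) / δ with hz
    have e1 : 𝓕⁻ B y = ∫ ξ : ℝ, (fun η : ℝ => ((δ : ℂ) ^ k)⁻¹ *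
        (Complex.exp (↑(2 * Real.pi * inner ℝ η z) * Complex.I) •
          ((2 * Real.pi * Complex.I * η) ^ k * 𝓕 ψ η))) (δ * ξ) := by
      rw [Real.fourierInv_eq']
      congr 1; ext ξ
      simp only [hB, smul_eq_mul, RCLike.inner_apply, conj_trivial]
      have e2 : Complex.exp (↑(2 * Real.pi * (z * (δ * ξ))) * Complex.I) =
          Complex.exp (↑(2 * Real.pi * (y * ξ)) * Complex.I) *
            Complex.exp ((-2 * Real.pi * c * ξ : ℝ) * Complex.I) := by
        rw [← Complex.exp_add, ← add_mul, ← Complex.ofReal_add]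
        congr 3
        rw [hz]; field_simp; ring
      rw [e2]
      have : (δ : ℂ) ^ k ≠ 0 := pow_ne_zero _ (by exact_mod_cast hδ.ne')
      field_simp
      push_cast; ring
    rw [e1, Measure.integral_comp_mul_left (fun η : ℝ => ((δ : ℂ) ^ k)⁻¹ *
        (Complex.exp (↑(2 * Real.pi * inner ℝ η z) * Complex.I) •
          ((2 * Real.pi * Complex.I * η) ^ k * 𝓕 ψ η))) δ, integral_const_mul,
      ← Real.fourierInv_eq', hinv]
    have : (ψ : ℝ → ℂ) =ᶠ[𝓝 z] fun _ => 0 := by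
      have hopen : IsOpen {z : ℝ | 1 / 2 < |z - c₀|} := isOpen_lt continuous_const (by fun_prop)
      filter_upwards [hopen.mem_nhds (hc y hy)] with y hy
      exact hψ y (le_of_lt hy)
    rw [this.iteratedDeriv_eq k]; simp
  rw [← integral_zero ℝ ℂ]
  congr 1; ext y
  by_cases hy : y ∈ Ioo a b
  · rw [hzero y hy, mul_zero]
  · simp [ext0, hy]

theorem two_mul_le_add_of_sq_le {p x y : ℝ} (hx : 0 ≤ x) (hy : 0 ≤ y) (h : p ^ 2 ≤ x * y) :
    2 * p ≤ x + y :=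
  le_of_sq_le_sq (by nlinarith [sq_nonneg (x - y)]) (by positivity)

/-- The exponential `e^{-2πicξ}`. -/
def chr (c ξ : ℝ) : ℂ := Complex.exp ((-2 * Real.pi * c * ξ : ℝ) * Complex.I)

theorem continuous_chr (c : ℝ) : Continuous (chr c) := by unfold chr; fun_prop

theorem norm_chr (c ξ : ℝ) : ‖chr c ξ‖ = 1 := Complex.norm_exp_ofReal_mul_I _

theorem sym_mul (N : ℕ) (δ ξ : ℝ) : sym N (δ * ξ) = δ ^ (2 * N) * sym N ξ := by
  unfold sym; rw [← mul_pow]; ring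

theorem sym_eq_abs_pow (N : ℕ) (ξ : ℝ) : sym N ξ = |2 * Real.pi * ξ| ^ (2 * N) := by
  rw [sym, pow_mul, pow_mul, sq_abs]

/-- Subtracting the vanishing pairing with the displaced bump replaces φ(hs) by its difference from
the transform of the bump. Relative to the weight, the square of what remains is at most G, whose
integral is O(δ); splitting the product with parameter √δ leaves a bound of order √δ. -/
theorem exists_boundary_bound {N k : ℕ} (hk : k < N) (c₀ : ℝ) :
    ∃ C : ℝ, 0 < C ∧ ∀ {a b δ c : ℝ}, 0 < δ → δ ≤ 1 →
      (∀ y ∈ Ioo a b, 1 / 2 < |(y - c) / δ - c₀|) → ∀ w : L2i a b,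
      Integrable (fun ξ : ℝ => (avgExp (δ ^ (2 * N) * sym N ξ) : ℂ) * (conj (hat a b w ξ) *
        ((2 * Real.pi * Complex.I * ξ) ^ k * chr c ξ))) ∧
      ‖∫ ξ : ℝ, (avgExp (δ ^ (2 * N) * sym N ξ) : ℂ) * (conj (hat a b w ξ) *
        ((2 * Real.pi * Complex.I * ξ) ^ k * chr c ξ))‖ ≤
        C * √δ * (1 + wnorm a b N (δ ^ (2 * N)) w) := by
  obtain ⟨ψ, hψ0, hψ⟩ := exists_schwartz_bump c₀
  obtain ⟨C, hC, hbd⟩ := exists_bound_avgExp_sub N (by lia) (𝓕 ψ) hψ0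
  refine ⟨C ^ 2 + 1, by positivity, fun {a b δ c} hδ hδ1 hc w => ?_⟩
  have hw := Lp.memLp w
  set h := δ ^ (2 * N) with hh
  have hh0 : 0 < h := by positivity
  obtain ⟨hBint, hB0⟩ := integral_conj_hat_mul_eq_zero hδ hψ hc k hw
  set A : ℝ → ℂ := fun ξ => (avgExp (h * sym N ξ) : ℂ) * (conj (hat a b w ξ) *
        ((2 * Real.pi * Complex.I * ξ) ^ k * chr c ξ)) with hA
  set B : ℝ → ℂ := fun ξ : ℝ => conj (hat a b w ξ) * ((2 * Real.pi * Complex.I * ξ) ^ k *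
      Complex.exp ((-2 * Real.pi * c * ξ : ℝ) * Complex.I) * 𝓕 ψ (δ * ξ)) with hB
  have hAm : AEStronglyMeasurable A := by
    refine (Complex.measurable_ofReal.comp (measurable_avgExp.comp
      (continuous_const.mul (continuous_sym N)).measurable)).aestronglyMeasurable.mul ?_
    exact ((Complex.continuous_conj.comp (continuous_hat hw)).mul
      ((by fun_prop : Continuous fun ξ : ℝ => (2 * Real.pi * Complex.I * ξ : ℂ) ^ k).mul
        (continuous_chr c))).aestronglyMeasurable
  set G : ℝ → ℝ := fun ξ => 4 * C ^ 2 * δ ^ 2 * (1 + (δ * |2 * Real.pi * ξ|) ^ 2)⁻¹ with hG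
  have hG' : G = fun ξ => 4 * C ^ 2 * δ ^ 2 * (1 + ((δ * (2 * Real.pi)) * ξ) ^ 2)⁻¹ := by
    ext ξ
    simp only [hG]
    rw [mul_pow, sq_abs, ← mul_pow, mul_assoc δ]
  have hGint : Integrable G := by
    rw [hG']
    exact (integrable_inv_one_add_sq.comp_mul_left' (by positivity)).const_mul _
  have hGval : ∫ ξ, G ξ = 2 * C ^ 2 * δ := by
    rw [hG', integral_const_mul, Measure.integral_comp_mul_left (fun ξ : ℝ => (1 + ξ ^ 2)⁻¹),
      integral_univ_inv_one_add_sq, smul_eq_mul, abs_of_pos (by positivity)]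
    field_simp
    norm_num
  have hsδ : 0 < √δ := Real.sqrt_pos.2 hδ
  have hpt : ∀ ξ, ‖A ξ - B ξ‖ ≤ (G ξ / √δ + √δ * (wt N h ξ * ‖hat a b w ξ‖ ^ 2)) / 2 := by
    intro ξ
    set K := ‖(avgExp (sym N (δ * ξ)) : ℂ) - 𝓕 ψ (δ * ξ)‖ with hK
    set X := |2 * Real.pi * ξ| with hX
    have hδX : |2 * Real.pi * (δ * ξ)| = δ * X := by
      rw [hX, mul_left_comm, abs_mul, abs_of_pos hδ]
    have h1 := hbd (δ * ξ)
    rw [hδX] at h1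
    have h2 := boundary_pointwise hk hδ hδ1 hC (abs_nonneg (2 * Real.pi * ξ)) (norm_nonneg _)
      h1.1 h1.2
    have hwt : (1 + (1 - Real.exp (-δ ^ (2 * N) * X ^ (2 * N))) / δ ^ (2 * N)) = wt N h ξ := by
      rw [wt, sym_eq_abs_pow]
    rw [hwt] at h2
    have hnorm : ‖A ξ - B ξ‖ = K * X ^ k * ‖hat a b w ξ‖ := by
      have : A ξ - B ξ = ((avgExp (sym N (δ * ξ)) : ℂ) - 𝓕 ψ (δ * ξ)) *
          ((2 * Real.pi * Complex.I * ξ) ^ k) * conj (hat a b w ξ) * chr c ξ := by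
        simp only [hA, hB, chr, sym_mul]; ring
      rw [this, norm_mul, norm_chr, norm_mul, norm_mul, RCLike.norm_conj, norm_pow]
      simp only [norm_mul, Complex.norm_I, Complex.norm_real, Complex.norm_ofNat, mul_one]
      rw [hX, hK, abs_mul, abs_mul]; simp
    rw [hnorm]
    have h3 := two_mul_le_add_of_sq_le (p := K * X ^ k * ‖hat a b w ξ‖) (x := G ξ / √δ)
      (y := √δ * (wt N h ξ * ‖hat a b w ξ‖ ^ 2)) (by positivity)
      (by have := one_le_wt N hh0 ξ; positivity) (by
        have : G ξ / √δ * (√δ * (wt N h ξ * ‖hat a b w ξ‖ ^ 2)) =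
          G ξ * wt N h ξ * ‖hat a b w ξ‖ ^ 2 := by field_simp
        rw [this, mul_pow _ ‖hat a b w ξ‖]
        exact mul_le_mul_of_nonneg_right h2 (by positivity))
    linarith
  have hbint : Integrable fun ξ => (G ξ / √δ + √δ * (wt N h ξ * ‖hat a b w ξ‖ ^ 2)) / 2 :=
    ((hGint.div_const _).add ((integrable_wnorm hh0 hw).const_mul _)).div_const 2
  have hABint : Integrable (fun ξ => A ξ - B ξ) :=
    hbint.mono' (hAm.sub hBint.aestronglyMeasurable) (Eventually.of_forall hpt)
  have hAint : Integrable A := (hABint.add hBint).congr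
    (Eventually.of_forall fun ξ => by simp)
  refine ⟨hAint, ?_⟩
  have : ∫ ξ, A ξ = ∫ ξ, (A ξ - B ξ) := by
    rw [integral_sub hAint hBint, hB0, sub_zero]
  rw [this]
  refine (norm_integral_le_of_norm_le hbint (Eventually.of_forall hpt)).trans ?_
  rw [integral_div, integral_add (hGint.div_const _) ((integrable_wnorm hh0 hw).const_mul _),
    integral_div, integral_const_mul √δ, hGval]
  have hQ := wnorm_nonneg (N := N) hh0 w
  change (2 * C ^ 2 * δ / √δ + √δ * wnorm a b N h w) / 2 ≤ _
  have e1 : 2 * C ^ 2 * δ / √δ = 2 * C ^ 2 * √δ := by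
    rw [mul_div_assoc, Real.div_sqrt]
  rw [e1]
  have : 0 ≤ C ^ 2 * √δ * wnorm a b N h w := by positivity
  nlinarith

/-! ### Consistency, stability and convergence of the discrete resolvents. -/

theorem inner_sub_comp {N : ℕ} (hN : 0 < N) {h : ℝ} (hh : 0 < h) (w v : L2i a b) :
    ⟪w, v - comp a b N hN h hh v⟫_ℂ = ∫ ξ, ((h * sym N ξ * avgExp (h * sym N ξ) : ℝ) : ℂ) *
      (conj (hat a b w ξ) * hat a b v ξ) := by
  have hi := integrable_conj_hat_mul (Lp.memLp v) (Lp.memLp w)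
  have hi2 : Integrable fun ξ => mult N h ξ * (conj (hat a b w ξ) * hat a b v ξ) :=
    hi.bdd_mul (continuous_mult N h).aestronglyMeasurable
      (Eventually.of_forall (norm_mult_le_one N hh.le))
  rw [inner_sub_right, inner_comp hN hh, inner_eq_integral_hat, ← integral_sub hi hi2]
  congr 1; ext ξ
  rw [mul_avgExp, mult]; push_cast
  rw [neg_mul]; ring

/-- `v` solves the Dirichlet problem `A v = g` on `(a, b)`, in Fourier form: `A v - g` is a
combination of derivatives of order `< N` of point masses at `a` and `b`. -/
def IsDirichletSol (N : ℕ) (v g : L2i a b) (ca cb : ℕ → ℂ) : Prop :=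
  ∀ ξ : ℝ, (sym N ξ : ℂ) * hat a b v ξ = hat a b g ξ + ∑ k ∈ Finset.range N,
    (2 * Real.pi * Complex.I * ξ) ^ k * (cb k * chr b ξ - ca k * chr a ξ)

/-- Consistency: (1 - T_h)v/h has symbol φ(hs) s, and the equation for v turns s v̂ into ĝ plus
boundary terms. Replacing φ by 1 in front of ĝ, and discarding the boundary terms, both cost O(√δ)
against functions w of bounded energy norm. -/
theorem exists_inner_sub_comp_bound {N : ℕ} (hN : 0 < N) {v g : L2i a b} {ca cb : ℕ → ℂ}
    (hv : IsDirichletSol N v g ca cb) :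
    ∃ C : ℝ, 0 < C ∧ ∀ (δ : ℝ) (hδ : 0 < δ), δ ≤ 1 → ∀ w : L2i a b,
      ‖⟪w, v - comp a b N hN (δ ^ (2 * N)) (pow_pos hδ _) v⟫_ℂ / (δ ^ (2 * N) : ℝ) - ⟪w, g⟫_ℂ‖ ≤
        C * √δ * (1 + wnorm a b N (δ ^ (2 * N)) w) := by
  have hA : ∀ k : ℕ, ∃ C : ℝ, 0 < C ∧ (k < N → ∀ {δ : ℝ}, 0 < δ → δ ≤ 1 → ∀ w : L2i a b,
      Integrable (fun ξ : ℝ => (avgExp (δ ^ (2 * N) * sym N ξ) : ℂ) * (conj (hat a b w ξ) *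
        ((2 * Real.pi * Complex.I * ξ) ^ k * chr a ξ))) ∧
      ‖∫ ξ : ℝ, (avgExp (δ ^ (2 * N) * sym N ξ) : ℂ) * (conj (hat a b w ξ) *
        ((2 * Real.pi * Complex.I * ξ) ^ k * chr a ξ))‖ ≤
        C * √δ * (1 + wnorm a b N (δ ^ (2 * N)) w)) := fun k => by
    by_cases hk : k < N
    -- The bump sits to the left of a; for the endpoint b the sign changes and it sits to the right.
    · obtain ⟨C, hC, h⟩ := exists_boundary_bound hk (-1)
      refine ⟨C, hC, fun _ δ hδ hδ1 w => h hδ hδ1 (fun y hy => ?_) w⟩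
      have : 0 < (y - a) / δ := div_pos (by linarith [hy.1]) hδ
      rw [abs_of_pos (by linarith)]; linarith
    · exact ⟨1, one_pos, fun h => absurd h hk⟩
  have hB : ∀ k : ℕ, ∃ C : ℝ, 0 < C ∧ (k < N → ∀ {δ : ℝ}, 0 < δ → δ ≤ 1 → ∀ w : L2i a b,
      Integrable (fun ξ : ℝ => (avgExp (δ ^ (2 * N) * sym N ξ) : ℂ) * (conj (hat a b w ξ) *
        ((2 * Real.pi * Complex.I * ξ) ^ k * chr b ξ))) ∧
      ‖∫ ξ : ℝ, (avgExp (δ ^ (2 * N) * sym N ξ) : ℂ) * (conj (hat a b w ξ) *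
        ((2 * Real.pi * Complex.I * ξ) ^ k * chr b ξ))‖ ≤
        C * √δ * (1 + wnorm a b N (δ ^ (2 * N)) w)) := fun k => by
    by_cases hk : k < N
    · obtain ⟨C, hC, h⟩ := exists_boundary_bound hk 1
      refine ⟨C, hC, fun _ δ hδ hδ1 w => h hδ hδ1 (fun y hy => ?_) w⟩
      have : (y - b) / δ < 0 := div_neg_of_neg_of_pos (by linarith [hy.2]) hδ
      rw [abs_of_neg (by linarith)]; linarith
    · exact ⟨1, one_pos, fun h => absurd h hk⟩
  choose CA hCA hA using hA
  choose CB hCB hB using hB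
  refine ⟨1 + ‖g‖ ^ 2 + ∑ k ∈ Finset.range N, (‖cb k‖ * CB k + ‖ca k‖ * CA k), ?_, ?_⟩
  · have : 0 ≤ ∑ k ∈ Finset.range N, (‖cb k‖ * CB k + ‖ca k‖ * CA k) :=
      Finset.sum_nonneg fun k _ => by have := hCA k; have := hCB k; positivity
    positivity
  intro δ hδ hδ1 w
  set h := δ ^ (2 * N) with hh
  have hh0 : 0 < h := by positivity
  have hw := Lp.memLp w
  have hQ := wnorm_nonneg (N := N) hh0 w
  have hsδ : 0 < √δ := Real.sqrt_pos.2 hδ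
  set φ : ℝ → ℂ := fun ξ => (avgExp (h * sym N ξ) : ℂ) with hφ
  have hφm : AEStronglyMeasurable φ := (Complex.measurable_ofReal.comp (measurable_avgExp.comp
      (continuous_const.mul (continuous_sym N)).measurable)).aestronglyMeasurable
  have hφ1 : ∀ ξ, ‖φ ξ‖ ≤ 1 := fun ξ => by
    have := mul_nonneg hh0.le (sym_nonneg N ξ)
    rw [hφ, Complex.norm_real, Real.norm_of_nonneg (avgExp_nonneg this)]
    exact avgExp_le_one this
  have hg := integrable_conj_hat_mul (Lp.memLp g) hw
  have hφg : Integrable fun ξ => φ ξ * (conj (hat a b w ξ) * hat a b g ξ) :=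
    hg.bdd_mul hφm (Eventually.of_forall hφ1)
  set DA : ℕ → ℂ := fun k => ∫ ξ : ℝ, φ ξ * (conj (hat a b w ξ) *
        ((2 * Real.pi * Complex.I * ξ) ^ k * chr a ξ)) with hDA
  set DB : ℕ → ℂ := fun k => ∫ ξ : ℝ, φ ξ * (conj (hat a b w ξ) *
        ((2 * Real.pi * Complex.I * ξ) ^ k * chr b ξ)) with hDB
  have key : ⟪w, v - comp a b N hN h (pow_pos hδ _) v⟫_ℂ / (h : ℂ) =
      (∫ ξ, φ ξ * (conj (hat a b w ξ) * hat a b g ξ)) +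
        ∑ k ∈ Finset.range N, (cb k * DB k - ca k * DA k) := by
    rw [inner_sub_comp, ← integral_div]
    have hk : ∀ k ∈ Finset.range N, Integrable fun ξ : ℝ =>
        cb k * (φ ξ * (conj (hat a b w ξ) * ((2 * Real.pi * Complex.I * ξ) ^ k * chr b ξ))) -
        ca k * (φ ξ * (conj (hat a b w ξ) * ((2 * Real.pi * Complex.I * ξ) ^ k * chr a ξ))) :=
      fun k hk => ((hB k (Finset.mem_range.1 hk) hδ hδ1 w).1.const_mul _).sub
        ((hA k (Finset.mem_range.1 hk) hδ hδ1 w).1.const_mul _)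
    have e1 : ∑ k ∈ Finset.range N, (cb k * DB k - ca k * DA k) = ∫ ξ : ℝ, ∑ k ∈ Finset.range N,
        (cb k * (φ ξ * (conj (hat a b w ξ) * ((2 * Real.pi * Complex.I * ξ) ^ k * chr b ξ))) -
        ca k * (φ ξ * (conj (hat a b w ξ) * ((2 * Real.pi * Complex.I * ξ) ^ k * chr a ξ)))) := by
      rw [integral_finsetSum _ hk]
      refine Finset.sum_congr rfl fun k hk => ?_
      rw [integral_sub ((hB k (Finset.mem_range.1 hk) hδ hδ1 w).1.const_mul _)
        ((hA k (Finset.mem_range.1 hk) hδ hδ1 w).1.const_mul _), integral_const_mul,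
        integral_const_mul]
    rw [e1, ← integral_add hφg (integrable_finsetSum _ hk)]
    congr 1; ext ξ
    have h1 := hv ξ
    have h2 : (h : ℂ) ≠ 0 := by exact_mod_cast hh0.ne'
    rw [div_eq_iff h2]
    push_cast
    calc _ = h * (φ ξ * (conj (hat a b w ξ) * (sym N ξ * hat a b v ξ))) := by rw [hφ]; ring
      _ = _ := by
        rw [h1, mul_comm _ (h : ℂ), mul_add (conj _), mul_add (φ ξ), Finset.mul_sum, Finset.mul_sum]
        congr 2
        refine Finset.sum_congr rfl fun k _ => ?_
        ring
  have e2 : ‖(∫ ξ, φ ξ * (conj (hat a b w ξ) * hat a b g ξ)) - ⟪w, g⟫_ℂ‖ ≤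
      √δ * (wnorm a b N h w + ‖g‖ ^ 2) / 2 := by
    rw [inner_eq_integral_hat, ← integral_sub hφg hg]
    have hi : Integrable fun ξ => √δ * (wt N h ξ * ‖hat a b w ξ‖ ^ 2 + ‖hat a b g ξ‖ ^ 2) / 2 :=
      (((integrable_wnorm hh0 hw).add (integrable_norm_sq_hat (Lp.memLp g))).const_mul _).div_const 2
    refine (norm_integral_le_of_norm_le hi (Eventually.of_forall fun ξ => ?_)).trans (le_of_eq ?_)
    · have hs := mul_nonneg hh0.le (sym_nonneg N ξ)
      have h3 : ‖φ ξ * (conj (hat a b w ξ) * hat a b g ξ) - conj (hat a b w ξ) * hat a b g ξ‖ =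
          (1 - avgExp (h * sym N ξ)) * (‖hat a b w ξ‖ * ‖hat a b g ξ‖) := by
        rw [← sub_one_mul, norm_mul, norm_mul, RCLike.norm_conj, hφ, ← Complex.ofReal_one,
          ← Complex.ofReal_sub, Complex.norm_real, Real.norm_eq_abs, abs_sub_comm,
          abs_of_nonneg (sub_nonneg.2 (avgExp_le_one hs))]
      rw [h3]
      have h4 := one_sub_avgExp_le hs
      have h5 := avgExp_nonneg hs
      have h6 := avgExp_le_one hs
      -- As 0 ≤ 1 - φ ≤ 1, the square is at most 1 - φ ≤ 1 - e^{-hs}, which is at most h times the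
      -- weight, and h ≤ δ.
      have h7 : (1 - avgExp (h * sym N ξ)) ^ 2 ≤ √δ * √δ * wt N h ξ := by
        rw [Real.mul_self_sqrt hδ.le]
        have h8 : 1 - Real.exp (-h * sym N ξ) ≤ h * wt N h ξ := by
          rw [wt, mul_add, mul_div_cancel₀ _ hh0.ne']; linarith
        have h9 : h ≤ δ := by
          have := pow_le_pow_of_le_one hδ.le hδ1 (show 1 ≤ 2 * N by lia)
          simpa using this
        have h10 := one_le_wt N hh0 ξ
        rw [neg_mul] at h8
        nlinarith
      have := two_mul_le_add_of_sq_le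
        (p := (1 - avgExp (h * sym N ξ)) * (‖hat a b w ξ‖ * ‖hat a b g ξ‖))
        (x := √δ * (wt N h ξ * ‖hat a b w ξ‖ ^ 2)) (y := √δ * ‖hat a b g ξ‖ ^ 2)
        (by have := one_le_wt N hh0 ξ; positivity) (by positivity) (by
          calc _ = (1 - avgExp (h * sym N ξ)) ^ 2 * (‖hat a b w ξ‖ * ‖hat a b g ξ‖) ^ 2 := by ring
            _ ≤ √δ * √δ * wt N h ξ * (‖hat a b w ξ‖ * ‖hat a b g ξ‖) ^ 2 := by gcongr
            _ = _ := by ring)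
      linarith
    · rw [integral_div, integral_const_mul, integral_add (integrable_wnorm hh0 hw)
        (integrable_norm_sq_hat (Lp.memLp g)), ← norm_sq_eq_integral_hat]; rfl
  have e3 : ‖∑ k ∈ Finset.range N, (cb k * DB k - ca k * DA k)‖ ≤
      (∑ k ∈ Finset.range N, (‖cb k‖ * CB k + ‖ca k‖ * CA k)) * (√δ * (1 + wnorm a b N h w)) := by
    rw [Finset.sum_mul]
    refine norm_sum_le_of_le _ fun k hk => ?_
    have h1 := (hB k (Finset.mem_range.1 hk) hδ hδ1 w).2
    have h2 := (hA k (Finset.mem_range.1 hk) hδ hδ1 w).2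
    calc _ ≤ ‖cb k‖ * ‖DB k‖ + ‖ca k‖ * ‖DA k‖ := by
          refine (norm_sub_le _ _).trans_eq ?_
          rw [norm_mul, norm_mul]
      _ ≤ ‖cb k‖ * (CB k * √δ * (1 + wnorm a b N h w)) +
          ‖ca k‖ * (CA k * √δ * (1 + wnorm a b N h w)) := by gcongr
      _ = _ := by ring
  rw [key, add_sub_right_comm]
  refine (norm_add_le _ _).trans ((add_le_add e2 e3).trans ?_)
  have : √δ * (wnorm a b N h w + ‖g‖ ^ 2) / 2 ≤ (1 + ‖g‖ ^ 2) * (√δ * (1 + wnorm a b N h w)) := by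
    have h1 : 0 ≤ √δ * wnorm a b N h w := by positivity
    have h2 : 0 ≤ √δ * ‖g‖ ^ 2 := by positivity
    have h3 : 0 ≤ √δ * wnorm a b N h w * ‖g‖ ^ 2 := by positivity
    nlinarith
  linarith

/-- Stability: pairing the equation for w = y - v with w itself produces λ'‖w‖² + energy(w), which
dominates min(λ', 1) times the squared norm. The other side is the consistency error plus (λ'/λ -
1)⟨w, g⟩. The bound contains the norm of w again, with a small coefficient, and is absorbed later.
-/
theorem resolvent_estimate {N : ℕ} (hN : 0 < N) {e v : L2i a b} {lam : ℝ} (hlam : 0 < lam)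
    {ca cb : ℕ → ℂ} (hv : IsDirichletSol N v (e - (lam : ℂ) • v) ca cb) :
    ∃ C : ℝ, 0 < C ∧ ∀ (δ : ℝ) (hδ : 0 < δ), δ ≤ 1 → ∀ (lam' : ℝ) (y : L2i a b), 0 < lam' →
      y - comp a b N hN (δ ^ (2 * N)) (pow_pos hδ _) y =
        ((δ ^ (2 * N) * lam' : ℝ) : ℂ) • ((lam : ℂ)⁻¹ • e - y) →
      min lam' 1 * wnorm a b N (δ ^ (2 * N)) (y - v : L2i a b) ≤
        C * (√δ + |lam' / lam - 1|) * (1 + wnorm a b N (δ ^ (2 * N)) (y - v : L2i a b)) := by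
  obtain ⟨C, hC, hbd⟩ := exists_inner_sub_comp_bound hN hv
  set g : L2i a b := e - (lam : ℂ) • v with hg
  refine ⟨C + 1 + ‖g‖ ^ 2, by positivity, fun δ hδ hδ1 lam' y hlam' hy => ?_⟩
  set h := δ ^ (2 * N) with hh
  have hh0 : 0 < h := by positivity
  set T := comp a b N hN h (pow_pos hδ _) with hT
  set w : L2i a b := y - v with hw
  have hb := hbd δ hδ hδ1 w
  have hQ := wnorm_nonneg (N := N) hh0 w
  set Q := wnorm a b N h w with hQdef
  have hlc : (lam : ℂ) ≠ 0 := by exact_mod_cast hlam.ne'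
  have hhc : (h : ℂ) ≠ 0 := by exact_mod_cast hh0.ne'
  have e1 : w - T w = ((h * lam' : ℝ) : ℂ) • ((lam : ℂ)⁻¹ • g - w) - (v - T v) := by
    have h1 : w - T w = (y - T y) - (v - T v) := by rw [hw, map_sub]; abel
    rw [h1, hy]
    congr 2
    rw [hg, hw, smul_sub, smul_smul, inv_mul_cancel₀ hlc, one_smul]; abel
  have e2 : ((h * energy a b N h w : ℝ) : ℂ) =
      ((h * lam' : ℝ) : ℂ) * ((lam : ℂ)⁻¹ * ⟪w, g⟫_ℂ - ((‖w‖ ^ 2 : ℝ) : ℂ)) - ⟪w, v - T v⟫_ℂ := by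
    rw [← inner_sub_comp_self hN (pow_pos hδ _), ← hT, e1, inner_sub_right, inner_smul_right,
      inner_sub_right, inner_smul_right, inner_self_eq_norm_sq_to_K]
    push_cast; rfl
  have e3 : ((lam' * ‖w‖ ^ 2 + energy a b N h w : ℝ) : ℂ) =
      ((lam' / lam - 1 : ℝ) : ℂ) * ⟪w, g⟫_ℂ - (⟪w, v - T v⟫_ℂ / (h : ℝ) - ⟪w, g⟫_ℂ) := by
    have : (energy a b N h w : ℂ) = (lam' : ℂ) * ((lam : ℂ)⁻¹ * ⟪w, g⟫_ℂ - ((‖w‖ ^ 2 : ℝ) : ℂ)) -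
        ⟪w, v - T v⟫_ℂ / (h : ℝ) := by
      rw [eq_sub_iff_add_eq, ← mul_right_inj' hhc, mul_add, mul_div_cancel₀ _ hhc]
      push_cast at e2 ⊢
      linear_combination e2
    push_cast at this ⊢
    rw [this]
    field_simp
    ring
  have hE := energy_nonneg (a := a) (b := b) (N := N) hh0 w
  have e4 : lam' * ‖w‖ ^ 2 + energy a b N h w ≤
      |lam' / lam - 1| * (‖w‖ * ‖g‖) + C * √δ * (1 + Q) := by
    have h1 : lam' * ‖w‖ ^ 2 + energy a b N h w =
        ‖((lam' * ‖w‖ ^ 2 + energy a b N h w : ℝ) : ℂ)‖ := by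
      rw [Complex.norm_real, Real.norm_of_nonneg (by positivity)]
    rw [h1, e3]
    refine (norm_sub_le _ _).trans (add_le_add ?_ hb)
    rw [norm_mul, Complex.norm_real, Real.norm_eq_abs]
    exact mul_le_mul_of_nonneg_left (norm_inner_le_norm _ _) (abs_nonneg _)
  have e5 : min lam' 1 * Q ≤ lam' * ‖w‖ ^ 2 + energy a b N h w := by
    rw [hQdef, wnorm_eq hh0, mul_add]
    have h1 := min_le_left lam' 1
    have h2 := min_le_right lam' 1
    have h3 := sq_nonneg ‖w‖
    nlinarith
  have e6 : ‖w‖ * ‖g‖ ≤ (1 + ‖g‖ ^ 2) * (1 + Q) := by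
    have h1 := sq_norm_le_wnorm (N := N) hh0 w
    have h2 := sq_nonneg ‖g‖
    have h3 := mul_nonneg h2 hQ
    nlinarith [sq_nonneg (‖w‖ - ‖g‖)]
  have hA := abs_nonneg (lam' / lam - 1)
  have hsδ := Real.sqrt_nonneg δ
  refine (e5.trans e4).trans ?_
  calc _ ≤ |lam' / lam - 1| * ((1 + ‖g‖ ^ 2) * (1 + Q)) + C * √δ * (1 + Q) := by gcongr
    _ ≤ _ := by
      have h1 : 0 ≤ C * |lam' / lam - 1| * (1 + Q) := by positivity
      have h2 : 0 ≤ (1 + ‖g‖ ^ 2) * √δ * (1 + Q) := by positivity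
      nlinarith

theorem wnorm_resolvent_estimate {N : ℕ} (hN : 0 < N) {e v : L2i a b} {lam : ℝ} (hlam : 0 < lam)
    {ca cb : ℕ → ℂ} (hv : IsDirichletSol N v (e - (lam : ℂ) • v) ca cb) :
    ∃ C : ℝ, 0 < C ∧ ∀ (h : ℝ) (hh : 0 < h), h ≤ 1 → ∀ (lam' : ℝ) (y : L2i a b), 0 < lam' →
      y - comp a b N hN h hh y = ((h * lam' : ℝ) : ℂ) • ((lam : ℂ)⁻¹ • e - y) →
      min lam' 1 * wnorm a b N h (y - v : L2i a b) ≤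
        C * (√(h ^ (1 / (2 * N : ℝ))) + |lam' / lam - 1|) *
          (1 + wnorm a b N h (y - v : L2i a b)) := by
  obtain ⟨C, hC, H⟩ := resolvent_estimate hN hlam hv
  refine ⟨C, hC, fun h hh hh1 lam' y hl hy => ?_⟩
  obtain ⟨δ, hδ, hδh⟩ : ∃ δ : ℝ, 0 < δ ∧ δ ^ (2 * N) = h := by
    refine ⟨h ^ (1 / ((2 * N : ℕ) : ℝ)), by positivity, ?_⟩
    rw [← Real.rpow_natCast, ← Real.rpow_mul hh.le, one_div_mul_cancel, Real.rpow_one]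
    have : (0 : ℝ) < (2 * N : ℕ) := by exact_mod_cast (by lia : 0 < 2 * N)
    exact this.ne'
  subst hδh
  have h1 : (δ ^ (2 * N)) ^ (1 / (2 * N : ℝ)) = δ := by
    have h2 : (0 : ℝ) < 2 * N := by exact_mod_cast (by lia : 0 < 2 * N)
    rw [← Real.rpow_natCast, ← Real.rpow_mul hδ.le]
    push_cast
    rw [mul_one_div_cancel h2.ne', Real.rpow_one]
  rw [h1]
  have h3 : δ ≤ 1 := by
    by_contra hcon
    exact absurd hh1 (not_le.2 (one_lt_pow₀ (not_le.1 hcon) (by lia)))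
  exact H δ hδ h3 lam' y hl hy

/-- The compressed heat-type semigroup with time step `2^{-n}`. -/
def dyadicComp (a b : ℝ) (N : ℕ) (hN : 0 < N) (n : ℕ) : L2i a b →L[ℂ] L2i a b :=
  comp a b N hN ((2 : ℝ) ^ n)⁻¹ (by positivity)

theorem isPosContraction_dyadicComp {N : ℕ} (hN : 0 < N) (n : ℕ) :
    IsPosContraction (dyadicComp a b N hN n) := isPosContraction_comp hN _

theorem tendsto_two_pow_inv : Tendsto (fun n : ℕ => ((2 : ℝ) ^ n)⁻¹) atTop (𝓝 0) :=
  (tendsto_pow_atTop_atTop_of_one_lt one_lt_two).inv_tendsto_atTop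

/-- The Laplace transforms of the discrete semigroups converge to the solution of the Dirichlet
problem `λ v + A v = e`. -/
theorem tendsto_stepResolvent {N : ℕ} (hN : 0 < N) {e v : L2i a b} {lam : ℝ} (hlam : 0 < lam)
    {ca cb : ℕ → ℂ} (hv : IsDirichletSol N v (e - (lam : ℂ) • v) ca cb) :
    Tendsto (fun n : ℕ => stepResolvent (dyadicComp a b N hN n) (2 ^ n) e lam) atTop (𝓝 v) := by
  obtain ⟨C, hC, H⟩ := wnorm_resolvent_estimate hN hlam hv
  set h : ℕ → ℝ := fun n => ((2 : ℝ) ^ n)⁻¹ with hh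
  have hh0 : ∀ n, 0 < h n := fun n => by positivity
  have hh1 : ∀ n, h n ≤ 1 := fun n => inv_le_one_of_one_le₀ (one_le_pow₀ one_le_two)
  set ε : ℕ → ℝ := fun n =>
    C * (√(h n ^ (1 / (2 * N : ℝ))) + (Real.exp (lam * h n) - 1)) with hε
  have hε0 : Tendsto ε atTop (𝓝 0) := by
    have hN' : (0 : ℝ) < 1 / (2 * N : ℝ) := by positivity
    have h1 : Tendsto (fun n => h n ^ (1 / (2 * N : ℝ))) atTop (𝓝 (0 ^ (1 / (2 * N : ℝ)))) :=
      tendsto_two_pow_inv.rpow_const (Or.inr hN'.le)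
    rw [Real.zero_rpow hN'.ne'] at h1
    have h2 : Tendsto (fun n => Real.exp (lam * h n) - 1) atTop (𝓝 (Real.exp (lam * 0) - 1)) :=
      ((Real.continuous_exp.tendsto _).comp (tendsto_two_pow_inv.const_mul lam)).sub_const 1
    have h3 := ((h1.sqrt.add h2).const_mul C)
    have h4 : C * (√0 + (Real.exp (lam * 0) - 1)) = 0 := by simp
    rw [h4] at h3
    exact h3
  set y : ℕ → L2i a b := fun n => stepResolvent (dyadicComp a b N hN n) (2 ^ n) e lam with hy
  have key : ∀ n, min lam 1 * wnorm a b N (h n) (y n - v : L2i a b) ≤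
      ε n * (1 + wnorm a b N (h n) (y n - v : L2i a b)) := by
    intro n
    set q := Real.exp (-lam / 2 ^ n) with hq
    have hq0 : 0 < q := Real.exp_pos _
    have hqi : q⁻¹ = Real.exp (lam * h n) := by rw [hq, ← Real.exp_neg]; congr 1; simp only [hh]; ring
    -- Since the flow is constant on each time step, its transform solves the discrete equation with
    -- this λ' in place of λ; λ' ≥ λ, and λ'/λ tends to 1.
    set lam' := (Real.exp (lam * h n) - 1) / h n with hlam'
    have hxn : 0 < lam * h n := mul_pos hlam (hh0 n)
    have h1 : lam ≤ lam' := by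
      rw [hlam', le_div_iff₀ (hh0 n)]
      linarith [Real.add_one_le_exp (lam * h n)]
    have h2 : lam' / lam - 1 ≤ Real.exp (lam * h n) - 1 := by
      rw [sub_le_sub_iff_right, hlam', div_div, div_le_iff₀ (mul_pos (hh0 n) hlam)]
      have h4 := Real.add_one_le_exp (-(lam * h n))
      have h5 : Real.exp (lam * h n) * Real.exp (-(lam * h n)) = 1 := by
        rw [← Real.exp_add, add_neg_cancel, Real.exp_zero]
      have h6 := mul_le_mul_of_nonneg_left h4 (Real.exp_nonneg (lam * h n))
      linarith
    have h3 : 0 ≤ lam' / lam - 1 := by rw [sub_nonneg, le_div_iff₀ hlam]; linarith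
    have heq : y n - comp a b N hN (h n) (hh0 n) (y n) =
        ((h n * lam' : ℝ) : ℂ) • ((lam : ℂ)⁻¹ • e - y n) := by
      have := (isPosContraction_dyadicComp (a := a) (b := b) hN n).apply_stepResolvent
        (r := 2 ^ n) (by positivity) e hlam
      rw [← hq] at this
      have hqc : (q : ℂ) ≠ 0 := by exact_mod_cast hq0.ne'
      have hlc : (lam : ℂ) ≠ 0 := by exact_mod_cast hlam.ne'
      change (q : ℂ) • comp a b N hN (h n) (hh0 n) (y n) = y n - _ at this
      have h7 : h n * lam' = q⁻¹ - 1 := by rw [hqi, hlam', mul_div_cancel₀ _ (hh0 n).ne']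
      have h8 : comp a b N hN (h n) (hh0 n) (y n) =
          (q : ℂ)⁻¹ • (y n - (((1 - q) / lam : ℝ) : ℂ) • e) := by
        rw [← this, smul_smul, inv_mul_cancel₀ hqc, one_smul]
      rw [h8, h7, smul_sub, smul_sub, smul_smul, smul_smul]
      have h9 : (((q⁻¹ - 1 : ℝ) : ℂ) * (lam : ℂ)⁻¹) = (q : ℂ)⁻¹ * (((1 - q) / lam : ℝ) : ℂ) := by
        push_cast; field_simp
      rw [h9]
      push_cast
      rw [sub_smul, one_smul]; abel
    have := H (h n) (hh0 n) (hh1 n) lam' (y n) (hlam.trans_le h1) heq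
    have hQ := wnorm_nonneg (N := N) (hh0 n) (y n - v)
    calc _ ≤ min lam' 1 * wnorm a b N (h n) (y n - v : L2i a b) := by gcongr
      _ ≤ _ := this
      _ ≤ _ := by 
        rw [abs_of_nonneg h3]
        refine mul_le_mul_of_nonneg_right ?_ (by positivity)
        exact mul_le_mul_of_nonneg_left (add_le_add le_rfl h2) hC.le
  have hc0 : 0 < min lam 1 := lt_min hlam one_pos
  -- Once ε n is below half of min(λ, 1), the norm on the right of `key` is absorbed by the left.
  have hlim : ∀ᶠ n in atTop, ‖y n - v‖ ^ 2 ≤ 2 / min lam 1 * ε n := by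
    filter_upwards [hε0.eventually_lt_const (half_pos hc0)] with n hn
    have hQ := wnorm_nonneg (N := N) (hh0 n) (y n - v)
    refine (sq_norm_le_wnorm (N := N) (hh0 n) _).trans ?_
    rw [div_mul_eq_mul_div, le_div_iff₀ hc0]
    nlinarith [key n]
  have hsq : Tendsto (fun n => ‖y n - v‖ ^ 2) atTop (𝓝 0) := by
    refine squeeze_zero' (Eventually.of_forall fun n => sq_nonneg _) hlim ?_
    simpa using hε0.const_mul (2 / min lam 1)
  rw [tendsto_iff_norm_sub_tendsto_zero]
  have := hsq.sqrt
  simpa [Real.sqrt_sq] using this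

/-! ### Exponential sums, the Dirichlet problem and the determinants. -/

theorem stepResolvent_zero {H : Type*} [NormedAddCommGroup H] [InnerProductSpace ℂ H]
    (T : H →L[ℂ] H) (r lam : ℝ) : stepResolvent T r 0 lam = 0 := by
  simp [stepResolvent, stepFlow]

theorem memLp_of_continuous {f : ℝ → ℂ} (hf : Continuous f) : MemLp f 2 (ivl a b) := by
  obtain ⟨C, hC⟩ := isCompact_Icc.exists_bound_of_continuousOn (s := Icc a b) hf.continuousOn
  refine MemLp.of_bound hf.aestronglyMeasurable C ?_
  exact (ae_restrict_iff' measurableSet_Ioo).2 (Eventually.of_forall fun x hx =>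
    hC x (Ioo_subset_Icc_self hx))

/-- The element of `L²(a, b)` given by a continuous function. -/
def contL2 (a b : ℝ) (f : ℝ → ℂ) (hf : Continuous f) : L2i a b :=
  (memLp_of_continuous hf).toLp f

theorem coeFn_contL2 {f : ℝ → ℂ} (hf : Continuous f) : contL2 a b f hf =ᵐ[ivl a b] f :=
  (memLp_of_continuous hf).coeFn_toLp

theorem mul_hat_of_hasDerivAt (hab : a < b) {u u' : ℝ → ℂ} (hu : ∀ x, HasDerivAt u (u' x) x)
    (hu' : Continuous u') (ξ : ℝ) :
    (2 * Real.pi * Complex.I * ξ) * hat a b u ξ =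
      hat a b u' ξ - (u b * chr b ξ - u a * chr a ξ) := by
  set X : ℂ := 2 * Real.pi * Complex.I * ξ with hX
  set E : ℝ → ℂ := fun y => Complex.exp ((-2 * Real.pi * y * ξ : ℝ) * Complex.I) with hE
  have hEd : ∀ y, HasDerivAt E (-X * E y) y := fun y => by
    have h1 : HasDerivAt (fun y : ℝ => ((-2 * Real.pi * y * ξ : ℝ) * Complex.I : ℂ)) (-X) y := by
      have h2 : HasDerivAt (fun y : ℝ => (-X) * (y : ℂ)) (-X * 1) y :=
        (Complex.ofRealCLM.hasDerivAt (x := y)).const_mul (-X)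
      rw [mul_one] at h2
      convert h2 using 1
      ext y; rw [hX]; push_cast; ring
    exact h1.cexp.congr_deriv (mul_comm _ _)
  have hEc : Continuous E := continuous_iff_continuousAt.2 fun y => (hEd y).continuousAt
  have huc : Continuous u := continuous_iff_continuousAt.2 fun y => (hu y).continuousAt
  have hcv : ∀ f : ℝ → ℂ, hat a b f ξ = ∫ y in a..b, E y * f y := fun f => by
    rw [hat_eq_integral, intervalIntegral.integral_of_le hab.le, ← integral_Ioc_eq_integral_Ioo]
  rw [hcv, hcv]
  have h := intervalIntegral.integral_mul_deriv_eq_deriv_mul (a := a) (b := b) (u := E) (v := u)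
    (fun y _ => hEd y) (fun y _ => hu y) ((by fun_prop : Continuous fun y => -X * E y).intervalIntegrable _ _)
    (hu'.intervalIntegrable _ _)
  rw [h]
  have h2 : ∫ y in a..b, -X * E y * u y = -X * ∫ y in a..b, E y * u y := by
    rw [← intervalIntegral.integral_const_mul]
    congr 1; ext y; ring
  rw [h2]
  simp only [hE, chr]
  ring

theorem pow_mul_hat_of_hasDerivAt (hab : a < b) {V : ℕ → ℝ → ℂ}
    (hV : ∀ m x, HasDerivAt (V m) (V (m + 1) x) x) (M : ℕ) (ξ : ℝ) {k : ℕ} (hk : k ≤ M) :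
    (2 * Real.pi * Complex.I * ξ) ^ k * hat a b (V (M - k)) ξ = hat a b (V M) ξ -
      ∑ i ∈ Finset.range k, (2 * Real.pi * Complex.I * ξ) ^ i *
        (V (M - 1 - i) b * chr b ξ - V (M - 1 - i) a * chr a ξ) := by
  have hc : ∀ m, Continuous (V m) := fun m =>
    continuous_iff_continuousAt.2 fun y => (hV m y).continuousAt
  induction k with
  | zero => simp
  | succ k ih =>
    have h1 := mul_hat_of_hasDerivAt hab (hV (M - (k + 1))) (hc _) ξ
    rw [show M - (k + 1) + 1 = M - k by lia] at h1
    rw [pow_succ, mul_assoc, h1, mul_sub, ih (by lia), Finset.sum_range_succ,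
      show M - 1 - k = M - (k + 1) by lia]
    ring

/-- `V m` is the m-th derivative of `V 0`. After 2N integrations by parts the endpoint values of `V
(2N - 1 - i)` accompany (2πiξ)^i. The Dirichlet conditions kill the terms with i ≥ N, leaving
exactly the orders that `IsDirichletSol` allows. -/
theorem exists_isDirichletSol (hab : a < b) {N : ℕ} {V : ℕ → ℝ → ℂ}
    (hV : ∀ m x, HasDerivAt (V m) (V (m + 1) x) x) (ha : ∀ k < N, V k a = 0)
    (hb : ∀ k < N, V k b = 0) (h0 : Continuous (V 0))
    (h1 : Continuous fun x => (-1) ^ N * V (2 * N) x) :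
    ∃ ca cb, IsDirichletSol N (contL2 a b (V 0) h0) (contL2 a b _ h1) ca cb := by
  refine ⟨fun k => -(-1) ^ N * V (2 * N - 1 - k) a, fun k => -(-1) ^ N * V (2 * N - 1 - k) b,
    fun ξ => ?_⟩
  rw [hat_congr (coeFn_contL2 h0), hat_congr (coeFn_contL2 h1)]
  have h2 := pow_mul_hat_of_hasDerivAt hab hV (2 * N) ξ le_rfl
  rw [Nat.sub_self] at h2
  have h3 : (sym N ξ : ℂ) = (-1) ^ N * (2 * Real.pi * Complex.I * ξ) ^ (2 * N) := by
    have : (2 * Real.pi * Complex.I * ξ : ℂ) = (2 * Real.pi * ξ) * Complex.I := by ring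
    rw [this, mul_pow, pow_mul Complex.I, Complex.I_sq, sym]
    push_cast
    rw [mul_left_comm, ← mul_pow]; norm_num
  have h4 : ∑ i ∈ Finset.range (2 * N), (2 * Real.pi * Complex.I * ξ : ℂ) ^ i *
      (V (2 * N - 1 - i) b * chr b ξ - V (2 * N - 1 - i) a * chr a ξ) =
      ∑ i ∈ Finset.range N, (2 * Real.pi * Complex.I * ξ : ℂ) ^ i *
      (V (2 * N - 1 - i) b * chr b ξ - V (2 * N - 1 - i) a * chr a ξ) := by
    symm
    refine Finset.sum_subset (Finset.range_subset_range.2 (by lia)) fun i hi hi' => ?_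
    rw [Finset.mem_range] at hi hi'
    rw [ha _ (by lia), hb _ (by lia)]; ring
  have h5 : hat a b (fun x => (-1) ^ N * V (2 * N) x) ξ = (-1) ^ N * hat a b (V (2 * N)) ξ :=
    hat_smul ((-1) ^ N) (V (2 * N)) ξ
  rw [h3, mul_assoc, h2, h4, h5, mul_sub, Finset.mul_sum, sub_eq_add_neg, ← Finset.sum_neg_distrib]
  congr 1
  refine Finset.sum_congr rfl fun i _ => ?_
  ring

/-- The derivatives of the function `K + ∑_j c_j e^{σ_j x}`. -/
def expSum {n : ℕ} (K : ℂ) (c σ : Fin n → ℂ) (m : ℕ) (x : ℝ) : ℂ :=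
  (if m = 0 then K else 0) + ∑ j, c j * σ j ^ m * Complex.exp (σ j * x)

theorem hasDerivAt_expSum {n : ℕ} (K : ℂ) (c σ : Fin n → ℂ) (m : ℕ) (x : ℝ) :
    HasDerivAt (expSum K c σ m) (expSum K c σ (m + 1) x) x := by
  have h : ∀ j, HasDerivAt (fun x : ℝ => c j * σ j ^ m * Complex.exp (σ j * x))
      (c j * σ j ^ (m + 1) * Complex.exp (σ j * x)) x := fun j => by
    have h2 : HasDerivAt (fun y : ℝ => σ j * (y : ℂ)) (σ j * 1) x :=
      (Complex.ofRealCLM.hasDerivAt (x := x)).const_mul (σ j)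
    refine (h2.cexp.const_mul (c j * σ j ^ m)).congr_deriv ?_
    rw [pow_succ]; ring
  have := (HasDerivAt.fun_sum fun j (_ : j ∈ Finset.univ) => h j).const_add
    (if m = 0 then K else 0)
  unfold expSum
  simpa using this

theorem continuous_expSum {n : ℕ} (K : ℂ) (c σ : Fin n → ℂ) (m : ℕ) :
    Continuous (expSum K c σ m) :=
  continuous_iff_continuousAt.2 fun y => (hasDerivAt_expSum K c σ m y).continuousAt

theorem exists_isDirichletSol_expSum (hab : a < b) {N n : ℕ} (hN : 0 < N) {K lam : ℂ}
    {c σ : Fin n → ℂ} (hσ : ∀ j, (-1) ^ N * σ j ^ (2 * N) = -lam)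
    (ha : ∀ k < N, expSum K c σ k a = 0) (hb : ∀ k < N, expSum K c σ k b = 0) :
    ∃ ca cb, IsDirichletSol N (contL2 a b (expSum K c σ 0) (continuous_expSum K c σ 0))
      (contL2 a b (fun _ => lam * K) continuous_const -
        lam • contL2 a b (expSum K c σ 0) (continuous_expSum K c σ 0)) ca cb := by
  obtain ⟨ca, cb, h⟩ := exists_isDirichletSol hab (hasDerivAt_expSum K c σ) ha hb
    (continuous_expSum K c σ 0) (continuous_const.mul (continuous_expSum K c σ _))
  refine ⟨ca, cb, ?_⟩
  convert h using 1
  rw [contL2, contL2, ← MemLp.toLp_const_smul, ← MemLp.toLp_sub]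
  refine MemLp.toLp_congr _ _ (Eventually.of_forall fun x => ?_)
  have h2N : 2 * N ≠ 0 := by lia
  simp only [expSum, Pi.sub_apply, Pi.smul_apply, smul_eq_mul, if_true, if_neg h2N, zero_add, pow_zero,
    mul_one, mul_add, Finset.mul_sum]
  rw [sub_add_eq_sub_sub, sub_self, zero_sub, ← Finset.sum_neg_distrib]
  refine Finset.sum_congr rfl fun j _ => ?_
  linear_combination (-(c j * Complex.exp (σ j * x))) * hσ j

/-- Uniqueness for the Dirichlet problem comes from the convergence theorem: with datum 0 the
discrete resolvents are all 0, and they converge to the given solution. The derivatives then vanish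
on the open interval in turn. -/
theorem expSum_eq_zero_of_boundary (hab : a < b) {N n : ℕ} (hN : 0 < N) {lam : ℝ} (hlam : 0 < lam)
    {c σ : Fin n → ℂ} (hσ : ∀ j, (-1) ^ N * σ j ^ (2 * N) = -(lam : ℂ))
    (ha : ∀ k < N, expSum 0 c σ k a = 0) (hb : ∀ k < N, expSum 0 c σ k b = 0) (m : ℕ) :
    ∀ x ∈ Ioo a b, expSum 0 c σ m x = 0 := by
  obtain ⟨ca, cb, h⟩ := exists_isDirichletSol_expSum hab hN hσ ha hb
  have he : contL2 a b (fun _ => (lam : ℂ) * 0) continuous_const = 0 := by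
    rw [contL2]
    refine (MemLp.toLp_congr _ (MemLp.zero (ε := ℂ)) (Eventually.of_forall fun x => ?_)).trans
      (MemLp.toLp_zero _)
    simp
  rw [he] at h
  have h1 := tendsto_stepResolvent hN hlam h
  have h2 : ∀ n, stepResolvent (dyadicComp a b N hN n) (2 ^ n) (0 : L2i a b) lam = 0 := fun n =>
    stepResolvent_zero _ _ _
  simp only [h2] at h1
  have h3 : contL2 a b (expSum 0 c σ 0) (continuous_expSum 0 c σ 0) = 0 :=
    (tendsto_nhds_unique h1 tendsto_const_nhds)
  induction m with
  | zero =>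
    have h4 : expSum 0 c σ 0 =ᵐ[ivl a b] fun _ => 0 := by
      have h5 := coeFn_contL2 (a := a) (b := b) (continuous_expSum 0 c σ 0)
      rw [h3] at h5
      exact h5.symm.trans (Lp.coeFn_zero _ _ _)
    exact Measure.eqOn_open_of_ae_eq h4 isOpen_Ioo (continuous_expSum 0 c σ 0).continuousOn
      continuousOn_const
  | succ m ih =>
    intro x hx
    have h4 : expSum 0 c σ m =ᶠ[𝓝 x] fun _ => 0 := by
      filter_upwards [isOpen_Ioo.mem_nhds hx] with y hy using ih y hy
    have h5 := (hasDerivAt_expSum 0 c σ m x).congr_of_eventuallyEq h4.symm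
    exact h5.unique (hasDerivAt_const x 0)

/-- The exponents `λ^{1/(2N)} θ_ℓ`. -/
def expo (N : ℕ) (lam : ℝ) (j : Fin (2 * N)) : ℂ := (lam ^ (1 / (2 * N : ℝ)) : ℝ) * theta N j

theorem eLam_theta_mul (N : ℕ) (lam : ℝ) (j : Fin (2 * N)) (x : ℝ) :
    eLam N lam (theta N j * x) = Complex.exp (expo N lam j * x) := by
  rw [eLam, expo, mul_assoc]

theorem theta_pow {N : ℕ} (hN : 0 < N) (j : Fin (2 * N)) : theta N j ^ (2 * N) = -(-1) ^ N := by
  rw [theta, ← Complex.exp_nat_mul]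
  have hN' : (N : ℂ) ≠ 0 := by exact_mod_cast hN.ne'
  have : ((2 * N : ℕ) : ℂ) * (Complex.I *
      (((2 * ((j : ℕ) + 1) + N - 1 : ℝ) / (2 * N) * Real.pi : ℝ) : ℂ)) =
      ((2 * (j : ℕ) + 1 + N : ℕ) : ℂ) * (Real.pi * Complex.I) := by
    push_cast; field_simp; ring
  rw [this, Complex.exp_nat_mul, Complex.exp_pi_mul_I, pow_add, pow_succ, pow_mul]
  norm_num

theorem theta_injective {N : ℕ} (hN : 0 < N) : Function.Injective (theta N) := by
  intro j k hjk
  rw [theta, theta, Complex.exp_eq_exp_iff_exists_int] at hjk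
  obtain ⟨n, hn⟩ := hjk
  have hN' : (N : ℝ) ≠ 0 := by exact_mod_cast hN.ne'
  have h1 : ((2 * ((j : ℕ) + 1) + N - 1 : ℝ) / (2 * N) * Real.pi) =
      ((2 * ((k : ℕ) + 1) + N - 1 : ℝ) / (2 * N) * Real.pi) + n * (2 * Real.pi) := by
    have : Complex.I * (((2 * ((j : ℕ) + 1) + N - 1 : ℝ) / (2 * N) * Real.pi : ℝ) : ℂ) =
        Complex.I * (((2 * ((k : ℕ) + 1) + N - 1 : ℝ) / (2 * N) * Real.pi +
          n * (2 * Real.pi) : ℝ) : ℂ) := by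
      rw [hn, Complex.ofReal_add]; push_cast; ring
    exact Complex.ofReal_injective (mul_left_cancel₀ Complex.I_ne_zero this)
  have h2 : ((j : ℕ) : ℝ) = (k : ℕ) + n * (2 * N) := by
    have hpi := Real.pi_ne_zero
    field_simp at h1
    linarith
  have h3 : ((j : ℕ) : ℤ) = (k : ℕ) + n * (2 * N) := by exact_mod_cast h2
  have hj := j.2
  have hk := k.2
  have h4 : n = 0 := by
    have : (0 : ℤ) < 2 * N := by lia
    by_contra hne
    rcases lt_or_gt_of_ne hne with h | h
    · nlinarith
    · nlinarith
  rw [h4] at h3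
  exact Fin.ext (by lia)

theorem rpow_pow_self {N : ℕ} (hN : 0 < N) {lam : ℝ} (hlam : 0 < lam) :
    (lam ^ (1 / (2 * N : ℝ))) ^ (2 * N) = lam := by
  have h2 : (0 : ℝ) < 2 * N := by exact_mod_cast (by lia : 0 < 2 * N)
  rw [← Real.rpow_natCast, ← Real.rpow_mul hlam.le]
  push_cast
  rw [one_div_mul_cancel h2.ne', Real.rpow_one]

theorem expo_pow {N : ℕ} (hN : 0 < N) {lam : ℝ} (hlam : 0 < lam) (j : Fin (2 * N)) :
    (-1) ^ N * expo N lam j ^ (2 * N) = -(lam : ℂ) := by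
  rw [expo, mul_pow, theta_pow hN, ← Complex.ofReal_pow, rpow_pow_self hN hlam]
  have : ((-1 : ℂ) ^ N) * (-1) ^ N = 1 := by rw [← mul_pow]; norm_num
  linear_combination (-(lam : ℂ)) * this

theorem expo_injective {N : ℕ} (hN : 0 < N) {lam : ℝ} (hlam : 0 < lam) :
    Function.Injective (expo N lam) := fun j k hjk => by
  refine theta_injective hN (mul_left_cancel₀ ?_ hjk)
  exact_mod_cast (Real.rpow_pos_of_pos hlam _).ne'

/-- The boundary values of an exponential sum, read off from `bvMatrix`. -/
theorem expSum_boundary (N : ℕ) (lam : ℝ) (c : Fin (2 * N) → ℂ) (K : ℂ) {k : ℕ} (hk : k < N) :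
    expSum K c (expo N lam) k a = (if k = 0 then K else 0) +
      ((lam ^ (1 / (2 * N : ℝ)) : ℝ) : ℂ) ^ k * (bvMatrix N a b lam).mulVec c ⟨k, by lia⟩ ∧
    expSum K c (expo N lam) k b = (if k = 0 then K else 0) +
      ((lam ^ (1 / (2 * N : ℝ)) : ℝ) : ℂ) ^ k * (bvMatrix N a b lam).mulVec c ⟨N + k, by lia⟩ := by
  constructor
  · rw [expSum, Matrix.mulVec, dotProduct, Finset.mul_sum]
    congr 1
    refine Finset.sum_congr rfl fun j _ => ?_
    simp only [bvMatrix, Matrix.of_apply, if_pos hk, eLam_theta_mul]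
    rw [expo, mul_pow]; ring
  · rw [expSum, Matrix.mulVec, dotProduct, Finset.mul_sum]
    congr 1
    refine Finset.sum_congr rfl fun j _ => ?_
    simp only [bvMatrix, Matrix.of_apply, if_neg (show ¬ N + k < N by lia), eLam_theta_mul,
      Nat.add_sub_cancel_left]
    rw [expo, mul_pow]; ring

/-- A vector in the kernel of the matrix gives an exponential sum with zero boundary data, hence
with all derivatives zero at the midpoint. The exponents are distinct, so a Vandermonde argument
makes the coefficients vanish. -/
theorem Delta_ne_zero (hab : a < b) {N : ℕ} (hN : 0 < N) {lam : ℝ} (hlam : 0 < lam) :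
    Delta N a b lam ≠ 0 := by
  intro h0
  obtain ⟨c, hc, hMc⟩ := Matrix.exists_mulVec_eq_zero_iff.2 h0
  have hz := expSum_eq_zero_of_boundary hab hN hlam (c := c) (expo_pow hN hlam)
    (fun k hk => by rw [(expSum_boundary (a := a) (b := b) N lam c 0 hk).1, hMc]; simp)
    (fun k hk => by rw [(expSum_boundary (a := a) (b := b) N lam c 0 hk).2, hMc]; simp)
  apply hc
  set x := (a + b) / 2 with hx
  have hx' : x ∈ Ioo a b := ⟨by linarith, by linarith⟩
  have h1 := Matrix.eq_zero_of_forall_pow_sum_mul_pow_eq_zero (expo_injective hN hlam)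
    (v := fun j => c j * Complex.exp (expo N lam j * x)) (fun i => by
      have := hz i x hx'
      rw [expSum, ite_self, zero_add] at this
      rw [← this]
      exact Finset.sum_congr rfl fun j _ => by ring)
  ext j
  have h2 := congrFun h1 j
  exact (mul_eq_zero.1 h2).resolve_right (Complex.exp_ne_zero _)

/-- Cofactor expansion along the replaced row; it exhibits the dependence on x as an exponential
sum. -/
theorem DeltaRow_eq_sum (N : ℕ) (lam x : ℝ) (r : Fin (2 * N)) :
    DeltaRow N a b lam x r =
      ∑ j, (bvMatrix N a b lam).adjugate j r * eLam N lam (theta N j * x) := by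
  have h1 : DeltaRow N a b lam x r =
      ((bvMatrix N a b lam).updateRow r fun j => eLam N lam (theta N j * x)).det := by
    rw [DeltaRow]
    congr 1; ext i j
    by_cases h : i = r
    · simp [h]
    · have : (i : ℕ) ≠ r := fun h' => h (Fin.ext h')
      simp [h, this]
  rw [h1, ← Matrix.cramer_transpose_apply, Matrix.cramer_eq_adjugate_mulVec, Matrix.mulVec,
    dotProduct, ← Matrix.adjugate_transpose]
  rfl

/-- The solution of the Dirichlet problem `λ v + A v = 1` on `(a, b)`. -/
def resolventSol (N : ℕ) (a b lam x : ℝ) : ℂ :=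
  1 / (lam : ℂ) * ((Delta N a b lam - DeltaPlus N a b lam x 0 - DeltaMinus N a b lam x 0) /
    Delta N a b lam)

/-- Cramer's rule: the coefficients solve a linear system whose right side is -1/λ in the two rows
of order 0, at a and at b, and 0 elsewhere. This cancels the constant 1/λ at both endpoints and
makes the derivatives of orders 1 to N - 1 vanish there. -/
theorem exists_resolventSol_eq_expSum (hab : a < b) {N : ℕ} (hN : 0 < N) {lam : ℝ}
    (hlam : 0 < lam) : ∃ c : Fin (2 * N) → ℂ,
      (∀ x, resolventSol N a b lam x = expSum (1 / (lam : ℂ)) c (expo N lam) 0 x) ∧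
      (∀ k < N, expSum (1 / (lam : ℂ)) c (expo N lam) k a = 0) ∧
      (∀ k < N, expSum (1 / (lam : ℂ)) c (expo N lam) k b = 0) := by
  set M := bvMatrix N a b lam with hM
  have hD : M.det ≠ 0 := Delta_ne_zero hab hN hlam
  set r₀ : Fin (2 * N) := ⟨0, by lia⟩ with hr₀
  set r₁ : Fin (2 * N) := ⟨N, by lia⟩ with hr₁
  have hl : (lam : ℂ) ≠ 0 := by exact_mod_cast hlam.ne'
  set c : Fin (2 * N) → ℂ := fun j =>
    -(1 / (lam : ℂ)) * ((M.adjugate j r₀ + M.adjugate j r₁) / M.det) with hc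
  have hMc : ∀ i, M.mulVec c i =
      -(1 / (lam : ℂ)) * ((if i = r₀ then 1 else 0) + (if i = r₁ then 1 else 0)) := by
    intro i
    have h1 : ∀ r, ∑ j, M i j * M.adjugate j r = M.det * (if i = r then 1 else 0) := fun r => by
      have := congrFun (congrFun (Matrix.mul_adjugate M) i) r
      rw [Matrix.mul_apply] at this
      rw [this]; simp [Matrix.one_apply]
    have h2 : M.mulVec c i = -(1 / (lam : ℂ)) / M.det *
        (∑ j, M i j * M.adjugate j r₀ + ∑ j, M i j * M.adjugate j r₁) := by
      rw [Matrix.mulVec, dotProduct, ← Finset.sum_add_distrib, Finset.mul_sum]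
      refine Finset.sum_congr rfl fun j _ => ?_
      rw [hc]; ring
    rw [h2, h1, h1]; field_simp
  refine ⟨c, fun x => ?_, fun k hk => ?_, fun k hk => ?_⟩
  · have h1 := DeltaRow_eq_sum (a := a) (b := b) N lam x r₀
    have h2 := DeltaRow_eq_sum (a := a) (b := b) N lam x r₁
    have h3 : expSum (1 / (lam : ℂ)) c (expo N lam) 0 x = 1 / (lam : ℂ) -
        1 / (lam : ℂ) / M.det * (DeltaRow N a b lam x r₀ + DeltaRow N a b lam x r₁) := by
      rw [h1, h2, expSum, if_pos rfl, ← Finset.sum_add_distrib, Finset.mul_sum, sub_eq_add_neg,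
        ← Finset.sum_neg_distrib]
      congr 1
      refine Finset.sum_congr rfl fun j _ => ?_
      rw [eLam_theta_mul, pow_zero, hc]; ring
    rw [h3, resolventSol, DeltaPlus, DeltaMinus, Delta, add_zero]
    change _ = 1 / (lam : ℂ) - 1 / (lam : ℂ) / M.det *
      (DeltaRow N a b lam x 0 + DeltaRow N a b lam x N)
    rw [← hM]
    field_simp; ring
  · rw [(expSum_boundary (a := a) (b := b) N lam c _ hk).1, hMc]
    have h1 : (⟨k, by lia⟩ : Fin (2 * N)) ≠ r₁ := fun h => by
      have := congrArg Fin.val h; simp [hr₁] at this; lia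
    rcases Nat.eq_zero_or_pos k with rfl | hk0
    · rw [if_neg h1]; simp [hr₀]
    · have h2 : (⟨k, by lia⟩ : Fin (2 * N)) ≠ r₀ := fun h => by
        have := congrArg Fin.val h; simp [hr₀] at this; lia
      rw [if_neg h1, if_neg h2, if_neg hk0.ne']; simp
  · rw [(expSum_boundary (a := a) (b := b) N lam c _ hk).2, hMc]
    have h1 : (⟨N + k, by lia⟩ : Fin (2 * N)) ≠ r₀ := fun h => by
      have := congrArg Fin.val h; simp [hr₀] at this; lia
    rcases Nat.eq_zero_or_pos k with rfl | hk0
    · rw [if_neg h1]; simp [hr₁]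
    · have h2 : (⟨N + k, by lia⟩ : Fin (2 * N)) ≠ r₁ := fun h => by
        have := congrArg Fin.val h; simp [hr₁] at this; lia
      rw [if_neg h1, if_neg h2, if_neg hk0.ne']; simp

theorem continuous_resolventSol (hab : a < b) {N : ℕ} (hN : 0 < N) {lam : ℝ} (hlam : 0 < lam) :
    Continuous (resolventSol N a b lam) := by
  obtain ⟨c, hc, -, -⟩ := exists_resolventSol_eq_expSum hab hN hlam
  rw [show resolventSol N a b lam = expSum (1 / (lam : ℂ)) c (expo N lam) 0 from funext hc]
  exact continuous_expSum _ _ _ _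

/-- The constant function `1` in `L²(a, b)`. -/
def oneL2 (a b : ℝ) : L2i a b := contL2 a b (fun _ => 1) continuous_const

theorem tendsto_stepResolvent_one (hab : a < b) {N : ℕ} (hN : 0 < N) {lam : ℝ} (hlam : 0 < lam) :
    Tendsto (fun n : ℕ => stepResolvent (dyadicComp a b N hN n) (2 ^ n) (oneL2 a b) lam) atTop
      (𝓝 (contL2 a b (resolventSol N a b lam) (continuous_resolventSol hab hN hlam))) := by
  obtain ⟨c, hc, ha, hb⟩ := exists_resolventSol_eq_expSum hab hN hlam
  obtain ⟨ca, cb, h⟩ := exists_isDirichletSol_expSum hab hN (expo_pow hN hlam) ha hb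
  have hl : (lam : ℂ) ≠ 0 := by exact_mod_cast hlam.ne'
  have h1 : contL2 a b (fun _ => (lam : ℂ) * (1 / (lam : ℂ))) continuous_const = oneL2 a b := by
    unfold oneL2 contL2
    exact MemLp.toLp_congr _ _ (Eventually.of_forall fun x => mul_one_div_cancel hl)
  have h2 : contL2 a b (expSum (1 / (lam : ℂ)) c (expo N lam) 0) (continuous_expSum _ _ _ _) =
      contL2 a b (resolventSol N a b lam) (continuous_resolventSol hab hN hlam) := by
    unfold contL2
    exact MemLp.toLp_congr _ _ (Eventually.of_forall fun x => (hc x).symm)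
  rw [h1, h2] at h
  exact tendsto_stepResolvent hN hlam h

/-! ### Pointwise values: bounds and moduli of continuity uniform in the mesh. -/

theorem sg_eq_integral_chr (N : ℕ) (h : ℝ) (f : ℝ → ℂ) (x : ℝ) :
    sg a b N h f x = ∫ ξ, chr (-x) ξ * (mult N h ξ * hat a b f ξ) := by
  rw [sg, Real.fourierInv_eq']
  congr 1; ext ξ
  rw [smul_eq_mul, chr]
  congr 3
  simp; ring

theorem integrable_one_div_one_add_sym {N : ℕ} (hN : 0 < N) :
    Integrable (fun ξ => 1 / (1 + sym N ξ)) := by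
  refine (integrable_inv_one_add_sq.const_mul 2).mono' ?_ (Eventually.of_forall fun ξ => ?_)
  · exact (continuous_const.div (continuous_const.add (continuous_sym N)) fun ξ => by
      have := sym_nonneg N ξ
      change 1 + sym N ξ ≠ 0
      positivity).aestronglyMeasurable
  · have h1 := sym_nonneg N ξ
    have h2 := sq_le_sym_add_one hN ξ
    rw [Real.norm_of_nonneg (by positivity), ← div_eq_mul_inv, div_le_div_iff₀ (by positivity)
      (by positivity)]
    linarith

/-- One more application of e^{-hA} turns the bounded energy at scale h into a genuine Sobolev norm
with weight 1 + s. The reason is hs e^{-hs} ≤ 1 - e^{-hs}. -/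
theorem one_add_sym_mul_exp_le {N : ℕ} {h : ℝ} (hh : 0 < h) (ξ : ℝ) :
    (1 + sym N ξ) * Real.exp (-h * sym N ξ) ^ 2 ≤ 1 + (1 - Real.exp (-h * sym N ξ)) / h := by
  have h1 := sym_nonneg N ξ
  have h2 := one_sub_exp_nonneg (N := N) hh ξ
  set e := Real.exp (-h * sym N ξ) with he
  have h3 : 0 < e := Real.exp_pos _
  have h4 : h * sym N ξ * e ≤ 1 - e := by
    have h5 : 1 + h * sym N ξ ≤ Real.exp (h * sym N ξ) := by
      linarith [Real.add_one_le_exp (h * sym N ξ)]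
    have h6 : Real.exp (h * sym N ξ) * e = 1 := by rw [he, ← Real.exp_add]; simp
    nlinarith
  have h7 : sym N ξ * e ≤ (1 - e) / h := by rw [le_div_iff₀ hh]; linarith
  have h8 : sym N ξ * e * e ≤ sym N ξ * e := mul_le_of_le_one_right (by positivity) (by linarith)
  nlinarith

/-- A Sobolev embedding: 1/(1 + s) is integrable. The function q is a character for bounds on values
and a difference of characters for moduli of continuity; ε stays free so that it can depend on t. -/
theorem norm_integral_mul_mult_hat_le {N : ℕ} (hN : 0 < N) {h : ℝ} (hh : 0 < h) (f : L2i a b)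
    {q : ℝ → ℂ} (hq : Continuous q) {B : ℝ} (hB : ∀ ξ, ‖q ξ‖ ≤ B) {ε : ℝ} (hε : 0 < ε) :
    ‖∫ ξ, q ξ * (mult N h ξ * hat a b f ξ)‖ ≤
      ε⁻¹ * (∫ ξ, ‖q ξ‖ ^ 2 * (1 / (1 + sym N ξ))) + ε * (‖f‖ ^ 2 + energy a b N h f) := by
  have i1 : Integrable (fun ξ => ‖q ξ‖ ^ 2 * (1 / (1 + sym N ξ))) :=
    (integrable_one_div_one_add_sym hN).bdd_mul (c := B ^ 2)
      (hq.norm.pow 2).aestronglyMeasurable (Eventually.of_forall fun ξ => by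
        rw [Real.norm_of_nonneg (by positivity)]
        exact pow_le_pow_left₀ (norm_nonneg _) (hB ξ) 2)
  have i2 := integrable_norm_sq_hat (Lp.memLp f)
  have i3 := integrable_energy (N := N) hh (Lp.memLp f)
  have i4 : Integrable fun ξ => ε * (‖hat a b f ξ‖ ^ 2 +
      (1 - Real.exp (-h * sym N ξ)) / h * ‖hat a b f ξ‖ ^ 2) := (i2.add i3).const_mul _
  rw [norm_sq_eq_integral_hat, energy, ← integral_add i2 i3, ← integral_const_mul,
    ← integral_const_mul, ← integral_add (i1.const_mul _) i4]
  refine norm_integral_le_of_norm_le ((i1.const_mul _).add i4)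
    (Eventually.of_forall fun ξ => ?_)
  have h1 := sym_nonneg N ξ
  have h2 := one_add_sym_mul_exp_le (N := N) hh ξ
  have h3 : ‖mult N h ξ‖ = Real.exp (-h * sym N ξ) := by rw [norm_mult]
  rw [norm_mul, norm_mul, h3]
  change _ ≤ ε⁻¹ * (‖q ξ‖ ^ 2 * (1 / (1 + sym N ξ))) + ε * (‖hat a b f ξ‖ ^ 2 +
    (1 - Real.exp (-h * sym N ξ)) / h * ‖hat a b f ξ‖ ^ 2)
  set e := Real.exp (-h * sym N ξ)
  set p := ‖q ξ‖
  set y := ‖hat a b f ξ‖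
  have h4 : (1 + sym N ξ) * e ^ 2 * y ^ 2 ≤ (1 + (1 - e) / h) * y ^ 2 := by gcongr
  set s := 1 + sym N ξ with hs
  have hs0 : 0 < s := by positivity
  have h5 : p * (e * y) ≤ ε⁻¹ * (p ^ 2 * (1 / s)) + ε * (s * e ^ 2 * y ^ 2) := by
    have h6 : ε⁻¹ * (p ^ 2 * (1 / s)) + ε * (s * e ^ 2 * y ^ 2) - p * (e * y) =
        (p ^ 2 + (ε * s * e * y) ^ 2 - p * (ε * s * e * y)) / (ε * s) := by
      field_simp
    have h7 : 0 ≤ (p ^ 2 + (ε * s * e * y) ^ 2 - p * (ε * s * e * y)) / (ε * s) :=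
      div_nonneg (by
        nlinarith [sq_nonneg (p - ε * s * e * y), sq_nonneg (p + ε * s * e * y)]) (by positivity)
    linarith
  nlinarith

theorem integrable_chr_mul {N : ℕ} (hN : 0 < N) {h : ℝ} (hh : 0 < h) (f : L2i a b) (x : ℝ) :
    Integrable fun ξ => chr (-x) ξ * (mult N h ξ * hat a b f ξ) :=
  (integrable_mult_mul_hat hN hh (Lp.memLp f)).bdd_mul (c := 1)
    (continuous_chr _).aestronglyMeasurable (Eventually.of_forall fun ξ => (norm_chr _ ξ).le)

/-- A modulus of continuity. -/
def modulus (N : ℕ) (r : ℝ) : ℝ := ∫ ξ, ‖chr r ξ - 1‖ ^ 2 * (1 / (1 + sym N ξ))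

theorem norm_chr_sub_one_le (r ξ : ℝ) : ‖chr r ξ - 1‖ ≤ 2 :=
  (norm_sub_le _ _).trans (by rw [norm_chr, norm_one]; norm_num)

theorem tendsto_modulus {N : ℕ} (hN : 0 < N) : Tendsto (modulus N) (𝓝 0) (𝓝 0) := by
  have : Continuous (modulus N) := by
    refine continuous_of_dominated (bound := fun ξ => 4 * (1 / (1 + sym N ξ))) (fun r => ?_)
      (fun r => Eventually.of_forall fun ξ => ?_) ((integrable_one_div_one_add_sym hN).const_mul 4)
      (Eventually.of_forall fun ξ => ?_)
    · exact (((continuous_chr r).sub continuous_const).norm.pow 2).aestronglyMeasurable.mul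
        (integrable_one_div_one_add_sym hN).aestronglyMeasurable
    · have h1 := sym_nonneg N ξ
      rw [Real.norm_of_nonneg (by positivity)]
      gcongr
      nlinarith [norm_chr_sub_one_le r ξ, norm_nonneg (chr r ξ - 1)]
    · unfold chr; fun_prop
  have h := this.tendsto 0
  have h0 : modulus N 0 = 0 := by simp [modulus, chr]
  rwa [h0] at h

theorem norm_sg_sub_sg_le {N : ℕ} (hN : 0 < N) {h : ℝ} (hh : 0 < h) (f : L2i a b) (x y : ℝ)
    {ε : ℝ} (hε : 0 < ε) :
    ‖sg a b N h f y - sg a b N h f x‖ ≤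
      ε⁻¹ * modulus N (x - y) + ε * (‖f‖ ^ 2 + energy a b N h f) := by
  rw [sg_eq_integral_chr, sg_eq_integral_chr,
    ← integral_sub (integrable_chr_mul hN hh f _) (integrable_chr_mul hN hh f _)]
  have h1 : ∀ ξ, chr (-y) ξ * (mult N h ξ * hat a b f ξ) - chr (-x) ξ * (mult N h ξ * hat a b f ξ)
      = (chr (-y) ξ - chr (-x) ξ) * (mult N h ξ * hat a b f ξ) := fun ξ => by ring
  rw [integral_congr_ae (Eventually.of_forall h1)]
  refine (norm_integral_mul_mult_hat_le hN hh f ((continuous_chr _).sub (continuous_chr _)) (B := 2)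
    (fun ξ => (norm_sub_le _ _).trans (by rw [norm_chr, norm_chr]; norm_num)) hε).trans ?_
  have h2 : ∀ ξ, ‖chr (-y) ξ - chr (-x) ξ‖ = ‖chr (x - y) ξ - 1‖ := fun ξ => by
    have : chr (-y) ξ - chr (-x) ξ = chr (-x) ξ * (chr (x - y) ξ - 1) := by
      rw [mul_sub, mul_one]
      unfold chr
      rw [← Complex.exp_add]
      congr 2
      push_cast; ring
    rw [this, norm_mul, norm_chr, one_mul]
  refine le_of_eq ?_
  congr 2
  exact integral_congr_ae (Eventually.of_forall fun ξ => by
    change ‖chr (-y) ξ - chr (-x) ξ‖ ^ 2 * _ = ‖chr (x - y) ξ - 1‖ ^ 2 * _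
    rw [h2])

theorem norm_sg_le {N : ℕ} (hN : 0 < N) {h : ℝ} (hh : 0 < h) (f : L2i a b) (x : ℝ)
    {ε : ℝ} (hε : 0 < ε) :
    ‖sg a b N h f x‖ ≤
      ε⁻¹ * (∫ ξ, 1 / (1 + sym N ξ)) + ε * (‖f‖ ^ 2 + energy a b N h f) := by
  rw [sg_eq_integral_chr]
  refine (norm_integral_mul_mult_hat_le hN hh f (continuous_chr _) (B := 1)
    (fun ξ => (norm_chr _ ξ).le) hε).trans ?_
  simp [norm_chr]

/-- Up to the factor h, the energy of T^k f is the decrement of the moments at 2k, hence at most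
‖f‖²/(2k + 1). At time t ≈ hk the energy is O(1/t), whatever h is. -/
theorem energy_pow_le {N : ℕ} (hN : 0 < N) {h : ℝ} (hh : 0 < h) (f : L2i a b) (k : ℕ) :
    energy a b N h ((comp a b N hN h hh ^ k) f : L2i a b) ≤ ‖f‖ ^ 2 / (h * (k + 1)) := by
  have hT := isPosContraction_comp (a := a) (b := b) hN hh
  have h1 := inner_sub_comp_self hN hh ((comp a b N hN h hh ^ k) f)
  have h2 := hT.mul_moment_diff_le f (k + k)
  have h3 : h * energy a b N h ((comp a b N hN h hh ^ k) f : L2i a b) =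
      moment (comp a b N hN h hh) f (k + k) - moment (comp a b N hN h hh) f (k + k + 1) := by
    have := congrArg Complex.re h1
    rw [Complex.ofReal_re, inner_sub_right, Complex.sub_re] at this
    rw [← this, hT.moment_add, add_assoc, hT.moment_add, pow_succ', mul_apply_eq_comp]
  rw [← h3] at h2
  have h4 := energy_nonneg (a := a) (b := b) (N := N) hh ((comp a b N hN h hh ^ k) f : L2i a b)
  set E := energy a b N h ((comp a b N hN h hh ^ k) f : L2i a b)
  rw [le_div_iff₀ (by positivity)]
  push_cast at h2
  nlinarith [mul_nonneg (mul_nonneg hh.le h4) (Nat.cast_nonneg (α := ℝ) k)]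

/-- The average over `(x - r, x + r)` as a functional on `L²(a, b)`. -/
def avg (a b x r : ℝ) : L2i a b →L[ℂ] ℂ :=
  innerSL ℂ (indicatorConstLp 2 (μ := ivl a b) (s := Ioo (x - r) (x + r)) measurableSet_Ioo
    (measure_ne_top _ _) (((2 * r)⁻¹ : ℝ) : ℂ))

theorem avg_apply (x r : ℝ) (f : L2i a b) (hsub : Ioo (x - r) (x + r) ⊆ Ioo a b) :
    avg a b x r f = (((2 * r)⁻¹ : ℝ) : ℂ) * ∫ y in Ioo (x - r) (x + r), f y := by
  rw [avg, innerSL_apply_apply, L2.inner_indicatorConstLp_eq_setIntegral_inner,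
    Measure.restrict_restrict_of_subset hsub, ← integral_const_mul]
  congr 1; ext y
  rw [RCLike.inner_apply, Complex.conj_ofReal, mul_comm]

theorem norm_avg_sub_le {x r η : ℝ} (hr : 0 < r) (hsub : Ioo (x - r) (x + r) ⊆ Ioo a b)
    {f : L2i a b} {g : ℝ → ℂ} (hfg : f =ᵐ[ivl a b] g) (hg : Continuous g)
    (hη : ∀ y ∈ Ioo (x - r) (x + r), ‖g y - g x‖ ≤ η) : ‖avg a b x r f - g x‖ ≤ η := by
  have hvol : volume.real (Ioo (x - r) (x + r)) = 2 * r := by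
    rw [Real.volume_real_Ioo_of_le (by linarith)]; ring
  have h1 : ∫ y in Ioo (x - r) (x + r), f y = ∫ y in Ioo (x - r) (x + r), g y :=
    integral_congr_ae (ae_restrict_of_ae_restrict_of_subset hsub hfg)
  have h2 : IntegrableOn g (Ioo (x - r) (x + r)) :=
    hg.integrableOn_Icc.mono_set Ioo_subset_Icc_self
  have h3 : (((2 * r)⁻¹ : ℝ) : ℂ) * (∫ y in Ioo (x - r) (x + r), g y) - g x =
      (((2 * r)⁻¹ : ℝ) : ℂ) * ∫ y in Ioo (x - r) (x + r), (g y - g x) := by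
    rw [integral_sub h2 (integrableOn_const (by simp)), setIntegral_const, hvol, mul_sub]
    congr 1
    rw [Complex.real_smul, ← mul_assoc, ← Complex.ofReal_mul, inv_mul_cancel₀ (by positivity)]
    simp
  rw [avg_apply x r f hsub, h1, h3, norm_mul, Complex.norm_real, Real.norm_of_nonneg (by positivity)]
  have h4 : ‖∫ y in Ioo (x - r) (x + r), (g y - g x)‖ ≤ η * (2 * r) := by
    rw [← hvol]
    exact norm_setIntegral_le_of_norm_le_const (by simp) hη
  calc (2 * r)⁻¹ * ‖∫ y in Ioo (x - r) (x + r), (g y - g x)‖ ≤ (2 * r)⁻¹ * (η * (2 * r)) := by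
        gcongr
    _ = η := by field_simp

/-- The weight `(1 + 1/t)^{1/2}`. -/
def wgt (t : ℝ) : ℝ := √(1 + t⁻¹)

theorem wgt_pos {t : ℝ} (ht : 0 < t) : 0 < wgt t := Real.sqrt_pos.2 (by positivity)

theorem wgt_sq {t : ℝ} (ht : 0 < t) : wgt t ^ 2 = 1 + t⁻¹ := Real.sq_sqrt (by positivity)

theorem wgt_le {t : ℝ} (ht : 0 < t) : wgt t ≤ 1 + t ^ (-(1 / 2) : ℝ) := by
  have h : (t ^ (-(1 / 2) : ℝ)) ^ 2 = t⁻¹ := by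
    rw [← Real.rpow_natCast, ← Real.rpow_mul ht.le]; norm_num [Real.rpow_neg_one]
  refine Real.sqrt_le_iff.2 ⟨by positivity, ?_⟩
  have : 0 < t ^ (-(1 / 2) : ℝ) := by positivity
  nlinarith

theorem wgt_anti {s t : ℝ} (hs : 0 < s) (hst : s ≤ t) : wgt t ≤ wgt s :=
  Real.sqrt_le_sqrt (by gcongr)

/-- Only a singularity t^{-1/2} appears at 0, so pointwise bounds by this weight can be integrated
in the Laplace transform; a bound by 1/t could not. -/
theorem integrableOn_wgt {lam : ℝ} (hlam : 0 < lam) :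
    IntegrableOn (fun t => Real.exp (-lam * t) * wgt t) (Ioi 0) := by
  have h1 := exp_neg_integrableOn_Ioi 0 hlam
  have h2 := integrableOn_rpow_mul_exp_neg_mul_rpow (s := -(1 / 2)) (p := 1) (b := lam)
    (by norm_num) one_pos hlam
  refine (h1.add h2).mono' ?_ ((ae_restrict_iff' measurableSet_Ioi).2
    (Eventually.of_forall fun t (ht : 0 < t) => ?_))
  · exact (Measurable.aestronglyMeasurable (by unfold wgt; fun_prop))
  · rw [Real.norm_of_nonneg (mul_nonneg (Real.exp_pos _).le (wgt_pos ht).le)]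
    simp only [Pi.add_apply, Real.rpow_one]
    nlinarith [mul_le_mul_of_nonneg_left (wgt_le ht) (Real.exp_pos (-lam * t)).le]

/-- The continuous representative of `T^{⌊2ⁿt⌋} 1`, evaluated at `x`. -/
def stepVal (a b : ℝ) (N : ℕ) (hN : 0 < N) (n : ℕ) (t x : ℝ) : ℂ :=
  if ⌊(2 : ℝ) ^ n * t⌋₊ = 0 then 1 else
    sg a b N ((2 : ℝ) ^ n)⁻¹
      ((dyadicComp a b N hN n ^ (⌊(2 : ℝ) ^ n * t⌋₊ - 1)) (oneL2 a b) : L2i a b) x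

section

variable {N : ℕ} (hN : 0 < N) {n : ℕ} {t : ℝ}

/-- One factor T is set aside and realized by the kernel, which has a value at every point; the
remaining power of T supplies the energy bound. At least one time step must have elapsed. -/
theorem exists_stepVal_eq (ht : 0 < t) (hn : 1 ≤ (2 : ℝ) ^ n * t) :
    ∃ f : L2i a b, (∀ x, stepVal a b N hN n t x = sg a b N ((2 : ℝ) ^ n)⁻¹ f x) ∧
      stepFlow (dyadicComp a b N hN n) (2 ^ n) (oneL2 a b) t = dyadicComp a b N hN n f ∧
      ‖f‖ ^ 2 + energy a b N ((2 : ℝ) ^ n)⁻¹ f ≤ 2 * ‖oneL2 a b‖ ^ 2 * wgt t ^ 2 := by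
  have hk : 1 ≤ ⌊(2 : ℝ) ^ n * t⌋₊ := Nat.one_le_floor_iff _ |>.2 hn
  obtain ⟨k, hk'⟩ : ∃ k, ⌊(2 : ℝ) ^ n * t⌋₊ = k + 1 := ⟨_, (Nat.sub_add_cancel hk).symm⟩
  refine ⟨(dyadicComp a b N hN n ^ k) (oneL2 a b), fun x => ?_, ?_, ?_⟩
  · simp [stepVal, hk']
  · rw [stepFlow, hk', pow_succ', mul_apply_eq_comp]
  · have h1 := (isPosContraction_dyadicComp (a := a) (b := b) hN n).norm_pow_le (oneL2 a b) k
    have h2 := energy_pow_le (a := a) (b := b) hN (h := ((2 : ℝ) ^ n)⁻¹) (by positivity)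
      (oneL2 a b) k
    -- The floor is k + 1, so 2^n t < k + 2 ≤ 2(k + 1).
    have h3 : t / 2 ≤ ((2 : ℝ) ^ n)⁻¹ * (k + 1) := by
      have h4 := Nat.lt_floor_add_one ((2 : ℝ) ^ n * t)
      rw [hk'] at h4
      push_cast at h4
      rw [inv_mul_eq_div, div_le_div_iff₀ two_pos (by positivity)]
      have : (0 : ℝ) ≤ k := Nat.cast_nonneg k
      nlinarith
    have h5 : ‖oneL2 a b‖ ^ 2 / (((2 : ℝ) ^ n)⁻¹ * (k + 1)) ≤ ‖oneL2 a b‖ ^ 2 / (t / 2) := by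
      gcongr
    have h6 : ‖oneL2 a b‖ ^ 2 / (t / 2) = 2 * ‖oneL2 a b‖ ^ 2 * t⁻¹ := by field_simp
    have h7 := pow_le_pow_left₀ (norm_nonneg _) h1 2
    rw [wgt_sq ht]
    change _ + energy a b N ((2 : ℝ) ^ n)⁻¹ ((comp a b N hN ((2 : ℝ) ^ n)⁻¹ _ ^ k) (oneL2 a b) : L2i a b) ≤ _
    nlinarith [sq_nonneg ‖oneL2 a b‖]

theorem continuous_stepVal : Continuous (stepVal a b N hN n t) := by
  unfold stepVal
  split_ifs
  · exact continuous_const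
  · exact continuous_sg hN (by positivity) (Lp.memLp _)

theorem stepFlow_ae_eq_stepVal (ht : 0 < t) (hn : 1 ≤ (2 : ℝ) ^ n * t) :
    ((stepFlow (dyadicComp a b N hN n) (2 ^ n) (oneL2 a b) t : L2i a b) : ℝ → ℂ)
      =ᵐ[ivl a b] stepVal a b N hN n t := by
  obtain ⟨f, h1, h2, -⟩ := exists_stepVal_eq (a := a) (b := b) hN ht hn
  rw [h2, funext h1]
  exact coeFn_comp hN _ f

/-- The energy is of order `wgt t ^ 2`; taking ε = 1/`wgt t` in the Sobolev bound balances its two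
terms. -/
theorem norm_stepVal_le (ht : 0 < t) (hn : 1 ≤ (2 : ℝ) ^ n * t) (x : ℝ) :
    ‖stepVal a b N hN n t x‖ ≤
      ((∫ ξ, 1 / (1 + sym N ξ)) + 2 * ‖oneL2 a b‖ ^ 2) * wgt t := by
  obtain ⟨f, h1, -, h3⟩ := exists_stepVal_eq (a := a) (b := b) hN ht hn
  have hw := wgt_pos ht
  rw [h1]
  refine (norm_sg_le hN (by positivity) f x (inv_pos.2 hw)).trans ?_
  have := mul_le_mul_of_nonneg_left h3 (inv_pos.2 hw).le
  have h4 : (wgt t)⁻¹ * (2 * ‖oneL2 a b‖ ^ 2 * wgt t ^ 2) = 2 * ‖oneL2 a b‖ ^ 2 * wgt t := by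
    field_simp
  rw [inv_inv]
  linarith

theorem norm_stepVal_sub_le (ht : 0 < t) (hn : 1 ≤ (2 : ℝ) ^ n * t) (x y : ℝ) {ε : ℝ} (hε : 0 < ε) :
    ‖stepVal a b N hN n t y - stepVal a b N hN n t x‖ ≤
      (ε⁻¹ * modulus N (x - y) + ε * (2 * ‖oneL2 a b‖ ^ 2)) * wgt t := by
  obtain ⟨f, h1, -, h3⟩ := exists_stepVal_eq (a := a) (b := b) hN ht hn
  have hw := wgt_pos ht
  rw [h1, h1]
  refine (norm_sg_sub_sg_le hN (by positivity) f x y (div_pos hε hw)).trans ?_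
  have := mul_le_mul_of_nonneg_left h3 (div_pos hε hw).le
  have h4 : ε / wgt t * (2 * ‖oneL2 a b‖ ^ 2 * wgt t ^ 2) = ε * (2 * ‖oneL2 a b‖ ^ 2) * wgt t := by
    field_simp
  have h5 : (ε / wgt t)⁻¹ * modulus N (x - y) = ε⁻¹ * modulus N (x - y) * wgt t := by field_simp
  rw [h5]
  linarith

theorem exists_norm_stepVal_sub_le (a b x : ℝ) {η : ℝ} (hη : 0 < η) :
    ∃ r > 0, ∀ y, |y - x| < r → ∀ n t, 0 < t → 1 ≤ (2 : ℝ) ^ n * t →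
      ‖stepVal a b N hN n t y - stepVal a b N hN n t x‖ ≤ η * wgt t := by
  set C := 2 * ‖oneL2 a b‖ ^ 2
  have hC : 0 ≤ C := by positivity
  set ε := η / (2 * (C + 1)) with hε
  have hε0 : 0 < ε := by positivity
  obtain ⟨r, hr, h⟩ := Metric.tendsto_nhds_nhds.1 (tendsto_modulus hN) (ε * η / 2) (by positivity)
  refine ⟨r, hr, fun y hy n t ht hn => (norm_stepVal_sub_le hN ht hn x y hε0).trans ?_⟩
  have h1 := h (x := x - y) (by rw [dist_zero_right, Real.norm_eq_abs, abs_sub_comm]; exact hy)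
  rw [dist_zero_right, Real.norm_eq_abs] at h1
  have h2 := (le_abs_self _).trans h1.le
  have := wgt_pos ht
  gcongr
  have h3 : ε⁻¹ * modulus N (x - y) ≤ ε⁻¹ * (ε * η / 2) := by gcongr
  have h4 : ε⁻¹ * (ε * η / 2) = η / 2 := by field_simp
  have h5 : ε * C ≤ η / 2 := by
    have : ε * (C + 1) = η / 2 := by rw [hε]; field_simp
    nlinarith
  linarith

/-- The limit of the paths `t ↦ T^{⌊2ⁿt⌋} 1`. -/
def limFlow (a b : ℝ) (N : ℕ) (hN : 0 < N) (t : ℝ) : L2i a b :=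
  limUnder atTop fun n : ℕ => stepFlow (dyadicComp a b N hN n) (2 ^ n) (oneL2 a b) t

theorem tendsto_limFlow (hab : a < b) (ht : 0 < t) :
    Tendsto (fun n : ℕ => stepFlow (dyadicComp a b N hN n) (2 ^ n) (oneL2 a b) t) atTop
      (𝓝 (limFlow a b N hN t)) :=
  tendsto_nhds_limUnder (exists_tendsto_stepFlow (isPosContraction_dyadicComp hN)
    (fun n => by positivity) (tendsto_pow_atTop_atTop_of_one_lt one_lt_two)
    (fun lam hlam => ⟨_, tendsto_stepResolvent_one hab hN hlam⟩) ht)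

theorem norm_limFlow_sub_le (hab : a < b) {τ s : ℝ} (hτ : 0 < τ) (hs : τ ≤ s) (ht : τ ≤ t) :
    ‖limFlow a b N hN s - limFlow a b N hN t‖ ≤ ‖oneL2 a b‖ * (|s - t| / τ) := by
  have h1 := ((tendsto_limFlow (a := a) (b := b) hN hab (hτ.trans_le hs)).sub
    (tendsto_limFlow (a := a) (b := b) hN hab (hτ.trans_le ht))).norm
  have h2 : Tendsto (fun n : ℕ => ‖oneL2 a b‖ * ((|s - t| + 1 / (2 : ℝ) ^ n) / τ)) atTop
      (𝓝 (‖oneL2 a b‖ * ((|s - t| + 0) / τ))) := by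
    simp_rw [one_div]
    exact ((tendsto_two_pow_inv.const_add _).div_const _).const_mul _
  rw [add_zero] at h2
  exact le_of_tendsto_of_tendsto' h1 h2 fun n =>
    (isPosContraction_dyadicComp hN n).norm_stepFlow_sub_le (by positivity) _ hτ hs ht

theorem continuousOn_limFlow (hab : a < b) : ContinuousOn (limFlow a b N hN) (Ioi 0) := by
  intro s (hs : 0 < s)
  refine ContinuousAt.continuousWithinAt ?_
  rw [ContinuousAt, tendsto_iff_norm_sub_tendsto_zero]
  have h1 : Tendsto (fun t => ‖oneL2 a b‖ * (|t - s| / (s / 2))) (𝓝 s) (𝓝 0) := by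
    have : Continuous fun t => ‖oneL2 a b‖ * (|t - s| / (s / 2)) := by fun_prop
    simpa using this.tendsto s
  refine squeeze_zero' (Eventually.of_forall fun _ => norm_nonneg _) ?_ h1
  filter_upwards [lt_mem_nhds (show s / 2 < s by linarith)] with t ht
  exact norm_limFlow_sub_le hN hab (by positivity) ht.le (by linarith)

theorem eventually_one_le_two_pow_mul (ht : 0 < t) : ∀ᶠ n : ℕ in atTop, 1 ≤ (2 : ℝ) ^ n * t :=
  ((tendsto_pow_atTop_atTop_of_one_lt one_lt_two).atTop_mul_const ht).eventually_ge_atTop 1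

/-- The bridge from L² to points: averages over short intervals are continuous functionals on L²,
and they approximate the value at x uniformly in n, with the weight `wgt t` in t. -/
theorem exists_norm_avg_sub_le {x : ℝ} (hx : x ∈ Ioo a b) {η : ℝ} (hη : 0 < η) :
    ∃ r₀ > 0, ∀ r, 0 < r → r < r₀ → ∀ n t, 0 < t → 1 ≤ (2 : ℝ) ^ n * t →
      ‖avg a b x r (stepFlow (dyadicComp a b N hN n) (2 ^ n) (oneL2 a b) t) -
        stepVal a b N hN n t x‖ ≤ η * wgt t := by
  obtain ⟨r₁, hr₁, h1⟩ := exists_norm_stepVal_sub_le hN a b x hη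
  refine ⟨min r₁ (min (x - a) (b - x)), lt_min hr₁ (lt_min (sub_pos.2 hx.1) (sub_pos.2 hx.2)),
    fun r hr hr' n t ht hn => ?_⟩
  obtain ⟨h3, h4, h5⟩ : r < r₁ ∧ r < x - a ∧ r < b - x := by simpa using! hr'
  exact norm_avg_sub_le hr (Ioo_subset_Ioo (by linarith) (by linarith))
    (stepFlow_ae_eq_stepVal hN ht hn) (continuous_stepVal hN)
    fun y hy => h1 y (abs_sub_lt_iff.2 ⟨by linarith [hy.2], by linarith [hy.1]⟩) n t ht hn

/-- The pointwise limit of `stepVal`. -/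
def limVal (a b : ℝ) (N : ℕ) (hN : 0 < N) (x t : ℝ) : ℂ :=
  limUnder atTop fun n : ℕ => stepVal a b N hN n t x

/-- Averages of the flows converge by the L² convergence, and they stay uniformly close to the
values at x; hence these values form a Cauchy sequence. -/
theorem tendsto_limVal {x : ℝ} (hx : x ∈ Ioo a b) (ht : 0 < t) :
    Tendsto (fun n : ℕ => stepVal a b N hN n t x) atTop (𝓝 (limVal a b N hN x t)) := by
  refine tendsto_nhds_limUnder (cauchySeq_tendsto_of_complete (Metric.cauchySeq_iff'.2 ?_))
  intro ε hε
  have hw := wgt_pos ht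
  obtain ⟨r, hr, h1⟩ := exists_norm_avg_sub_le hN hx (η := ε / (4 * wgt t)) (by positivity)
  have h2 := ((avg a b x (r / 2)).continuous.tendsto _).comp
    (tendsto_limFlow (a := a) (b := b) hN (hx.1.trans hx.2) ht)
  obtain ⟨M, hM⟩ := Metric.cauchySeq_iff.1 h2.cauchySeq (ε / 4) (by positivity)
  obtain ⟨M', hM'⟩ := eventually_atTop.1 (eventually_one_le_two_pow_mul ht)
  refine ⟨max M M', fun n hn => ?_⟩
  have h3 := h1 (r / 2) (by positivity) (by linarith) n t ht (hM' n ((le_max_right _ _).trans hn))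
  have h4 := h1 (r / 2) (by positivity) (by linarith) (max M M') t ht (hM' _ (le_max_right _ _))
  have h5 := hM n ((le_max_left _ _).trans hn) (max M M') (le_max_left _ _)
  have h6 : ε / (4 * wgt t) * wgt t = ε / 4 := by field_simp
  rw [h6, ← dist_eq_norm] at h3 h4
  rw [dist_comm] at h3
  have h7 := dist_triangle4 (stepVal a b N hN n t x) _ _ (stepVal a b N hN (max M M') t x) |>.trans
    (add_le_add_three h3 h5.le h4)
  linarith

theorem norm_limVal_le {x : ℝ} (hx : x ∈ Ioo a b) (ht : 0 < t) :
    ‖limVal a b N hN x t‖ ≤ ((∫ ξ, 1 / (1 + sym N ξ)) + 2 * ‖oneL2 a b‖ ^ 2) * wgt t :=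
  le_of_tendsto (tendsto_limVal hN hx ht).norm
    ((eventually_one_le_two_pow_mul ht).mono fun _ hn => norm_stepVal_le hN ht hn x)

theorem exists_norm_avg_sub_limVal_le {x : ℝ} (hx : x ∈ Ioo a b) {η : ℝ} (hη : 0 < η) :
    ∃ r₀ > 0, ∀ r, 0 < r → r < r₀ → ∀ t, 0 < t →
      ‖avg a b x r (limFlow a b N hN t) - limVal a b N hN x t‖ ≤ η * wgt t := by
  obtain ⟨r₀, hr₀, h⟩ := exists_norm_avg_sub_le hN hx hη
  refine ⟨r₀, hr₀, fun r hr hr' t ht => ?_⟩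
  have h2 := (((avg a b x r).continuous.tendsto _).comp
    (tendsto_limFlow (a := a) (b := b) hN (hx.1.trans hx.2) ht)).sub (tendsto_limVal hN hx ht)
  exact le_of_tendsto h2.norm ((eventually_one_le_two_pow_mul ht).mono fun n hn =>
    h r hr hr' n t ht hn)

theorem continuousOn_limVal {x : ℝ} (hx : x ∈ Ioo a b) :
    ContinuousOn (limVal a b N hN x) (Ioi 0) := by
  intro s (hs : 0 < s)
  refine ContinuousAt.continuousWithinAt ?_
  refine continuousAt_of_locally_uniform_approx_of_continuousAt fun U hU => ?_
  obtain ⟨ε, hε, hU⟩ := Metric.mem_uniformity_dist.1 hU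
  have hw := wgt_pos (half_pos hs)
  obtain ⟨r, hr, h1⟩ := exists_norm_avg_sub_limVal_le hN hx (η := ε / (2 * wgt (s / 2)))
    (by positivity)
  refine ⟨Ioi (s / 2), lt_mem_nhds (by linarith), fun t => avg a b x (r / 2) (limFlow a b N hN t),
    (avg a b x (r / 2)).continuous.continuousAt.comp ((continuousOn_limFlow hN
      (hx.1.trans hx.2)).continuousAt (lt_mem_nhds hs)), fun t (ht : s / 2 < t) => hU ?_⟩
  have ht0 : 0 < t := by linarith
  rw [dist_comm, dist_eq_norm]
  refine (h1 (r / 2) (by positivity) (by linarith) t ht0).trans_lt ?_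
  have := wgt_anti (half_pos hs) ht.le
  calc ε / (2 * wgt (s / 2)) * wgt t ≤ ε / (2 * wgt (s / 2)) * wgt (s / 2) := by gcongr
    _ = ε / 2 := by field_simp
    _ < ε := by linarith

theorem integrableOn_exp_mul_limVal {x : ℝ} (hx : x ∈ Ioo a b) {lam : ℝ} (hlam : 0 < lam) :
    IntegrableOn (fun t => (Real.exp (-lam * t) : ℂ) * limVal a b N hN x t) (Ioi 0) := by
  refine ((integrableOn_wgt hlam).const_mul
    ((∫ ξ, 1 / (1 + sym N ξ)) + 2 * ‖oneL2 a b‖ ^ 2)).mono' ?_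
    ((ae_restrict_iff' measurableSet_Ioi).2 (Eventually.of_forall fun t (ht : 0 < t) => ?_))
  · refine ContinuousOn.aestronglyMeasurable (ContinuousOn.mul ?_ (continuousOn_limVal hN hx))
      measurableSet_Ioi
    exact Continuous.continuousOn (by fun_prop)
  · rw [norm_mul, Complex.norm_real, Real.norm_of_nonneg (Real.exp_pos _).le]
    have := mul_le_mul_of_nonneg_left (norm_limVal_le hN hx ht) (Real.exp_pos (-lam * t)).le
    linarith

/-- The Laplace transform of a short average of the flow is the same average of `resolventSol`. It
is within ε/2 of the left side by the weighted bound integrated in t, and within ε/2 of the right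
side by continuity in x. -/
theorem integral_exp_mul_limVal {x : ℝ} (hx : x ∈ Ioo a b) {lam : ℝ} (hlam : 0 < lam) :
    ∫ t in Ioi (0 : ℝ), (Real.exp (-lam * t) : ℂ) * limVal a b N hN x t =
      resolventSol N a b lam x := by
  have hab := hx.1.trans hx.2
  set W := ∫ t in Ioi (0 : ℝ), Real.exp (-lam * t) * wgt t with hW
  have hW0 : 0 ≤ W := setIntegral_nonneg measurableSet_Ioi fun t ht =>
    mul_nonneg (Real.exp_pos _).le (wgt_pos ht).le
  refine eq_of_forall_dist_le fun ε hε => ?_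
  obtain ⟨r₀, hr₀, h1⟩ := exists_norm_avg_sub_limVal_le hN hx (η := ε / (2 * (W + 1)))
    (by positivity)
  obtain ⟨r₁, hr₁, h2⟩ := Metric.continuous_iff.1 (continuous_resolventSol hab hN hlam) x (ε / 2)
    (by positivity)
  obtain ⟨r, hr, hr'⟩ := exists_between
    (lt_min (lt_min hr₀ hr₁) (lt_min (sub_pos.2 hx.1) (sub_pos.2 hx.2)))
  obtain ⟨⟨h3, h4⟩, h5, h6⟩ : (r < r₀ ∧ r < r₁) ∧ r < x - a ∧ r < b - x := by simpa using! hr'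
  have h7 := integral_exp_mul_apply_lim (isPosContraction_dyadicComp hN) hlam
    (tendsto_stepResolvent_one hab hN hlam) (fun t ht => tendsto_limFlow hN hab ht) (avg a b x r)
  have h8 := norm_avg_sub_le (a := a) (b := b) (x := x) hr (Ioo_subset_Ioo (by linarith) (by linarith))
    (coeFn_contL2 (continuous_resolventSol hab hN hlam)) (continuous_resolventSol hab hN hlam)
    (η := ε / 2) fun y hy => by
      rw [← dist_eq_norm]
      exact (h2 y (abs_sub_lt_iff.2 ⟨by linarith [hy.2], by linarith [hy.1]⟩)).le
  have i1 := integrableOn_exp_mul_limVal hN hx hlam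
  have i2 : IntegrableOn (fun t => (Real.exp (-lam * t) : ℂ) *
      avg a b x r (limFlow a b N hN t)) (Ioi 0) := by
    have i3 : IntegrableOn (fun t => (Real.exp (-lam * t) : ℂ) *
        (avg a b x r (limFlow a b N hN t) - limVal a b N hN x t)) (Ioi 0) := by
      refine ((integrableOn_wgt hlam).const_mul (ε / (2 * (W + 1)))).mono' ?_
        ((ae_restrict_iff' measurableSet_Ioi).2 (Eventually.of_forall fun t (ht : 0 < t) => ?_))
      · refine ContinuousOn.aestronglyMeasurable (ContinuousOn.mul
          (Continuous.continuousOn (by fun_prop)) (ContinuousOn.sub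
            ((avg a b x r).continuous.comp_continuousOn (continuousOn_limFlow hN hab))
            (continuousOn_limVal hN hx))) measurableSet_Ioi
      · rw [norm_mul, Complex.norm_real, Real.norm_of_nonneg (Real.exp_pos _).le]
        have := mul_le_mul_of_nonneg_left (h1 r hr h3 t ht) (Real.exp_pos (-lam * t)).le
        linarith
    refine (i3.add i1).congr (Eventually.of_forall fun t => ?_)
    simp only [Pi.add_apply]; ring
  have h9 : ‖(∫ t in Ioi (0 : ℝ), (Real.exp (-lam * t) : ℂ) * limVal a b N hN x t) -
      ∫ t in Ioi (0 : ℝ), (Real.exp (-lam * t) : ℂ) * avg a b x r (limFlow a b N hN t)‖ ≤ ε / 2 := by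
    rw [← integral_sub i1 i2]
    calc _ ≤ ∫ t in Ioi (0 : ℝ), ε / (2 * (W + 1)) * (Real.exp (-lam * t) * wgt t) := by
          refine norm_integral_le_of_norm_le ((integrableOn_wgt hlam).const_mul _)
            ((ae_restrict_iff' measurableSet_Ioi).2 (Eventually.of_forall fun t (ht : 0 < t) => ?_))
          rw [← mul_sub, norm_mul, Complex.norm_real, Real.norm_of_nonneg (Real.exp_pos _).le,
            norm_sub_rev]
          have := mul_le_mul_of_nonneg_left (h1 r hr h3 t ht) (Real.exp_pos (-lam * t)).le
          linarith
      _ = ε / (2 * (W + 1)) * W := integral_const_mul _ _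
      _ ≤ ε / (2 * (W + 1)) * (W + 1) := by gcongr; linarith
      _ = ε / 2 := by field_simp
  rw [h7] at h9
  rw [← dist_eq_norm] at h8 h9
  linarith [dist_triangle _ _ _ |>.trans (add_le_add h9 h8)]

end

/-! ### Behaviour as t tends to 0: cut-off kernels and commutators. -/

theorem exists_schwartz_cutoff {x : ℝ} (hx : x ∈ Ioo a b) :
    ∃ ζ : 𝓢(ℝ, ℂ), ζ x = 1 ∧ ∀ y ∉ Ioo a b, ζ y = 0 := by
  obtain ⟨r, hr, hr'⟩ := exists_between (lt_min (sub_pos.2 hx.1) (sub_pos.2 hx.2))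
  obtain ⟨h5, h6⟩ : r < x - a ∧ r < b - x := by simpa using! hr'
  let f : ContDiffBump x := ⟨r / 2, r, by positivity, by linarith⟩
  have hg : ContDiff ℝ ∞ (fun y => (f y : ℂ)) := Complex.ofRealCLM.contDiff.comp f.contDiff
  have hgc : HasCompactSupport (fun y => (f y : ℂ)) :=
    f.hasCompactSupport.comp_left (g := ((↑) : ℝ → ℂ)) rfl
  refine ⟨hgc.toSchwartzMap hg, ?_, fun y hy => ?_⟩
  · change (f x : ℂ) = 1
    rw [f.one_of_mem_closedBall (by simp [f.rIn_pos.le])]; simp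
  · change (f y : ℂ) = 0
    rw [f.zero_of_le_dist, Complex.ofReal_zero]
    change r ≤ dist y x
    by_contra! h
    rw [Real.dist_eq, abs_sub_lt_iff] at h
    exact hy ⟨by linarith, by linarith⟩

theorem chr_comm (c ξ : ℝ) : chr c ξ = chr ξ c := by unfold chr; congr 2; push_cast; ring

theorem fourier_eq_integral_chr (f : ℝ → ℂ) (ξ : ℝ) : 𝓕 f ξ = ∫ y, chr ξ y * f y := by
  rw [Real.fourier_real_eq_integral_exp_smul]
  congr 1; ext y
  rw [smul_eq_mul, chr_comm, chr]

theorem chr_add (c ξ η : ℝ) : chr c (ξ + η) = chr c ξ * chr c η := by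
  unfold chr; rw [← Complex.exp_add]; congr 1; push_cast; ring

theorem chr_neg_neg (c ξ : ℝ) : chr (-c) (-ξ) = chr c ξ := by unfold chr; congr 2; push_cast; ring

/-- The Fourier transform of `y ↦ ζ(y) p_τ(x - y)`. -/
def modConv (N : ℕ) (ζ : 𝓢(ℝ, ℂ)) (x τ ξ : ℝ) : ℂ :=
  ∫ σ, 𝓕 ζ σ * (chr x (ξ - σ) * mult N τ (ξ - σ))

variable {N : ℕ} {ζ : 𝓢(ℝ, ℂ)} {x : ℝ}

theorem hat_mul_kernel (hN : 0 < N) (hζ : ∀ y ∉ Ioo a b, ζ y = 0) {τ : ℝ} (hτ : 0 < τ) (ξ : ℝ) :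
    hat a b (fun y => ζ y * (kernel N τ (x - y) : ℂ)) ξ = modConv N ζ x τ ξ := by
  have h1 : ext0 a b (fun y => ζ y * (kernel N τ (x - y) : ℂ)) =
      fun y => ζ y * (kernel N τ (x - y) : ℂ) := by
    ext y
    by_cases hy : y ∈ Ioo a b <;> simp [ext0, hy, hζ]
  have h2 : ∀ y, (kernel N τ (x - y) : ℂ) = 𝓕 (fun η => chr (-x) η * mult N τ η) y := by
    intro y
    rw [kernel_eq_integral hN hτ, Real.fourierInv_eq', fourier_eq_integral_chr]
    congr 1; ext η
    rw [smul_eq_mul, ← mul_assoc, chr, chr, ← Complex.exp_add]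
    congr 2
    simp; ring
  have h3 : ∀ η, 𝓕 (fun y => chr ξ y * ζ y) η = 𝓕 ζ (ξ + η) := by
    intro η
    rw [fourier_eq_integral_chr, SchwartzMap.fourier_coe, fourier_eq_integral_chr]
    congr 1; ext y
    rw [chr_comm (ξ + η), chr_add, chr_comm y, chr_comm y]; ring
  have i1 : Integrable (fun y => chr ξ y * ζ y) :=
    ζ.integrable.bdd_mul (c := 1) (continuous_chr _).aestronglyMeasurable
      (Eventually.of_forall fun y => (norm_chr _ y).le)
  have i2 : Integrable (fun η => chr (-x) η * mult N τ η) :=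
    (integrable_mult hN hτ).bdd_mul (c := 1) (continuous_chr _).aestronglyMeasurable
      (Eventually.of_forall fun y => (norm_chr _ y).le)
  have h4 := integral_fourier_mul i1 i2
  rw [hat, h1, fourier_eq_integral_chr]
  simp_rw [h2, ← mul_assoc]
  rw [← h4]
  simp_rw [h3]
  rw [modConv, ← integral_sub_right_eq_self _ ξ]
  congr 1; ext σ
  rw [add_sub_cancel, ← chr_neg_neg, neg_neg, neg_sub, mult, mult, ← sym_neg, neg_sub]

/-- At τ = 0 the kernel is the point mass at x, which the cut-off leaves unchanged because ζ(x) = 1.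
-/
theorem modConv_zero (hx : ζ x = 1) (ξ : ℝ) : modConv N ζ x 0 ξ = chr x ξ := by
  have h1 : ∀ σ, 𝓕 ζ σ * (chr x (ξ - σ) * mult N 0 (ξ - σ)) =
      chr x ξ * (Complex.exp (↑(2 * Real.pi * inner ℝ σ x) * Complex.I) • 𝓕 ζ σ) := by
    intro σ
    have : chr x (ξ - σ) = chr x ξ * Complex.exp (↑(2 * Real.pi * inner ℝ σ x) * Complex.I) := by
      unfold chr
      rw [← Complex.exp_add]; congr 1; simp; ring
    rw [this, mult]; simp; ring
  rw [modConv]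
  simp_rw [h1]
  rw [integral_const_mul, ← Real.fourierInv_eq']
  have h2 : 𝓕⁻ (𝓕 (ζ : ℝ → ℂ)) x = ζ x :=
    congrFun (ζ.continuous.fourierInv_fourier_eq ζ.integrable (𝓕 ζ).integrable) x
  rw [SchwartzMap.fourier_coe, h2, hx, mul_one]

theorem integrable_modConv (N : ℕ) (ζ : 𝓢(ℝ, ℂ)) (x ξ : ℝ) {τ : ℝ} (hτ : 0 ≤ τ) :
    Integrable (fun σ => 𝓕 ζ σ * (chr x (ξ - σ) * mult N τ (ξ - σ))) := by
  refine (𝓕 ζ).integrable.mul_bdd (c := 1) ?_ (Eventually.of_forall fun σ => ?_)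
  · exact (((continuous_chr x).comp (continuous_const.sub continuous_id)).mul
      ((continuous_mult N τ).comp (continuous_const.sub continuous_id))).aestronglyMeasurable
  · rw [norm_mul, norm_chr, one_mul]; exact norm_mult_le_one N hτ _

theorem tendsto_modConv (hx : ζ x = 1) : Tendsto (fun τ => modConv N ζ x τ 0) (𝓝[≥] 0) (𝓝 1) := by
  have h0 : modConv N ζ x 0 0 = 1 := by rw [modConv_zero hx]; simp [chr]
  rw [← h0]
  refine tendsto_integral_filter_of_dominated_convergence (fun σ => ‖𝓕 ζ σ‖) ?_ ?_
    (𝓕 ζ).integrable.norm ?_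
  · filter_upwards [self_mem_nhdsWithin] with τ hτ
    exact (integrable_modConv N ζ x 0 hτ).aestronglyMeasurable
  · filter_upwards [self_mem_nhdsWithin] with τ hτ
    refine Eventually.of_forall fun σ => ?_
    rw [norm_mul, norm_mul, norm_chr, one_mul]
    exact mul_le_of_le_one_right (norm_nonneg _) (norm_mult_le_one N hτ _)
  · refine Eventually.of_forall fun σ => Tendsto.mono_left ?_ nhdsWithin_le_nhds
    have : Continuous fun τ => 𝓕 ζ σ * (chr x (0 - σ) * mult N τ (0 - σ)) := by
      unfold mult; fun_prop
    exact this.tendsto 0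

/-- A shift of frequency lowers the degree in ξ by one; this is the gain in the commutator of A with
a smooth cut-off. The growth in σ will be absorbed by the decay of the transform of ζ. -/
theorem abs_sym_sub_le (N : ℕ) (ξ σ : ℝ) :
    |sym N ξ - sym N (ξ - σ)| ≤ (2 * Real.pi) ^ (2 * N) * (2 * N) * (1 + |σ|) ^ (2 * N) *
      (1 + |ξ|) ^ (2 * N - 1) := by
  rcases Nat.eq_zero_or_pos N with rfl | hN
  · simp [sym]
  obtain ⟨m, hm⟩ : ∃ m, 2 * N = m + 1 := ⟨2 * N - 1, by omega⟩
  have hm' : (2 * N : ℝ) = m + 1 := by exact_mod_cast hm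
  rw [sym, sym, mul_pow _ ξ, mul_pow _ (ξ - σ), ← mul_sub, abs_mul, abs_of_nonneg (by positivity), mul_assoc,
    mul_assoc]
  refine mul_le_mul_of_nonneg_left ?_ (by positivity)
  refine (abs_pow_sub_pow_le _ _ _).trans ?_
  rw [hm', hm, Nat.add_sub_cancel, sub_sub_cancel]
  have h1 : max |ξ| |ξ - σ| ≤ (1 + |σ|) * (1 + |ξ|) := by
    have := abs_sub ξ σ
    have := mul_nonneg (abs_nonneg ξ) (abs_nonneg σ)
    exact max_le (by nlinarith [abs_nonneg ξ, abs_nonneg σ]) (by nlinarith [abs_nonneg σ])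
  calc |σ| * ((m + 1 : ℕ) : ℝ) * max |ξ| |ξ - σ| ^ m
      ≤ (1 + |σ|) * ((m + 1 : ℕ) : ℝ) * ((1 + |σ|) * (1 + |ξ|)) ^ m := by
        gcongr; linarith
    _ = _ := by rw [mul_pow]; push_cast; ring

variable {N : ℕ}

/-- The weight `(1 + |ξ|)^{2N-1} e^{-τ s(ξ)}`. -/
def symWgt (N : ℕ) (τ ξ : ℝ) : ℝ := (1 + |ξ|) ^ (2 * N - 1) * Real.exp (-τ * sym N ξ)

theorem symWgt_sq (N : ℕ) (τ ξ : ℝ) :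
    symWgt N τ ξ ^ 2 = (1 + |ξ|) ^ (2 * (2 * N - 1)) * Real.exp (-(2 * τ) * sym N ξ) := by
  rw [symWgt, mul_pow, ← pow_mul, mul_comm (2 * N - 1), ← Real.exp_nat_mul]
  congr 2; push_cast; ring

theorem integrable_symWgt_sq (hN : 0 < N) {τ : ℝ} (hτ : 0 < τ) :
    Integrable (fun ξ => symWgt N τ ξ ^ 2) := by
  simp_rw [symWgt_sq]
  exact integrable_one_add_abs_pow_mul_exp_sym hN _ (by positivity)

/-- Scaling ξ by δ = τ^{1/(2N)}: the degree 2(2N - 1) and the Jacobian give δ^{-(4N-1)}, which is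
the square of τ^{1/(4N) - 1}. The exponent exceeds -1, so these norms are integrable in τ near 0. -/
theorem integral_symWgt_sq_le (hN : 0 < N) {τ : ℝ} (hτ : 0 < τ) (hτ1 : τ ≤ 1) :
    ∫ ξ, symWgt N τ ξ ^ 2 ≤
      (∫ ξ, symWgt N 1 ξ ^ 2) * (τ ^ (1 / (4 * N : ℝ) - 1)) ^ 2 := by
  have hN' : (0 : ℝ) < N := by exact_mod_cast hN
  set δ := τ ^ (1 / (2 * N : ℝ)) with hδ
  have hδ0 : 0 < δ := by positivity
  have hδ1 : δ ≤ 1 := Real.rpow_le_one hτ.le hτ1 (by positivity)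
  have hδp : δ ^ (2 * N) = τ := by
    rw [hδ, ← Real.rpow_natCast, ← Real.rpow_mul hτ.le]; push_cast
    rw [one_div_mul_cancel (by positivity), Real.rpow_one]
  have h1 : ∀ ξ, symWgt N τ ξ ^ 2 ≤ (δ⁻¹) ^ (2 * (2 * N - 1)) * symWgt N 1 (δ * ξ) ^ 2 := by
    intro ξ
    rw [symWgt_sq, symWgt_sq, sym_mul, hδp, ← mul_assoc, ← mul_pow]
    have h2 : 1 + |ξ| ≤ δ⁻¹ * (1 + |δ * ξ|) := by
      rw [abs_mul, abs_of_pos hδ0, mul_add, ← mul_assoc, inv_mul_cancel₀ hδ0.ne']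
      have := (one_le_inv₀ hδ0).2 hδ1
      linarith
    have h3 : -(2 * 1) * (τ * sym N ξ) = -(2 * τ) * sym N ξ := by ring
    rw [h3]
    gcongr
  have h4 : (δ⁻¹) ^ (2 * (2 * N - 1)) * δ⁻¹ = (τ ^ (1 / (4 * N : ℝ) - 1)) ^ 2 := by
    rw [← pow_succ, hδ, ← Real.rpow_neg hτ.le, ← Real.rpow_natCast, ← Real.rpow_natCast,
      ← Real.rpow_mul hτ.le, ← Real.rpow_mul hτ.le]
    congr 1
    rw [show 2 * (2 * N - 1) + 1 = 4 * N - 1 by omega, Nat.cast_sub (by omega)]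
    push_cast
    field_simp
    ring
  have i1 := (integrable_symWgt_sq hN one_pos).comp_mul_left' hδ0.ne'
  calc ∫ ξ, symWgt N τ ξ ^ 2
      ≤ ∫ ξ, (δ⁻¹) ^ (2 * (2 * N - 1)) * symWgt N 1 (δ * ξ) ^ 2 :=
        integral_mono (integrable_symWgt_sq hN hτ) (i1.const_mul _) h1
    _ = (δ⁻¹) ^ (2 * (2 * N - 1)) * (δ⁻¹ * ∫ ξ, symWgt N 1 ξ ^ 2) := by
        rw [integral_const_mul, Measure.integral_comp_mul_left (fun ξ => symWgt N 1 ξ ^ 2) δ,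
          abs_of_pos (by positivity), smul_eq_mul]
    _ = _ := by rw [← h4]; ring

theorem abs_exp_neg_sub_exp_neg_le {p q : ℝ} (hp : 0 ≤ p) (hq : 0 ≤ q) :
    |Real.exp (-p) - Real.exp (-q)| ≤ |p - q| * (Real.exp (-p) + Real.exp (-q)) ∧
      |Real.exp (-p) - Real.exp (-q)| ≤ |p - q| := by
  have key : ∀ {p q : ℝ}, 0 ≤ p → p ≤ q →
      |Real.exp (-p) - Real.exp (-q)| ≤ |p - q| * Real.exp (-p) := by
    intro p q _ hpq
    have h1 : Real.exp (-q) = Real.exp (-p) * Real.exp (p - q) := by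
      rw [← Real.exp_add]; congr 1; ring
    have h2 := Real.add_one_le_exp (p - q)
    have h3 : Real.exp (p - q) ≤ 1 := Real.exp_le_one_iff.2 (by linarith)
    have h4 := Real.exp_pos (-p)
    rw [h1, ← mul_one_sub, abs_mul, abs_of_pos h4, abs_of_nonneg (by linarith), mul_comm,
      abs_of_nonpos (by linarith)]
    gcongr
    linarith
  have e1 := Real.exp_pos (-p)
  have e2 := Real.exp_pos (-q)
  have e3 : Real.exp (-p) ≤ 1 := Real.exp_le_one_iff.2 (by linarith)
  have e4 : Real.exp (-q) ≤ 1 := Real.exp_le_one_iff.2 (by linarith)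
  have e5 := abs_nonneg (p - q)
  rcases le_total p q with h | h
  · have := key hp h
    exact ⟨by nlinarith, by nlinarith⟩
  · have := key hq h
    rw [abs_sub_comm, abs_sub_comm q p] at this
    exact ⟨by nlinarith, by nlinarith⟩

/-- τ' is the time available for damping. For τ > 0 it is τ itself; in the very first step, where τ
= 0, the damping comes from the increment of the multiplier and τ' = h. -/
theorem norm_mult_mul_mult_sub_le {h τ τ' : ℝ} (hh : 0 < h) (hτ : τ' = τ ∨ τ = 0 ∧ τ' = h)
    (ξ η : ℝ) (hτ0 : 0 ≤ τ) :
    ‖mult N τ η * (mult N h ξ - mult N h η)‖ ≤ h * |sym N ξ - sym N η| *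
      (Real.exp (-τ' * sym N ξ) + Real.exp (-τ' * sym N η)) := by
  have h1 := mul_nonneg hh.le (sym_nonneg N ξ)
  have h2 := mul_nonneg hh.le (sym_nonneg N η)
  obtain ⟨h3, h4⟩ := abs_exp_neg_sub_exp_neg_le h1 h2
  rw [← mul_sub, abs_mul, abs_of_pos hh, ← neg_mul, ← neg_mul] at h3 h4
  rw [norm_mul, norm_mult, mult, mult, ← Complex.ofReal_sub, Complex.norm_real, Real.norm_eq_abs]
  have e1 := Real.exp_pos (-τ' * sym N ξ)
  rcases hτ with rfl | ⟨rfl, rfl⟩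
  · have e2 := Real.exp_pos (-τ' * sym N η)
    have h5 : 0 ≤ h * |sym N ξ - sym N η| := by positivity
    nlinarith [mul_le_mul_of_nonneg_left h4 e2.le]
  · simpa using h3

theorem sym_sub_mul_exp_le {τ : ℝ} (ξ σ : ℝ) :
    |sym N ξ - sym N (ξ - σ)| *
      (Real.exp (-τ * sym N ξ) + Real.exp (-τ * sym N (ξ - σ))) ≤
    (2 * Real.pi) ^ (2 * N) * (2 * N) * (1 + |σ|) ^ (2 * N) *
      (symWgt N τ ξ + symWgt N τ (ξ - σ)) := by
  have h1 := abs_sym_sub_le N ξ σ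
  have h2 := abs_sym_sub_le N (ξ - σ) (-σ)
  rw [sub_neg_eq_add, sub_add_cancel, abs_sub_comm, abs_neg] at h2
  have e1 := mul_le_mul_of_nonneg_right h1 (Real.exp_pos (-τ * sym N ξ)).le
  have e2 := mul_le_mul_of_nonneg_right h2 (Real.exp_pos (-τ * sym N (ξ - σ))).le
  unfold symWgt
  linarith

theorem integrable_fourier_mul_one_add_abs_pow (ζ : 𝓢(ℝ, ℂ)) (m : ℕ) :
    Integrable (fun σ => ‖𝓕 ζ σ‖ * (1 + |σ|) ^ m) := by
  have i1 := ((𝓕 ζ).integrable.norm.add ((𝓕 ζ).integrable_pow_mul volume m)).const_mul (2 ^ (m - 1))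
  refine i1.mono' (((𝓕 ζ).continuous.norm.mul (by fun_prop)).aestronglyMeasurable)
    (Eventually.of_forall fun σ => ?_)
  rw [Real.norm_of_nonneg (by positivity)]
  have h1 := add_pow_le zero_le_one (abs_nonneg σ) m
  rw [one_pow] at h1
  have h2 := mul_le_mul_of_nonneg_left h1 (norm_nonneg (𝓕 ζ σ))
  simp only [Pi.add_apply, Real.norm_eq_abs]
  linarith

/-- Without the cut-off, advancing the kernel by h would be exact by the semigroup law. The error is
the commutator of e^{-hA} with ζ, of order h times the L² size τ'^{1/(4N) - 1} of the weight of
degree 2N - 1. -/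
theorem exists_commutator_bound (hN : 0 < N) (ζ : 𝓢(ℝ, ℂ)) (x : ℝ) :
    ∃ C, 0 ≤ C ∧ ∀ h τ τ' : ℝ, 0 < h → 0 ≤ τ → 0 < τ' → τ' ≤ 1 → (τ' = τ ∨ τ = 0 ∧ τ' = h) →
      ∀ {a b : ℝ} (f : L2i a b),
        ‖∫ ξ, (mult N h ξ * conj (modConv N ζ x τ ξ) - conj (modConv N ζ x (τ + h) ξ)) *
          hat a b f ξ‖ ≤ C * (h * τ' ^ (1 / (4 * N : ℝ) - 1)) * (‖f‖ ^ 2 + 1) := by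
  set c₀ : ℝ := (2 * Real.pi) ^ (2 * N) * (2 * N) with hc₀
  have hc₀0 : 0 ≤ c₀ := by positivity
  set ρ : ℝ → ℝ := fun σ => ‖𝓕 ζ σ‖ * (1 + |σ|) ^ (2 * N) with hρ
  have iρ : Integrable ρ := integrable_fourier_mul_one_add_abs_pow ζ _
  have hρ0 : ∀ σ, 0 ≤ ρ σ := fun σ => by positivity
  set B := ∫ σ, ρ σ with hB
  have hB0 : 0 ≤ B := integral_nonneg hρ0
  set A := ∫ ξ, symWgt N 1 ξ ^ 2 with hA
  have hA0 : 0 ≤ A := integral_nonneg fun ξ => by positivity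
  refine ⟨c₀ * B * (1 + A), by positivity, fun h τ τ' hh hτ hτ' hτ1 hcase a b f => ?_⟩
  -- The integral of the squared weight is at most Aε², so with this parameter both halves of the
  -- split product are O(ε).
  set ε := τ' ^ (1 / (4 * N : ℝ) - 1) with hε
  have hε0 : 0 < ε := by positivity
  have iw := integrable_symWgt_sq hN hτ'
  have hw := integral_symWgt_sq_le hN hτ' hτ1
  rw [← hε, ← hA] at hw
  -- a bound for the commutator in the frequency variable
  have h1 : ∀ ξ, mult N h ξ * modConv N ζ x τ ξ - modConv N ζ x (τ + h) ξ =
      ∫ σ, 𝓕 ζ σ * (chr x (ξ - σ) * (mult N τ (ξ - σ) * (mult N h ξ - mult N h (ξ - σ)))) := by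
    intro ξ
    rw [modConv, modConv, ← integral_const_mul, ← integral_sub
      ((integrable_modConv N ζ x ξ hτ).const_mul _) (integrable_modConv N ζ x ξ (by positivity))]
    congr 1; ext σ
    have : mult N (τ + h) (ξ - σ) = mult N τ (ξ - σ) * mult N h (ξ - σ) := by
      rw [mult, mult, mult, ← Complex.ofReal_mul, ← Real.exp_add]; congr 2; ring
    rw [this]; ring
  have ic : ∀ᵐ ξ, Integrable (fun σ => ρ σ * symWgt N τ' (ξ - σ) ^ 2) :=
    iρ.ae_convolution_exists (ContinuousLinearMap.mul ℝ ℝ) iw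
  have h2 : ∀ᵐ ξ, ‖(mult N h ξ * conj (modConv N ζ x τ ξ) - conj (modConv N ζ x (τ + h) ξ)) *
      hat a b f ξ‖ ≤ h * c₀ * (B * (ε * ‖hat a b f ξ‖ ^ 2) + B * (ε⁻¹ / 2 * symWgt N τ' ξ ^ 2) +
        ε⁻¹ / 2 * convolution ρ (fun ξ => symWgt N τ' ξ ^ 2) (ContinuousLinearMap.mul ℝ ℝ) volume ξ) := by
    filter_upwards [ic] with ξ ic
    have e1 : mult N h ξ * conj (modConv N ζ x τ ξ) - conj (modConv N ζ x (τ + h) ξ) =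
        conj (mult N h ξ * modConv N ζ x τ ξ - modConv N ζ x (τ + h) ξ) := by
      rw [map_sub, map_mul, mult, Complex.conj_ofReal]
    rw [e1, norm_mul, RCLike.norm_conj, h1, mul_comm, ← norm_mul, ← integral_const_mul]
    have e2 : h * c₀ * (B * (ε * ‖hat a b f ξ‖ ^ 2) + B * (ε⁻¹ / 2 * symWgt N τ' ξ ^ 2) +
        ε⁻¹ / 2 * convolution ρ (fun ξ => symWgt N τ' ξ ^ 2) (ContinuousLinearMap.mul ℝ ℝ) volume ξ) =
        ∫ σ, (h * c₀ * (ε * ‖hat a b f ξ‖ ^ 2 + ε⁻¹ / 2 * symWgt N τ' ξ ^ 2) * ρ σ +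
          h * c₀ * (ε⁻¹ / 2) * (ρ σ * symWgt N τ' (ξ - σ) ^ 2)) := by
      rw [integral_add (iρ.const_mul _) (ic.const_mul _), integral_const_mul,
        integral_const_mul, convolution_mul, ← hB]
      ring
    rw [e2]
    refine norm_integral_le_of_norm_le ((iρ.const_mul _).add (ic.const_mul _))
      (Eventually.of_forall fun σ => ?_)
    simp only [norm_mul, norm_chr, one_mul]
    rw [← norm_mul (mult N τ _)]
    have e3 := norm_mult_mul_mult_sub_le (N := N) hh hcase ξ (ξ - σ) hτ
    have e4 := sym_sub_mul_exp_le (N := N) (τ := τ') ξ σ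
    rw [← hc₀] at e4
    set y := ‖hat a b f ξ‖
    set w₁ := symWgt N τ' ξ
    set w₂ := symWgt N τ' (ξ - σ)
    have e5 : ∀ w : ℝ, y * w ≤ ε / 2 * y ^ 2 + ε⁻¹ / 2 * w ^ 2 := fun w => by
      have : ε / 2 * y ^ 2 + ε⁻¹ / 2 * w ^ 2 - y * w = (ε * y - w) ^ 2 / (2 * ε) := by
        field_simp; ring
      have h6 : 0 ≤ (ε * y - w) ^ 2 / (2 * ε) := by positivity
      linarith
    calc y * (‖𝓕 ζ σ‖ * ‖mult N τ (ξ - σ) * (mult N h ξ - mult N h (ξ - σ))‖)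
        ≤ y * (‖𝓕 ζ σ‖ * (h * (c₀ * (1 + |σ|) ^ (2 * N) * (w₁ + w₂)))) := by
          gcongr
          refine e3.trans ?_
          rw [mul_assoc]
          gcongr
      _ = h * c₀ * ρ σ * (y * w₁ + y * w₂) := by simp only [hρ]; ring
      _ ≤ h * c₀ * ρ σ * ((ε / 2 * y ^ 2 + ε⁻¹ / 2 * w₁ ^ 2) +
            (ε / 2 * y ^ 2 + ε⁻¹ / 2 * w₂ ^ 2)) := by
          have := hρ0 σ
          gcongr
          · exact e5 _
          · exact e5 _
      _ = _ := by ring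
  have icv : Integrable (convolution ρ (fun ξ => symWgt N τ' ξ ^ 2)
      (ContinuousLinearMap.mul ℝ ℝ) volume) := iρ.integrable_convolution _ iw
  have i2 := (integrable_norm_sq_hat (Lp.memLp f)).const_mul ε |>.const_mul B
  have i3 := (iw.const_mul (ε⁻¹ / 2)).const_mul B
  have i4 := icv.const_mul (ε⁻¹ / 2)
  have i5 : Integrable (fun ξ => B * (ε * ‖hat a b f ξ‖ ^ 2) + B * (ε⁻¹ / 2 * symWgt N τ' ξ ^ 2)) :=
    i2.add i3
  have i6 : Integrable (fun ξ => B * (ε * ‖hat a b f ξ‖ ^ 2) + B * (ε⁻¹ / 2 * symWgt N τ' ξ ^ 2) +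
      ε⁻¹ / 2 * convolution ρ (fun ξ => symWgt N τ' ξ ^ 2) (ContinuousLinearMap.mul ℝ ℝ) volume ξ) :=
    i5.add i4
  refine (norm_integral_le_of_norm_le (i6.const_mul (h * c₀)) h2).trans ?_
  rw [integral_const_mul, integral_add i5 i4, integral_add i2 i3,
    integral_const_mul, integral_const_mul, integral_const_mul, integral_const_mul,
    integral_const_mul, integral_convolution _ iρ iw, ← norm_sq_eq_integral_hat,
    ContinuousLinearMap.mul_apply', ← hB]
  have h5 : h * c₀ * (B * (ε * ‖f‖ ^ 2) + B * (ε⁻¹ / 2 * ∫ ξ, symWgt N τ' ξ ^ 2) +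
      ε⁻¹ / 2 * (B * ∫ ξ, symWgt N τ' ξ ^ 2)) =
      h * c₀ * B * (ε * ‖f‖ ^ 2 + ε⁻¹ * ∫ ξ, symWgt N τ' ξ ^ 2) := by ring
  rw [h5]
  have h6 : ε⁻¹ * ∫ ξ, symWgt N τ' ξ ^ 2 ≤ ε * A := by
    calc ε⁻¹ * ∫ ξ, symWgt N τ' ξ ^ 2 ≤ ε⁻¹ * (A * ε ^ 2) := by gcongr
      _ = ε * A := by field_simp
  calc h * c₀ * B * (ε * ‖f‖ ^ 2 + ε⁻¹ * ∫ ξ, symWgt N τ' ξ ^ 2)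
      ≤ h * c₀ * B * (ε * ‖f‖ ^ 2 + ε * A) := by gcongr
    _ = c₀ * B * (h * ε) * (‖f‖ ^ 2 + A) := by ring
    _ ≤ c₀ * B * (h * ε) * ((1 + A) * (‖f‖ ^ 2 + 1)) := by
        gcongr
        nlinarith [sq_nonneg ‖f‖, mul_nonneg hA0 (sq_nonneg ‖f‖)]
    _ = _ := by ring

/-- Makes the sum of the errors j^{α-1} telescope. Bernoulli's inequality bounds the increment of
y^α from below by α(y + 1)^{α-1}, and y + 1 ≤ 2y costs the factor 2. -/
theorem rpow_sub_one_le {α y : ℝ} (hα : 0 < α) (hα1 : α ≤ 1) (hy : 1 ≤ y) :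
    y ^ (α - 1) ≤ 2 / α * ((y + 1) ^ α - y ^ α) := by
  have hy0 : 0 < y := by linarith
  have h1 : y ^ (α - 1) ≤ 2 * (y + 1) ^ (α - 1) := by
    have e1 : (2 * y) ^ (α - 1) ≤ (y + 1) ^ (α - 1) :=
      Real.rpow_le_rpow_of_nonpos (by linarith) (by linarith) (by linarith)
    rw [Real.mul_rpow two_pos.le hy0.le] at e1
    have e2 : (2 : ℝ)⁻¹ ≤ 2 ^ (α - 1) := by
      rw [← Real.rpow_neg_one]
      exact Real.rpow_le_rpow_of_exponent_le one_le_two (by linarith)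
    have := Real.rpow_pos_of_pos hy0 (α - 1)
    nlinarith
  have h2 : α * (y + 1) ^ (α - 1) ≤ (y + 1) ^ α - y ^ α := by
    have e1 := rpow_one_add_le_one_add_mul_self (s := -(1 / (y + 1))) (p := α)
      (by rw [neg_le_neg_iff, div_le_one (by linarith)]; linarith) hα.le hα1
    have e2 : y ^ α = (y + 1) ^ α * (1 + -(1 / (y + 1))) ^ α := by
      rw [← Real.mul_rpow (by linarith) (by
        rw [show 1 + -(1 / (y + 1)) = y / (y + 1) by field_simp; ring]; positivity)]
      congr 1; field_simp; ring
    have e3 : (y + 1) ^ (α - 1) = (y + 1) ^ α / (y + 1) := by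
      rw [Real.rpow_sub_one (by linarith)]
    have e4 := mul_le_mul_of_nonneg_left e1 (Real.rpow_nonneg (by linarith : 0 ≤ y + 1) α)
    rw [e3, e2]
    calc α * ((y + 1) ^ α / (y + 1)) = (y + 1) ^ α - (y + 1) ^ α * (1 + α * -(1 / (y + 1))) := by
          ring
      _ ≤ _ := by linarith
  calc y ^ (α - 1) ≤ 2 * (y + 1) ^ (α - 1) := h1
    _ = 2 / α * (α * (y + 1) ^ (α - 1)) := by field_simp
    _ ≤ _ := by gcongr

variable {N : ℕ} {ζ : 𝓢(ℝ, ℂ)} {x : ℝ}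

theorem continuous_mul_kernel (hN : 0 < N) (ζ : 𝓢(ℝ, ℂ)) (x : ℝ) {τ : ℝ} (hτ : 0 < τ) :
    Continuous fun y => ζ y * (kernel N τ (x - y) : ℂ) :=
  ζ.continuous.mul (Complex.continuous_ofReal.comp
    ((continuous_kernel hN hτ).comp (continuous_const.sub continuous_id)))

/-- The function `y ↦ ζ(y) p_τ(x - y)` in `L²(a, b)`. -/
def cutKernel (a b : ℝ) (hN : 0 < N) (ζ : 𝓢(ℝ, ℂ)) (x : ℝ) {τ : ℝ} (hτ : 0 < τ) : L2i a b :=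
  contL2 a b _ (continuous_mul_kernel hN ζ x hτ)

theorem hat_cutKernel (hN : 0 < N) (hζ : ∀ y ∉ Ioo a b, ζ y = 0) {τ : ℝ} (hτ : 0 < τ) :
    hat a b (cutKernel a b hN ζ x hτ) = modConv N ζ x τ := by
  rw [cutKernel, hat_congr (coeFn_contL2 _)]
  exact funext (hat_mul_kernel hN hζ hτ)

theorem inner_cutKernel (hN : 0 < N) (hζ : ∀ y ∉ Ioo a b, ζ y = 0) {τ : ℝ} (hτ : 0 < τ)
    (f : L2i a b) :
    ⟪cutKernel a b hN ζ x hτ, f⟫_ℂ = ∫ ξ, conj (modConv N ζ x τ ξ) * hat a b f ξ := by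
  rw [inner_eq_integral_hat, hat_cutKernel hN hζ]

theorem inner_cutKernel_one (hN : 0 < N) (hζ : ∀ y ∉ Ioo a b, ζ y = 0) {τ : ℝ} (hτ : 0 < τ) :
    ⟪cutKernel a b hN ζ x hτ, oneL2 a b⟫_ℂ = conj (modConv N ζ x τ 0) := by
  rw [← hat_cutKernel (a := a) (b := b) hN hζ hτ, hat_eq_integral, ← integral_conj, L2.inner_def]
  refine integral_congr_ae ?_
  filter_upwards [coeFn_contL2 (a := a) (b := b) (f := fun _ => 1) continuous_const] with y hy
  rw [oneL2, hy]
  simp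

theorem integrable_conj_modConv_mul (hN : 0 < N) (hζ : ∀ y ∉ Ioo a b, ζ y = 0) {τ : ℝ}
    (hτ : 0 < τ) (f : L2i a b) : Integrable fun ξ => conj (modConv N ζ x τ ξ) * hat a b f ξ := by
  rw [← hat_cutKernel (a := a) (b := b) hN hζ hτ]
  exact integrable_conj_hat_mul (Lp.memLp f) (Lp.memLp _)

theorem conj_chr (c ξ : ℝ) : conj (chr c ξ) = chr (-c) ξ := by
  unfold chr
  rw [← Complex.exp_conj, map_mul, Complex.conj_ofReal, Complex.conj_I]
  congr 1; push_cast; ring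

theorem sg_eq_integral_modConv (hx : ζ x = 1) (h : ℝ) (f : L2i a b) :
    sg a b N h f x = ∫ ξ, mult N h ξ * (conj (modConv N ζ x 0 ξ) * hat a b f ξ) := by
  rw [sg_eq_integral_chr]
  congr 1; ext ξ
  rw [modConv_zero hx, conj_chr]; ring

/-- By symmetry the powers of T_h are moved one at a time onto the cut-off kernel, each move
advancing its time by h. The move from time hj costs h(hj)^{α-1} with α = 1/(4N), and the sum is of
order (h(k + 1))^α. The vector e is arbitrary because the induction step applies the hypothesis to
T_h e. -/
theorem exists_norm_sg_pow_sub_le (hN : 0 < N) (hζ : ∀ y ∉ Ioo a b, ζ y = 0) (hx : ζ x = 1) :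
    ∃ C, 0 ≤ C ∧ ∀ (h : ℝ) (hh : 0 < h) (k : ℕ), h * (k + 1) ≤ 1 → ∀ e : L2i a b,
      ‖sg a b N h ((comp a b N hN h hh ^ k) e : L2i a b) x -
        ⟪cutKernel a b hN ζ x (τ := h * (k + 1)) (by positivity), e⟫_ℂ‖ ≤
        C * (‖e‖ ^ 2 + 1) * (h * (k + 1)) ^ (1 / (4 * N : ℝ)) := by
  have hN' : (1 : ℝ) ≤ N := by exact_mod_cast hN
  obtain ⟨C, hC, H⟩ := exists_commutator_bound hN ζ x
  set α : ℝ := 1 / (4 * N : ℝ) with hα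
  have hα0 : 0 < α := by positivity
  have hα1 : α ≤ 1 := by rw [hα, div_le_one (by positivity)]; linarith
  refine ⟨C * (2 / α), by positivity, fun h hh k => ?_⟩
  have hpow : ∀ y : ℝ, 0 < y → h * (h * y) ^ (α - 1) = h ^ α * y ^ (α - 1) := fun y hy => by
    rw [Real.mul_rpow hh.le hy.le, Real.rpow_sub_one hh.ne']; field_simp
  have ih2 : ∀ (e : L2i a b) (τ : ℝ) (hτ : 0 < τ), Integrable fun ξ =>
      mult N h ξ * (conj (modConv N ζ x τ ξ) * hat a b e ξ) := fun e τ hτ =>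
    (integrable_conj_modConv_mul hN hζ hτ e).bdd_mul (c := 1)
      (continuous_mult N h).aestronglyMeasurable
      (Eventually.of_forall fun ξ => norm_mult_le_one N hh.le ξ)
  induction k with
  | zero =>
    intro hk e
    -- The first move starts from the point mass at x, hence the exceptional case τ = 0, τ' = h.
    have h1 := H h 0 h hh le_rfl hh (by simpa using hk) (Or.inr ⟨rfl, rfl⟩) e
    rw [zero_add] at h1
    have i1 : Integrable fun ξ => mult N h ξ * (conj (modConv N ζ x 0 ξ) * hat a b e ξ) := by
      refine (integrable_chr_mul hN hh e x).congr (Eventually.of_forall fun ξ => ?_)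
      simp only [modConv_zero hx, conj_chr]; ring
    have h2 : sg a b N h ((comp a b N hN h hh ^ 0) e : L2i a b) x -
        ⟪cutKernel a b hN ζ x hh, e⟫_ℂ = ∫ ξ, (mult N h ξ * conj (modConv N ζ x 0 ξ) -
          conj (modConv N ζ x h ξ)) * hat a b e ξ := by
      rw [pow_zero, one_apply_eq_self, sg_eq_integral_modConv hx, inner_cutKernel hN hζ,
        ← integral_sub i1 (integrable_conj_modConv_mul hN hζ hh e)]
      congr 1; ext ξ; ring
    simp only [Nat.cast_zero, zero_add, mul_one]
    rw [h2]
    refine h1.trans ?_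
    have h3 := hpow 1 one_pos
    rw [mul_one, Real.one_rpow, mul_one] at h3
    rw [h3]
    have h4 : 1 ≤ 2 / α := by rw [le_div_iff₀ hα0]; linarith
    calc C * h ^ α * (‖e‖ ^ 2 + 1) = C * 1 * (‖e‖ ^ 2 + 1) * h ^ α := by ring
      _ ≤ _ := by gcongr
  | succ k ih =>
    intro hk e
    simp only [Nat.cast_add, Nat.cast_one] at hk ⊢
    have hτ : 0 < h * ((k : ℝ) + 1) := by positivity
    have hτ1 : h * ((k : ℝ) + 1) ≤ 1 := by nlinarith
    have h0 := ih hτ1 (comp a b N hN h hh e)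
    have h1 := H h _ _ hh hτ.le hτ hτ1 (Or.inl rfl) e
    have h2 : ⟪cutKernel a b hN ζ x hτ, comp a b N hN h hh e⟫_ℂ -
        ⟪cutKernel a b hN ζ x (τ := h * ((k : ℝ) + 1 + 1)) (by positivity), e⟫_ℂ =
        ∫ ξ, (mult N h ξ * conj (modConv N ζ x (h * (k + 1)) ξ) -
          conj (modConv N ζ x (h * (k + 1) + h) ξ)) * hat a b e ξ := by
      have h3 : h * ((k : ℝ) + 1 + 1) = h * (k + 1) + h := by ring
      rw [inner_comp, inner_cutKernel hN hζ, hat_cutKernel hN hζ, h3, ← integral_sub (ih2 e _ hτ)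
        (integrable_conj_modConv_mul hN hζ (by positivity) e)]
      congr 1; ext ξ; ring
    rw [← h2] at h1
    have h4 : ‖comp a b N hN h hh e‖ ≤ ‖e‖ := (isPosContraction_comp hN hh).norm_le e
    rw [pow_succ (comp a b N hN h hh), mul_apply_eq_comp]
    refine (norm_sub_le_norm_sub_add_norm_sub _ _ _).trans ((add_le_add h0 h1).trans ?_)
    have h5 := rpow_sub_one_le hα0 hα1 (y := k + 1) (by linarith [Nat.cast_nonneg (α := ℝ) k])
    rw [hpow _ (by positivity), Real.mul_rpow hh.le (by positivity),
      Real.mul_rpow hh.le (by positivity)]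
    calc C * (2 / α) * (‖comp a b N hN h hh e‖ ^ 2 + 1) * (h ^ α * ((k : ℝ) + 1) ^ α) +
          C * (h ^ α * ((k : ℝ) + 1) ^ (α - 1)) * (‖e‖ ^ 2 + 1)
        ≤ C * (2 / α) * (‖e‖ ^ 2 + 1) * (h ^ α * ((k : ℝ) + 1) ^ α) +
          C * (h ^ α * (2 / α * (((k : ℝ) + 1 + 1) ^ α - ((k : ℝ) + 1) ^ α))) * (‖e‖ ^ 2 + 1) := by
          gcongr
      _ = _ := by ring

/-- Up to O(t^{1/(4N)}), uniformly in n, the value is the integral of the cut-off kernel at a time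
at most t, which tends to ζ(x) = 1. -/
theorem tendsto_limVal_zero (hN : 0 < N) (hx : x ∈ Ioo a b) :
    Tendsto (limVal a b N hN x) (𝓝[>] 0) (𝓝 1) := by
  have hN' : (1 : ℝ) ≤ N := by exact_mod_cast hN
  obtain ⟨ζ, hζx, hζ⟩ := exists_schwartz_cutoff hx
  obtain ⟨C, hC, H⟩ := exists_norm_sg_pow_sub_le hN hζ hζx
  have hα0 : (0 : ℝ) < 1 / (4 * N : ℝ) := by positivity
  set K := C * (‖oneL2 a b‖ ^ 2 + 1)
  rw [Metric.tendsto_nhdsWithin_nhds]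
  intro ε hε
  obtain ⟨δ, hδ, h1⟩ := Metric.tendsto_nhdsWithin_nhds.1 (tendsto_modConv (N := N) hζx) (ε / 4)
    (by positivity)
  have h2 : Tendsto (fun t : ℝ => K * t ^ (1 / (4 * N : ℝ))) (𝓝 0) (𝓝 0) := by
    have := (Real.continuousAt_rpow_const 0 (1 / (4 * N : ℝ)) (Or.inr hα0.le)).tendsto.const_mul K
    rwa [Real.zero_rpow hα0.ne', mul_zero] at this
  obtain ⟨δ', hδ', h3⟩ := Metric.tendsto_nhds_nhds.1 h2 (ε / 4) (by positivity)
  refine ⟨min (min δ δ') 1, by positivity, fun t ht htd => ?_⟩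
  have ht0 : 0 < t := ht
  rw [dist_zero_right, Real.norm_of_nonneg ht0.le, lt_min_iff, lt_min_iff] at htd
  obtain ⟨⟨ht1, ht2⟩, ht3⟩ := htd
  have h4 : ∀ᶠ n : ℕ in atTop, ‖stepVal a b N hN n t x - 1‖ ≤ ε / 2 := by
    filter_upwards [eventually_one_le_two_pow_mul ht0] with n hn
    have hk : 1 ≤ ⌊(2 : ℝ) ^ n * t⌋₊ := Nat.one_le_floor_iff _ |>.2 hn
    obtain ⟨k, hk'⟩ : ∃ k, ⌊(2 : ℝ) ^ n * t⌋₊ = k + 1 := ⟨_, (Nat.sub_add_cancel hk).symm⟩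
    have hkt : ((2 : ℝ) ^ n)⁻¹ * (k + 1) ≤ t := by
      have := Nat.floor_le (show 0 ≤ (2 : ℝ) ^ n * t by positivity)
      rw [hk'] at this
      rw [inv_mul_le_iff₀ (by positivity)]
      exact_mod_cast this
    have hp : 0 < ((2 : ℝ) ^ n)⁻¹ * ((k : ℝ) + 1) := by positivity
    have h5 := H ((2 : ℝ) ^ n)⁻¹ (by positivity) k (hkt.trans ht3.le) (oneL2 a b)
    rw [inner_cutKernel_one hN hζ] at h5
    have h6 : stepVal a b N hN n t x = sg a b N ((2 : ℝ) ^ n)⁻¹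
        ((comp a b N hN ((2 : ℝ) ^ n)⁻¹ (by positivity) ^ k) (oneL2 a b) : L2i a b) x := by
      simp [stepVal, hk', dyadicComp]
    rw [← h6] at h5
    have h7 : ‖conj (modConv N ζ x (((2 : ℝ) ^ n)⁻¹ * (k + 1)) 0) - 1‖ < ε / 4 := by
      rw [← map_one (starRingEnd ℂ), ← map_sub, RCLike.norm_conj, ← dist_eq_norm]
      exact h1 hp.le (by
        rw [dist_zero_right, Real.norm_of_nonneg hp.le]; exact hkt.trans_lt ht1)
    have h8 := h3 (x := t) (by rwa [dist_zero_right, Real.norm_of_nonneg ht0.le])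
    rw [dist_zero_right, Real.norm_of_nonneg (by positivity)] at h8
    have h9 : K * (((2 : ℝ) ^ n)⁻¹ * (k + 1)) ^ (1 / (4 * N : ℝ)) ≤ K * t ^ (1 / (4 * N : ℝ)) := by
      gcongr
    have := norm_sub_le_norm_sub_add_norm_sub (stepVal a b N hN n t x)
      (conj (modConv N ζ x (((2 : ℝ) ^ n)⁻¹ * (k + 1)) 0)) 1
    linarith
  have h5 := le_of_tendsto ((tendsto_limVal hN hx ht0).sub_const 1).norm h4
  rw [dist_eq_norm]
  linarith

/-! ### From signed path laws to powers of the compression. -/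

theorem positions_cons_succ (x z : ℝ) {k : ℕ} (y : Fin k → ℝ) (j : ℕ) :
    positions x (Fin.cons z y : Fin (k + 1) → ℝ) (j + 1) = positions z y j := by
  cases j with
  | zero => simp [positions]
  | succ j =>
    simp only [positions, Nat.add_lt_add_iff_right]
    split_ifs with h
    · exact Fin.cons_succ (α := fun _ => ℝ) z y ⟨j, h⟩
    · rfl

theorem continuous_positions (x : ℝ) {k : ℕ} (j : ℕ) :
    Continuous fun y : Fin k → ℝ => positions x y j := by
  cases j with
  | zero => exact continuous_const
  | succ j =>
    simp only [positions]
    split_ifs with h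
    · exact continuous_apply _
    · exact continuous_const

theorem continuous_positions_prod {k : ℕ} (j : ℕ) :
    Continuous fun p : ℝ × (Fin k → ℝ) => positions p.1 p.2 j := by
  cases j with
  | zero => exact continuous_fst
  | succ j => exact (continuous_positions 0 (j + 1)).comp continuous_snd

/-- The paths that stay in `(a, b)`. -/
def box (a b : ℝ) (k : ℕ) : Set (Fin k → ℝ) := {y | ∀ j, y j ∈ Ioo a b}

/-- The signed measure of the paths of `k` steps of length `h` that stay in `(a, b)`. -/
def stayProb (a b : ℝ) (N : ℕ) (h : ℝ) (k : ℕ) (x : ℝ) : ℝ :=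
  ∫ y in box a b k, ∏ j ∈ Finset.range k, kernel N h (positions x y j - positions x y (j + 1))

theorem stayProb_zero (N : ℕ) (h x : ℝ) : stayProb a b N h 0 x = 1 := by
  have : box a b 0 = univ := by ext y; simp [box]
  simp [stayProb, this, Measure.real, volume_pi]

variable {N : ℕ} {h : ℝ}

/-- The Markov property, by Fubini in the first coordinate. The density is signed, but it is bounded
and the box has finite volume. -/
theorem stayProb_succ (hN : 0 < N) (hh : 0 < h) (k : ℕ) (x : ℝ) :
    stayProb a b N h (k + 1) x = ∫ z in Ioo a b, kernel N h (x - z) * stayProb a b N h k z := by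
  have hk := continuous_kernel hN hh
  set M := ∫ y, ‖mult N h y‖
  have hM : ∀ y, |kernel N h y| ≤ M := abs_kernel_le hN hh
  have hM0 : 0 ≤ M := (abs_nonneg _).trans (hM 0)
  set e := (MeasurableEquiv.piFinSuccAbove (fun _ : Fin (k + 1) => ℝ) 0).symm with he
  have he' : ∀ p : ℝ × (Fin k → ℝ), e p = Fin.cons p.1 p.2 := fun p => by
    simp only [he, MeasurableEquiv.piFinSuccAbove]
    exact Fin.insertNth_zero (α := fun _ => ℝ) p.1 p.2
  have hmp : MeasurePreserving e (volume.prod volume) volume :=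
    (volume_preserving_piFinSuccAbove (fun _ : Fin (k + 1) => ℝ) 0).symm
  have hpre : e ⁻¹' (box a b (k + 1)) = Ioo a b ×ˢ box a b k := by
    ext p
    rw [mem_preimage, he', mem_prod, box, box, mem_ofPred_eq, mem_ofPred_eq, Fin.forall_fin_succ]
    simp
  have hfun : ∀ p : ℝ × (Fin k → ℝ), (∏ j ∈ Finset.range (k + 1),
      kernel N h (positions x (e p) j - positions x (e p) (j + 1))) =
      kernel N h (x - p.1) * ∏ j ∈ Finset.range k,
        kernel N h (positions p.1 p.2 j - positions p.1 p.2 (j + 1)) := fun p => by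
    rw [he', Finset.prod_range_succ', mul_comm]
    simp only [positions_cons_succ]
    rfl
  have hbox : volume (box a b k) ≠ ⊤ := by
    have : box a b k = Set.pi univ fun _ => Ioo a b := by ext y; simp [box]
    rw [this, volume_pi_pi]
    exact ENNReal.prod_ne_top fun _ _ => by simp
  have hint : IntegrableOn (fun p : ℝ × (Fin k → ℝ) => kernel N h (x - p.1) *
      ∏ j ∈ Finset.range k, kernel N h (positions p.1 p.2 j - positions p.1 p.2 (j + 1)))
      (Ioo a b ×ˢ box a b k) (volume.prod volume) := by
    refine Measure.integrableOn_of_bounded (M := M * M ^ k) ?_ ?_ ?_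
    · rw [Measure.prod_prod]
      exact ENNReal.mul_ne_top (by simp) hbox
    · refine Continuous.aestronglyMeasurable ?_
      refine (hk.comp (continuous_const.sub continuous_fst)).mul (continuous_finsetProd _ fun j _ =>
        hk.comp ((continuous_positions_prod j).sub (continuous_positions_prod (j + 1))))
    · refine Eventually.of_forall fun p => ?_
      rw [norm_mul, norm_prod]
      refine mul_le_mul (hM _) ?_ (by positivity) hM0
      calc _ ≤ ∏ _j ∈ Finset.range k, M := Finset.prod_le_prod (fun _ _ => norm_nonneg _)
            fun _ _ => hM _
        _ = M ^ k := by simp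
  rw [stayProb, ← hmp.setIntegral_preimage_emb e.measurableEmbedding, hpre]
  simp_rw [hfun]
  rw [setIntegral_prod _ hint]
  simp_rw [integral_const_mul]
  rfl

theorem stayProb_succ_eq_sg (hN : 0 < N) (hh : 0 < h) (k : ℕ) (x : ℝ) :
    (stayProb a b N h (k + 1) x : ℂ) =
      sg a b N h ((comp a b N hN h hh ^ k) (oneL2 a b) : L2i a b) x := by
  -- Both sides integrate the same kernel, so equality almost everywhere at level k gives equality
  -- at every point at level k + 1.
  have key : ∀ k, (∀ x, (stayProb a b N h (k + 1) x : ℂ) =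
      sg a b N h ((comp a b N hN h hh ^ k) (oneL2 a b) : L2i a b) x) ↔ ∀ x,
      ∫ z, (kernel N h (x - z) : ℂ) * (stayProb a b N h k z : ℂ) ∂ivl a b =
      ∫ z, (kernel N h (x - z) : ℂ) *
        ((comp a b N hN h hh ^ k) (oneL2 a b) : L2i a b) z ∂ivl a b := fun k => by
    refine forall_congr' fun x => ?_
    rw [stayProb_succ hN hh, sg_eq_integral_kernel hN hh (Lp.memLp _), ← integral_complex_ofReal]
    simp only [Complex.ofReal_mul]
  suffices ∀ x, (stayProb a b N h (k + 1) x : ℂ) =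
      sg a b N h ((comp a b N hN h hh ^ k) (oneL2 a b) : L2i a b) x from this x
  induction k with
  | zero =>
    refine (key 0).2 fun x => integral_congr_ae ?_
    filter_upwards [coeFn_contL2 (a := a) (b := b) (f := fun _ => 1) continuous_const] with y hy
    rw [pow_zero, one_apply_eq_self, oneL2, hy, stayProb_zero, Complex.ofReal_one]
  | succ k ih =>
    refine (key (k + 1)).2 fun x => integral_congr_ae ?_
    filter_upwards [coeFn_comp hN hh ((comp a b N hN h hh ^ k) (oneL2 a b))] with y hy
    rw [pow_succ', mul_apply_eq_comp, hy, ih]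

theorem stepPath_image (n : ℕ) (w : ℕ → ℝ) {t : ℝ} (ht : 0 ≤ t) :
    stepPath n w '' Icc 0 t = w '' Iic ⌊(2 : ℝ) ^ n * t⌋₊ := by
  ext v
  constructor
  · rintro ⟨s, hs, rfl⟩
    exact ⟨_, Nat.floor_le_floor (by gcongr; exact hs.2), rfl⟩
  · rintro ⟨j, hj, rfl⟩
    have h2 : (0 : ℝ) < 2 ^ n := by positivity
    refine ⟨j / 2 ^ n, ⟨by positivity, ?_⟩, ?_⟩
    · rw [div_le_iff₀ h2, mul_comm]
      exact (Nat.le_floor_iff (by positivity)).1 hj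
    · rw [stepPath, mul_div_cancel₀ _ h2.ne', Nat.floor_natCast]

theorem stepProb_eq_stayProb (N : ℕ) {x : ℝ} (hx : x ∈ Ioo a b) (n : ℕ) {t : ℝ} (ht : 0 ≤ t) :
    stepProb N a b x n t = stayProb a b N ((2 : ℝ) ^ n)⁻¹ ⌊(2 : ℝ) ^ n * t⌋₊ x := by
  set k := ⌊(2 : ℝ) ^ n * t⌋₊ with hk
  have hset : {y : Fin k → ℝ | a < runMin n (positions x y) t ∧
      runMin n (positions x y) t ≤ runMax n (positions x y) t ∧
      runMax n (positions x y) t < b} = box a b k := by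
    ext y
    have hfin : (positions x y '' Iic k).Finite := (finite_Iic k).image _
    have hne : (positions x y '' Iic k).Nonempty := nonempty_Iic.image _
    rw [mem_ofPred_eq, runMin, runMax, stepPath_image n _ ht, ← hk, hfin.lt_csInf_iff hne,
      hfin.csSup_lt_iff hne, forall_mem_image, forall_mem_image]
    constructor
    · rintro ⟨h1, -, h2⟩ j
      have e : positions x y (j + 1) = y j := by simp [positions]
      rw [← e]
      exact ⟨h1 j.2, h2 j.2⟩
    · intro hy
      have h3 : ∀ j, j ≤ k → positions x y j ∈ Ioo a b := fun j hj => by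
        cases j with
        | zero => exact hx
        | succ j =>
          simp only [positions, dif_pos (show j < k from hj)]
          exact hy _
      exact ⟨fun j hj => (h3 j hj).1, csInf_le_csSup hne hfin.bddBelow hfin.bddAbove,
        fun j hj => (h3 j hj).2⟩
  rw [stepProb, pseudoProb, ← hk, hset, stayProb]
  congr 1; ext y
  refine Finset.prod_congr rfl fun j _ => ?_
  rw [transition]
  congr 1
  push_cast; ring

theorem stepProb_eq_stepVal (hN : 0 < N) {x : ℝ} (hx : x ∈ Ioo a b) (n : ℕ) {t : ℝ} (ht : 0 ≤ t) :
    (stepProb N a b x n t : ℂ) = stepVal a b N hN n t x := by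
  rw [stepProb_eq_stayProb N hx n ht, stepVal]
  split_ifs with h
  · rw [h, stayProb_zero, Complex.ofReal_one]
  · obtain ⟨k, hk⟩ := Nat.exists_eq_succ_of_ne_zero h
    rw [hk, Nat.succ_eq_add_one, stayProb_succ_eq_sg hN (by positivity), Nat.add_sub_cancel]
    rfl

/-! ### Injectivity of the Laplace transform on continuous functions. -/

theorem integral_mul_eval_exp_eq_zero {f : ℝ → ℝ}
    (hi : ∀ lam : ℝ, 0 < lam → IntegrableOn (fun t => f t * Real.exp (-lam * t)) (Ioi 0))
    (h0 : ∀ lam : ℝ, 0 < lam → ∫ t in Ioi (0 : ℝ), f t * Real.exp (-lam * t) = 0)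
    (p : Polynomial ℝ) :
    IntegrableOn (fun t => f t * Real.exp (-1 * t) * p.eval (Real.exp (-t))) (Ioi 0) ∧
      ∫ t in Ioi (0 : ℝ), f t * Real.exp (-1 * t) * p.eval (Real.exp (-t)) = 0 := by
  have hmon : ∀ (n : ℕ) (c t : ℝ), f t * Real.exp (-1 * t) *
      (Polynomial.monomial n c).eval (Real.exp (-t)) =
      c * (f t * Real.exp (-(n + 1 : ℝ) * t)) := fun n c t => by
    rw [Polynomial.eval_monomial, ← Real.exp_nat_mul, mul_left_comm, mul_assoc,
      ← Real.exp_add]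
    congr 3; ring_nf
  induction p using Polynomial.induction_on' with
  | add p q hp hq =>
    simp only [Polynomial.eval_add, mul_add]
    exact ⟨hp.1.add hq.1, by rw [integral_add hp.1 hq.1, hp.2, hq.2, add_zero]⟩
  | monomial n c =>
    simp_rw [hmon]
    exact ⟨(hi _ (by positivity)).const_mul _, by
      rw [integral_const_mul, h0 _ (by positivity), mul_zero]⟩

theorem integral_mul_comp_exp_eq_zero {f : ℝ → ℝ}
    (hi : ∀ lam : ℝ, 0 < lam → IntegrableOn (fun t => f t * Real.exp (-lam * t)) (Ioi 0))
    (h0 : ∀ lam : ℝ, 0 < lam → ∫ t in Ioi (0 : ℝ), f t * Real.exp (-lam * t) = 0)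
    {φ : ℝ → ℝ} (hφ : Continuous φ) :
    ∫ t in Ioi (0 : ℝ), f t * Real.exp (-1 * t) * φ (Real.exp (-t)) = 0 := by
  have hg := hi 1 one_pos
  set G := ∫ t in Ioi (0 : ℝ), ‖f t * Real.exp (-1 * t)‖ with hG
  have hG0 : 0 ≤ G := integral_nonneg fun _ => norm_nonneg _
  refine eq_of_forall_dist_le fun ε hε => ?_
  obtain ⟨p, hp⟩ := exists_polynomial_near_of_continuousOn 0 1 φ hφ.continuousOn (ε / (G + 1))
    (by positivity)
  obtain ⟨ip, hp0⟩ := integral_mul_eval_exp_eq_zero hi h0 p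
  have hb : ∀ t ∈ Ioi (0 : ℝ), ‖f t * Real.exp (-1 * t) * φ (Real.exp (-t)) -
      f t * Real.exp (-1 * t) * p.eval (Real.exp (-t))‖ ≤
      ε / (G + 1) * ‖f t * Real.exp (-1 * t)‖ := fun t (ht : 0 < t) => by
    rw [← mul_sub, norm_mul, mul_comm, norm_sub_rev]
    gcongr
    exact (hp _ ⟨(Real.exp_pos _).le, Real.exp_le_one_iff.2 (by linarith)⟩).le
  have hb' : ∀ᵐ t ∂(volume.restrict (Ioi (0 : ℝ))), ‖f t * Real.exp (-1 * t) * φ (Real.exp (-t)) -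
      f t * Real.exp (-1 * t) * p.eval (Real.exp (-t))‖ ≤
      ε / (G + 1) * ‖f t * Real.exp (-1 * t)‖ :=
    (ae_restrict_iff' measurableSet_Ioi).2 (Eventually.of_forall hb)
  have id : IntegrableOn (fun t => f t * Real.exp (-1 * t) * φ (Real.exp (-t)) -
      f t * Real.exp (-1 * t) * p.eval (Real.exp (-t))) (Ioi 0) :=
    (hg.norm.const_mul _).mono' ((hg.aestronglyMeasurable.mul
      (hφ.comp (by fun_prop)).aestronglyMeasurable).sub ip.aestronglyMeasurable) hb'
  have ic : IntegrableOn (fun t => f t * Real.exp (-1 * t) * φ (Real.exp (-t))) (Ioi 0) :=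
    (id.add ip).congr (Eventually.of_forall fun t => by simp)
  have h1 := norm_integral_le_of_norm_le (hg.norm.const_mul (ε / (G + 1))) hb'
  rw [integral_sub ic ip, hp0, sub_zero, integral_const_mul, ← hG] at h1
  rw [dist_zero_right]
  refine h1.trans ?_
  rw [div_mul_eq_mul_div, div_le_iff₀ (by positivity)]
  nlinarith

/-- In the variable z = e^{-t} the vanishing transforms say that all polynomial moments vanish,
hence by Weierstrass all integrals against continuous functions of z. These include the test
functions on (0, ∞), so f vanishes almost everywhere, and everywhere by continuity. -/
theorem eq_zero_of_laplace_eq_zero {f : ℝ → ℝ} (hf : ContinuousOn f (Ici 0))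
    (hi : ∀ lam : ℝ, 0 < lam → IntegrableOn (fun t => f t * Real.exp (-lam * t)) (Ioi 0))
    (h0 : ∀ lam : ℝ, 0 < lam → ∫ t in Ioi (0 : ℝ), f t * Real.exp (-lam * t) = 0)
    {t : ℝ} (ht : 0 ≤ t) : f t = 0 := by
  have hg : ∀ᵐ t, t ∈ Ioi (0 : ℝ) → f t * Real.exp (-1 * t) = 0 := by
    refine isOpen_Ioi.ae_eq_zero_of_integral_contDiff_smul_eq_zero
      (hi 1 one_pos).locallyIntegrableOn fun ψ hψ hψc hψs => ?_
    obtain ⟨M, hM⟩ := hψc.isCompact.bddAbove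
    have hM' : ∀ t, M < t → ψ t = 0 := fun t ht =>
      image_eq_zero_of_notMem_tsupport fun h => absurd (hM h) (not_le.2 ht)
    -- The support of ψ is bounded by M, so the function already vanishes for 0 < z < e^{-M} and the
    -- extension by 0 is continuous.
    have hφ : Continuous fun z => if z ≤ 0 then 0 else ψ (-Real.log z) := by
      refine continuous_iff_continuousAt.2 fun z => ?_
      rcases lt_or_ge 0 z with hz | hz
      · have : (fun z => if z ≤ 0 then 0 else ψ (-Real.log z)) =ᶠ[𝓝 z]
            fun z => ψ (-Real.log z) := by
          filter_upwards [lt_mem_nhds hz] with w hw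
          rw [if_neg (not_le.2 hw)]
        exact (hψ.continuous.continuousAt.comp
          (Real.continuousAt_log hz.ne').neg).congr this.symm
      · have : (fun z => if z ≤ 0 then 0 else ψ (-Real.log z)) =ᶠ[𝓝 z] fun _ => 0 := by
          filter_upwards [gt_mem_nhds (hz.trans_lt (Real.exp_pos (-M)))] with w hw
          split_ifs with h
          · rfl
          · refine hM' _ ?_
            have := (Real.log_lt_iff_lt_exp (not_le.1 h)).2 hw
            linarith
        exact continuousAt_const.congr this.symm
    have h1 := integral_mul_comp_exp_eq_zero hi h0 hφ
    have h2 : ∀ t, ψ t • (f t * Real.exp (-1 * t)) =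
        f t * Real.exp (-1 * t) * (if Real.exp (-t) ≤ 0 then 0 else ψ (-Real.log (Real.exp (-t)))) :=
      fun t => by rw [if_neg (not_le.2 (Real.exp_pos _)), Real.log_exp, neg_neg, smul_eq_mul, mul_comm]
    rw [← h1, ← integral_indicator measurableSet_Ioi]
    congr 1; ext t
    by_cases h : t ∈ Ioi (0 : ℝ)
    · rw [indicator_of_mem h, h2]
    · rw [indicator_of_notMem h, image_eq_zero_of_notMem_tsupport fun h' => h (hψs h'), zero_smul]
  have h1 : EqOn f (fun _ => 0) (Ioi 0) := by
    refine Measure.eqOn_open_of_ae_eq (μ := volume) ?_ isOpen_Ioi (hf.mono Ioi_subset_Ici_self)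
      continuousOn_const
    refine (ae_restrict_iff' measurableSet_Ioi).2 ?_
    filter_upwards [hg] with t h ht
    exact (mul_eq_zero.1 (h ht)).resolve_right (Real.exp_pos _).ne'
  have h2 : EqOn f (fun _ => 0) (Ici 0) :=
    h1.of_subset_closure hf continuousOn_const Ioi_subset_Ici_self (by rw [closure_Ioi])
  exact h2 ht

/-! ### The pseudo-probability and the exit function. -/

variable {N : ℕ} {x : ℝ}

theorem stepProb_at_zero (hN : 0 < N) (hx : x ∈ Ioo a b) (n : ℕ) : stepProb N a b x n 0 = 1 := by
  have := stepProb_eq_stepVal hN hx n le_rfl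
  simp only [stepVal, mul_zero, Nat.floor_zero, if_true] at this
  exact_mod_cast this

theorem tendsto_stepProb (hN : 0 < N) (hx : x ∈ Ioo a b) {t : ℝ} (ht : 0 < t) :
    Tendsto (fun n => stepProb N a b x n t) atTop (𝓝 (limVal a b N hN x t).re) := by
  have h := (Complex.continuous_re.tendsto _).comp (tendsto_limVal hN hx ht)
  refine h.congr fun n => ?_
  rw [Function.comp_apply, ← stepProb_eq_stepVal hN hx n ht.le, Complex.ofReal_re]

theorem minMaxProb_zero (hN : 0 < N) (hx : x ∈ Ioo a b) : minMaxProb N a b x 0 = 1 :=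
  Tendsto.limUnder_eq (by simp_rw [stepProb_at_zero hN hx]; exact tendsto_const_nhds)

theorem minMaxProb_eq_re (hN : 0 < N) (hx : x ∈ Ioo a b) {t : ℝ} (ht : 0 < t) :
    minMaxProb N a b x t = (limVal a b N hN x t).re :=
  (tendsto_stepProb hN hx ht).limUnder_eq

theorem minMaxProb_eq_limVal (hN : 0 < N) (hx : x ∈ Ioo a b) {t : ℝ} (ht : 0 < t) :
    (minMaxProb N a b x t : ℂ) = limVal a b N hN x t := by
  have h := (Complex.continuous_ofReal.tendsto _).comp (tendsto_stepProb hN hx ht)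
  rw [minMaxProb_eq_re hN hx ht]
  refine tendsto_nhds_unique h ((tendsto_limVal hN hx ht).congr fun n => ?_)
  rw [Function.comp_apply, stepProb_eq_stepVal hN hx n ht.le]

theorem tendsto_minMaxProb (hN : 0 < N) (hx : x ∈ Ioo a b) {t : ℝ} (ht : 0 ≤ t) :
    Tendsto (fun n => stepProb N a b x n t) atTop (𝓝 (minMaxProb N a b x t)) := by
  rcases ht.eq_or_lt with rfl | ht
  · simp_rw [minMaxProb_zero hN hx, stepProb_at_zero hN hx]; exact tendsto_const_nhds
  · rw [minMaxProb_eq_re hN hx ht]; exact tendsto_stepProb hN hx ht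

theorem continuousOn_minMaxProb (hN : 0 < N) (hx : x ∈ Ioo a b) :
    ContinuousOn (minMaxProb N a b x) (Ici 0) := by
  have h1 : EqOn (minMaxProb N a b x) (fun t => (limVal a b N hN x t).re) (Ioi 0) :=
    fun t ht => minMaxProb_eq_re hN hx ht
  intro t (ht : 0 ≤ t)
  rcases ht.eq_or_lt with rfl | ht
  -- At t = 0 no step has been made and the value is 1 for every mesh; the limit from the right is
  -- also 1 by `tendsto_limVal_zero`.
  · rw [← continuousWithinAt_Ioi_iff_Ici, ContinuousWithinAt, minMaxProb_zero hN hx]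
    have := (Complex.continuous_re.tendsto _).comp (tendsto_limVal_zero hN hx)
    rw [Complex.one_re] at this
    exact this.congr' (h1.symm.eventuallyEq_nhdsWithin)
  · refine ContinuousAt.continuousWithinAt ?_
    exact (((Complex.continuous_re.comp_continuousOn (continuousOn_limVal hN hx)).congr
      h1).continuousAt (Ioi_mem_nhds ht))

theorem exp_mul_limVal_eq (hN : 0 < N) (hx : x ∈ Ioo a b) (lam : ℝ) {t : ℝ} (ht : 0 < t) :
    (Real.exp (-lam * t) : ℂ) * limVal a b N hN x t =
      ((minMaxProb N a b x t * Real.exp (-lam * t) : ℝ) : ℂ) := by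
  rw [← minMaxProb_eq_limVal hN hx ht, mul_comm, Complex.ofReal_mul]

theorem integrableOn_minMaxProb (hN : 0 < N) (hx : x ∈ Ioo a b) {lam : ℝ} (hlam : 0 < lam) :
    IntegrableOn (fun t => minMaxProb N a b x t * Real.exp (-lam * t)) (Ioi 0) := by
  have h := (integrableOn_exp_mul_limVal hN hx hlam).re
  refine IntegrableOn.congr_fun h (fun t ht => ?_) measurableSet_Ioi
  simp only [exp_mul_limVal_eq hN hx lam ht]
  exact Complex.ofReal_re _

theorem integral_minMaxProb (hN : 0 < N) (hx : x ∈ Ioo a b) {lam : ℝ} (hlam : 0 < lam) :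
    ((∫ t in Ioi (0 : ℝ), minMaxProb N a b x t * Real.exp (-lam * t) : ℝ) : ℂ) =
      resolventSol N a b lam x := by
  rw [← integral_exp_mul_limVal hN hx hlam, ← integral_complex_ofReal]
  exact setIntegral_congr_fun measurableSet_Ioi fun t ht => (exp_mul_limVal_eq hN hx lam ht).symm

theorem isExitFunction_one_sub_minMaxProb (hN : 0 < N) (hx : x ∈ Ioo a b) :
    IsExitFunction N a b x fun t => 1 - minMaxProb N a b x t where
  continuousOn := continuousOn_const.sub (continuousOn_minMaxProb hN hx)
  integrable lam hlam := by
    simp_rw [sub_mul, one_mul]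
    exact (exp_neg_integrableOn_Ioi 0 hlam).sub (integrableOn_minMaxProb hN hx hlam)
  laplace lam hlam := by
    have hD := Delta_ne_zero (hx.1.trans hx.2) hN hlam
    have hl : (lam : ℂ) ≠ 0 := by exact_mod_cast hlam.ne'
    simp_rw [sub_mul, one_mul]
    rw [integral_sub (exp_neg_integrableOn_Ioi 0 hlam) (integrableOn_minMaxProb hN hx hlam),
      Complex.ofReal_sub, integral_minMaxProb hN hx hlam, integral_exp_mul_Ioi (by linarith),
      resolventSol]
    push_cast
    rw [mul_zero, Complex.exp_zero]
    field_simp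
    ring

theorem IsExitFunction.eq {J J' : ℝ → ℝ} (hJ : IsExitFunction N a b x J)
    (hJ' : IsExitFunction N a b x J') {t : ℝ} (ht : 0 ≤ t) : J t = J' t := by
  refine sub_eq_zero.1 (eq_zero_of_laplace_eq_zero (f := fun t => J t - J' t)
    (hJ.continuousOn.sub hJ'.continuousOn) (fun lam hlam => ?_) (fun lam hlam => ?_) ht)
  · simp_rw [sub_mul]
    exact (hJ.integrable lam hlam).sub (hJ'.integrable lam hlam)
  · simp_rw [sub_mul]
    rw [integral_sub (hJ.integrable lam hlam) (hJ'.integrable lam hlam), sub_eq_zero]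
    exact Complex.ofReal_injective ((hJ.laplace lam hlam).trans (hJ'.laplace lam hlam).symm)

end PseudoBM

end

theorem mainTheorem4 (N : ℕ) (hN : 1 < N) (a b x : ℝ) (hx : x ∈ Set.Ioo a b) :
    -- the pseudo-probability is well defined (the defining limit exists)
    (∀ t : ℝ, 0 ≤ t →
      Tendsto (fun n : ℕ => PseudoBM.stepProb N a b x n t) atTop
        (𝓝 (PseudoBM.minMaxProb N a b x t))) ∧
    -- the denominator does not vanish
    (∀ lam : ℝ, 0 < lam → PseudoBM.Delta N a b lam ≠ 0) ∧
    -- the function `J(·; x)` exists, and the pseudo-probability is `1 - J(t; x)`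
    (∃ J : ℝ → ℝ, PseudoBM.IsExitFunction N a b x J) ∧
    (∀ J : ℝ → ℝ, PseudoBM.IsExitFunction N a b x J →
      ∀ t : ℝ, 0 ≤ t → PseudoBM.minMaxProb N a b x t = 1 - J t) ∧
    -- the Laplace transform in `t` of the pseudo-probability
    (∀ lam : ℝ, 0 < lam →
      IntegrableOn (fun t => PseudoBM.minMaxProb N a b x t * Real.exp (-lam * t)) (Set.Ioi 0) ∧
      ((∫ t in Set.Ioi (0 : ℝ), PseudoBM.minMaxProb N a b x t * Real.exp (-lam * t) : ℝ) : ℂ) =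
        1 / (lam : ℂ) *
          ((PseudoBM.Delta N a b lam - PseudoBM.DeltaPlus N a b lam x 0
            - PseudoBM.DeltaMinus N a b lam x 0) / PseudoBM.Delta N a b lam)) := by
  have hN0 : 0 < N := by omega
  have hab : a < b := hx.1.trans hx.2
  refine ⟨fun t ht => PseudoBM.tendsto_minMaxProb hN0 hx ht,
    fun lam hlam => PseudoBM.Delta_ne_zero hab hN0 hlam,
    ⟨_, PseudoBM.isExitFunction_one_sub_minMaxProb hN0 hx⟩, fun J hJ t ht => ?_,
    fun lam hlam => ⟨PseudoBM.integrableOn_minMaxProb hN0 hx hlam,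
      PseudoBM.integral_minMaxProb hN0 hx hlam⟩⟩
  rw [hJ.eq (PseudoBM.isExitFunction_one_sub_minMaxProb hN0 hx) ht, sub_sub_cancel]
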